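/- Let $A$ be a group with a finite presentation $\langle \mathcal A:\mathcal R\rangle$, let $\phi:A\to A$ be a monomorphism, and for each $a\in\mathcal A$ let $w_a$ be a word in $\mathcal A^{\pm1}$ representing $\phi(a)$. Let $G$ be the ascending HNN extension of $A$ with the presentation $$\mathcal P=\langle t,\mathcal A:\mathcal R,\ t^{-1}at=w_a\ \text{ for all } a\in\mathcal A\rangle ,$$ identify $A$ with the subgroup of $G$ generated by $\mathcal A$, and let $X$ be the Cayley 2-complex of $\mathcal P$: its vertex set is $G$, for every $g\in G$ and every generator $s\in\{t\}\cup\mathcal A$ there is an edge from $g$ to $gs$ labelled $s$, and for every $g\in G$ and every relator $r$ there is a 2-cell attached along the edge loop at $g$ that spells $r$. For integers $M,N\ge 0$ let $D=t^NA\{1,t^{-1},\dots,t^{-M}\}$, a set of vertices of $X$. For a set $V$ of vertices write $\langle V\rangle$ for the subcomplex of $X$ spanned by $V$, that is, the union of all closed cells whose vertices all lie in $V$. Then, for all $M,N\ge 0$: (1) every loop in the complement $X-\langle D\rangle$ is homotopic, relative to its base point, to a constant loop within $X-\langle D\rangle$; (2) every loop in $\langle G-D\rangle$, the largest subcomplex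 of $X$ that contains no vertex of $D$, is homotopic, relative to its base point, to a constant loop within $\langle G-D\rangle$. -/

import Mathlib

/-- Words in the letters `s`, `s⁻¹` for `s : S`: `(s, true)` is `s` and `(s, false)` is `s⁻¹`,
as in `FreeGroup`. -/
abbrev GenWord (S : Type*) := List (S × Bool)

/-- The group `⟨S : R⟩`, for a set `R` of words. -/
abbrev PresGroup {S : Type*} (R : Set (GenWord S)) : Type _ :=
  PresentedGroup (FreeGroup.mk '' R)

namespace PresGroup

/-- The element of `⟨S : R⟩` spelled by a word. -/
def val {S : Type*} (R : Set (GenWord S)) (l : GenWord S) : PresGroup R :=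
  PresentedGroup.mk (FreeGroup.mk '' R) (FreeGroup.mk l)

/-- The element of `⟨S : R⟩` given by a generator. -/
def gen {S : Type*} (R : Set (GenWord S)) (s : S) : PresGroup R :=
  PresentedGroup.of s

end PresGroup

/-! ### The Cayley 2-complex of a presentation, as a topological space -/

namespace Cayley

/-- The disjoint union of the closed cells: a point for every `g : G`, an interval for every `g` and
every generator, a closed disc for every `g` and every relator. The `Sigma` types carry the
topology of a disjoint union, so the sets of indices are discrete. -/
abbrev Cells {S : Type*} (R : Set (GenWord S)) : Type _ :=
  (Σ _ : PresGroup R, Unit) ⊕ (Σ _ : PresGroup R × S, unitInterval) ⊕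
    (Σ _ : PresGroup R × R, Metric.closedBall (0 : ℂ) 1)

section
variable {S : Type*} (R : Set (GenWord S))

/-- The 0-cell `g`. -/
def cell0 (g : PresGroup R) : Cells R := Sum.inl ⟨g, ()⟩

/-- The point with parameter `u` on the 1-cell at `g` labelled `s`. -/
def cell1 (g : PresGroup R) (s : S) (u : unitInterval) : Cells R := Sum.inr (Sum.inl ⟨(g, s), u⟩)

/-- The point `z` of the 2-cell at `g` of the relator `r`. -/
def cell2 (g : PresGroup R) (r : R) (z : Metric.closedBall (0 : ℂ) 1) : Cells R :=
  Sum.inr (Sum.inr ⟨(g, r), z⟩)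

/-- The point with parameter `u` on the edge that starts at `g` and is read as the given letter:
for the letter `s` this is the 1-cell from `g` to `g * s`, for the letter `s⁻¹` it is the 1-cell
from `g * s⁻¹` to `g`, traversed backwards. -/
def letterPoint (g : PresGroup R) : S × Bool → unitInterval → Cells R
  | (s, true), u => cell1 R g s u
  | (s, false), u => cell1 R (g * (PresGroup.gen R s)⁻¹) s (unitInterval.symm u)

/-- The point `exp (2 π i θ)` of the boundary of the unit disc. -/
noncomputable def circlePoint (θ : ℝ) : Metric.closedBall (0 : ℂ) 1 :=
  ⟨Complex.exp ((2 * Real.pi * θ : ℝ) * Complex.I), by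
    rw [mem_closedBall_zero_iff, Complex.norm_exp_ofReal_mul_I]⟩

/-- The identifications: the 1-cell at `g` labelled `s` runs from `g` to `g * s`, and the boundary
of the 2-cell at `g` of the relator `r` runs, at constant speed, through the edge path that starts
at `g` and spells `r` (the constant path, if `r` is the empty word). -/
inductive Glue : Cells R → Cells R → Prop
  | source (g : PresGroup R) (s : S) : Glue (cell1 R g s 0) (cell0 R g)
  | target (g : PresGroup R) (s : S) : Glue (cell1 R g s 1) (cell0 R (g * PresGroup.gen R s))
  | boundary (g : PresGroup R) (r : R) (i : Fin r.1.length) (u : unitInterval) :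
      Glue (cell2 R g r (circlePoint (((i : ℕ) + (u : ℝ)) / (r.1.length : ℝ))))
        (letterPoint R (g * PresGroup.val R (r.1.take i)) (r.1.get i) u)
  | constant (g : PresGroup R) (r : R) (hr : r.1 = []) (z : Metric.closedBall (0 : ℂ) 1)
      (hz : ‖(z : ℂ)‖ = 1) : Glue (cell2 R g r z) (cell0 R g)

/-- The Cayley 2-complex of the presentation `⟨S : R⟩`, with the quotient topology. -/
def Complex2 : Type _ := Quot (Glue R)

instance : TopologicalSpace (Complex2 R) := inferInstanceAs (TopologicalSpace (Quot (Glue R)))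

/-- The subcomplex of the Cayley 2-complex spanned by a set `V` of vertices: the union of all
closed cells of which every vertex is in `V`. -/
def spanned (V : Set (PresGroup R)) : Set (Complex2 R) :=
  {x | (∃ g ∈ V, x = Quot.mk (Glue R) (cell0 R g)) ∨
    (∃ g s u, g ∈ V ∧ g * PresGroup.gen R s ∈ V ∧ x = Quot.mk (Glue R) (cell1 R g s u)) ∨
    (∃ g, ∃ r : R, ∃ z, (∀ i ≤ r.1.length, g * PresGroup.val R (r.1.take i) ∈ V) ∧
      x = Quot.mk (Glue R) (cell2 R g r z))}

end

end Cayley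

/-- Every loop in the subspace `Y` (with any base point) is homotopic in `Y`, relative to its
base point, to a constant loop. -/
def LoopsNullHomotopicIn {X : Type*} [TopologicalSpace X] (Y : Set X) : Prop :=
  ∀ (x : Y) (α : Path x x), α.Homotopic (Path.refl x)

/-! ### Ascending HNN presentations -/

namespace AscHNN

/-- A word in the generators of the base, as a word in the generators of the HNN presentation
(`some a` is the generator `a` of the base, `none` is the stable letter `t`). -/
def baseWord {S : Type*} (l : GenWord S) : GenWord (Option S) :=
  l.map fun p => (some p.1, p.2)

/-- The word `t⁻¹ a t w⁻¹`. -/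
def conjWord {S : Type*} (a : S) (w : GenWord S) : GenWord (Option S) :=
  (none, false) :: (some a, true) :: (none, true) :: baseWord (FreeGroup.invRev w)

/-- The relators of the HNN presentation `⟨t, S : R, t⁻¹ a t = w a for all a ∈ S⟩`. -/
def relators {S : Type*} (R : Set (GenWord S)) (w : S → GenWord S) :
    Set (GenWord (Option S)) :=
  baseWord '' R ∪ Set.range fun a => conjWord a (w a)

section
variable {S : Type*} (R : Set (GenWord S)) (w : S → GenWord S)

/-- The stable letter in the group of the HNN presentation. -/
def stable : PresGroup (relators R w) := PresGroup.gen (relators R w) none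

/-- The base: the subgroup generated by the generators other than the stable letter. -/
def base : Subgroup (PresGroup (relators R w)) :=
  Subgroup.closure (Set.range fun a : S => PresGroup.gen (relators R w) (some a))

/-- The set `t ^ N A {1, t⁻¹, …, t⁻ᴹ}`, where `A` is the base. -/
def removedSet (N M : ℕ) : Set (PresGroup (relators R w)) :=
  {g | ∃ a ∈ base R w, ∃ m ≤ M, g = stable R w ^ N * a * (stable R w ^ m)⁻¹}

end

end AscHNN

/-! The only property of `D` that matters is that `D`, and hence its complement, is a union of left
cosets of `A`. For every such union `V`, and every part `Y` of `X` that `Fits` it, all loops in `Y`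
are null-homotopic (`AscHNN.loopsNullHomotopicIn`). Geometrically, the left cosets are the vertices
of the Bass–Serre tree, with one coset `gtA` above each `gA` because `a t = t φ(a)`. Over a subtree,
`X` consists of copies of the simply connected Cayley complex of `A`, joined by strips.

The argument uses normal forms instead of van Kampen. Consider the homotopy classes of paths in `Y`
from a base vertex to vertices, that is, the vertices of a universal cover. Appending an edge with a
given label is a partial injection of this set (`Step`). A relator that bounds a 2-cell in `Y` acts
trivially (`run_relator`), so `A` acts from the right (`actHom`). The 2-cells of `t⁻¹ a t w_a⁻¹`
carry this action up along `t`-edges (`exists_commutes`). Hence the classes of paths of the form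
`t^m a t^{-n}` are closed under appending and removing edges (`Reach.step_iff`). If such a path is
closed, the exponent sum of `t` gives `m = n`, so `a` is trivial in `G`. It is then trivial in the
base group, which embeds in `G` by `ofBase_injective`, and the path retraces itself (`Reach.eq`).

It remains to pass from edge paths to continuous loops. A set of classes that is stable under edges
extends to classes of paths ending anywhere in `Y`, and every path preserves the extension
(`Stable.moves`). Subdivision (`Moves.of_cover`) reduces this to short paths. These lie in an open
2-cell or miss all centers, and in the second case they are pushed into the graph. There they are
cut again into pieces in an open edge or in the star of a vertex. So the class of any loop at a
vertex lies in every stable set that contains the trivial class.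

Both subspaces of the theorem fit the complement of `D`. For the spanned subcomplex this is
`fits_spanned`. For the complement of `⟨D⟩` it holds because `⟨D⟩` contains a closed 2-cell, misses
it, or meets it in a boundary arc. A disc without such an arc retracts onto the rest of its boundary
(`exists_retraction_compl_arc`). -/

open Topology unitInterval Set.Icc

local notation "𝔻" => Metric.closedBall (0 : ℂ) 1

/-! ### Path classes and subdivision of paths -/

section PathClasses

variable {Y : Type*} [TopologicalSpace Y]

/-- A triangle of paths that lifts to a simply connected space commutes up to homotopy. -/
theorem Path.Homotopic.Quotient.trans_eq_of_lift {E : Type*} [TopologicalSpace E]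
    [SimplyConnectedSpace E] {f : E → Y} (hf : Continuous f) {x y z : Y} {a b c : E}
    {p : Path x y} {q : Path y z} {r : Path x z} (p' : Path a b) (q' : Path b c) (r' : Path a c)
    (hp : ∀ t, p t = f (p' t)) (hq : ∀ t, q t = f (q' t)) (hr : ∀ t, r t = f (r' t)) :
    (Quotient.mk p).trans (Quotient.mk q) = Quotient.mk r := by
  obtain rfl : x = f a := by rw [← p.source, hp, p'.source]
  obtain rfl : y = f b := by rw [← p.target, hp, p'.target]
  obtain rfl : z = f c := by rw [← q.target, hq, q'.target]
  obtain rfl : p = p'.map hf := Path.ext (funext hp)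
  obtain rfl : q = q'.map hf := Path.ext (funext hq)
  obtain rfl : r = r'.map hf := Path.ext (funext hr)
  rw [← Quotient.mk_trans, ← Path.map_trans]
  exact Quotient.eq.2 ((SimplyConnectedSpace.paths_homotopic _ _).map ⟨f, hf⟩)

instance : SimplyConnectedSpace I :=
  have : ContractibleSpace I := (convex_Icc (0 : ℝ) 1).contractibleSpace ⟨0, by simp⟩
  inferInstance

instance : SimplyConnectedSpace (I × I) :=
  have : ContractibleSpace I := (convex_Icc (0 : ℝ) 1).contractibleSpace ⟨0, by simp⟩
  inferInstance

/-- The boundary of a continuous square commutes up to homotopy. -/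
theorem Path.Homotopic.Quotient.trans_eq_trans_of_square {F : I × I → Y} (hF : Continuous F)
    {x y x' y' : Y} {p : Path x y} {q : Path x' y'} {a : Path x x'} {b : Path y y'}
    (hp : ∀ t, p t = F (t, 0)) (hq : ∀ t, q t = F (t, 1)) (ha : ∀ s, a s = F (0, s))
    (hb : ∀ s, b s = F (1, s)) :
    (Quotient.mk p).trans (Quotient.mk b) = (Quotient.mk a).trans (Quotient.mk q) := by
  let i : Path (0 : I) 1 := ⟨⟨id, continuous_id⟩, rfl, rfl⟩
  have hx : x = F (0, 0) := by rw [← ha, a.source]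
  have hy : y' = F (1, 1) := by rw [← hb, b.target]
  -- Both routes around the square are compared with its diagonal.
  let d : Path x y' := ((i.prod i).map hF).cast hx hy
  rw [trans_eq_of_lift hF (r := d) (i.prod (Path.refl 0)) ((Path.refl 1).prod i) (i.prod i)
      hp hb fun _ => rfl,
    trans_eq_of_lift hF (r := d) ((Path.refl 0).prod i) (i.prod (Path.refl 1)) (i.prod i)
      ha hq fun _ => rfl]

theorem Path.Homotopic.Quotient.mk_eq_refl {x : Y} {p : Path x x} (hp : ∀ t, p t = x) :
    Quotient.mk p = Quotient.refl x := by
  rw [← Quotient.mk_refl]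
  exact congrArg _ (Path.ext (funext hp))

variable {x₀ : Y}

/-- Appending the path class `q` maps the set `T` of path classes that start at `x₀` to itself. -/
def Moves (T : ∀ y, Path.Homotopic.Quotient x₀ y → Prop) {x y : Y}
    (q : Path.Homotopic.Quotient x y) : Prop :=
  ∀ k, T x k → T y (k.trans q)

namespace Moves

variable {T : ∀ y, Path.Homotopic.Quotient x₀ y → Prop} {x y z : Y}

theorem refl (x : Y) : Moves T (Path.Homotopic.Quotient.refl x) := fun k hk => by
  rwa [Path.Homotopic.Quotient.trans_refl]

theorem trans {p : Path.Homotopic.Quotient x y} {q : Path.Homotopic.Quotient y z}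
    (hp : Moves T p) (hq : Moves T q) : Moves T (p.trans q) := fun k hk => by
  rw [← Path.Homotopic.Quotient.trans_assoc]
  exact hq _ (hp _ hk)

theorem cast {x' y' : Y} {p : Path x y} (hp : Moves T (Path.Homotopic.Quotient.mk p))
    (hx : x' = x) (hy : y' = y) : Moves T (Path.Homotopic.Quotient.mk (p.cast hx hy)) := by
  subst hx hy; exact hp

/-- A property of path classes that is stable under composition holds for a path if it holds for
all short pieces of the path. -/
theorem of_cover {γ : Path x y} {ι : Type*} {U : ι → Set Y}
    (hU : ∀ i, IsOpen (γ ⁻¹' U i)) (hγ : ∀ t, ∃ i, γ t ∈ U i)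
    (h : ∀ i {a b : Y} (δ : Path a b), (∀ t, δ t ∈ U i) → Set.range δ ⊆ Set.range γ →
      Moves T (Path.Homotopic.Quotient.mk δ)) :
    Moves T (Path.Homotopic.Quotient.mk γ) := by
  obtain ⟨t, h0, hmono, ⟨n, hn⟩, ht⟩ := exists_monotone_Icc_subset_open_cover_unitInterval hU
    (fun s _ => Set.mem_iUnion.2 (hγ s))
  have key : ∀ m, Moves T (Path.Homotopic.Quotient.mk (γ.subpath (t 0) (t m))) := by
    intro m
    induction m with
    | zero =>
      rw [Path.subpath_self]
      exact refl _
    | succ m ih =>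
      obtain ⟨i, hi⟩ := ht m
      have h2 : Moves T (Path.Homotopic.Quotient.mk (γ.subpath (t m) (t (m + 1)))) := by
        refine h i _ (fun s => ?_) ?_
        · have h3 := Set.mem_range_self (f := γ.subpath (t m) (t (m + 1))) s
          rw [Path.range_subpath_of_le _ _ _ (hmono m.le_succ)] at h3
          obtain ⟨u, hu, hus⟩ := h3
          rw [← hus]
          exact hi hu
        · rw [Path.range_subpath]; exact Set.image_subset_range _ _
      have h3 := ih.trans h2
      rwa [← Path.Homotopic.Quotient.mk_trans, Path.Homotopic.Quotient.eq.2
        ⟨Path.Homotopy.subpathTransSubpath γ _ _ _⟩] at h3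
  have h1 := key n
  have e : γ = (γ.subpath (t 0) (t n)).cast (by simp [h0]) (by simp [hn n le_rfl]) := by
    ext s
    simp [Path.subpath, h0, hn n le_rfl]
  rw [e]
  exact h1.cast _ _

end Moves

end PathClasses

/-! ### Quotient maps and homotopies that descend to them -/

section Descent

/-- A quotient map restricts to a quotient map over a locally closed set. -/
theorem Topology.IsQuotientMap.restrictPreimage_isLocallyClosed {C X : Type*} [TopologicalSpace C]
    [TopologicalSpace X] {q : C → X} (hq : IsQuotientMap q) {W : Set X} (hW : IsLocallyClosed W) :
    IsQuotientMap (W.restrictPreimage q) := by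
  obtain ⟨U, Z, hU, hZ, rfl⟩ := hW
  refine (isQuotientMap_iff _).2 ⟨isCoinducing_iff.2 fun s =>
    ⟨fun hs => ?_, fun hs => hs.preimage hq.continuous.restrictPreimage⟩,
    Set.restrictPreimage_surjective _ hq.surjective⟩
  obtain ⟨O, hO, hOs⟩ := isOpen_induced_iff.1 hs
  have hOs' : ∀ c, ∀ hc : q c ∈ U ∩ Z, c ∈ O ↔ (⟨q c, hc⟩ : ↥(U ∩ Z)) ∈ s := fun c hc =>
    Set.ext_iff.1 hOs ⟨c, hc⟩
  -- The points of `U` outside `Z` are added because `s` is open only relative to `Z`. The preimage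
  -- of the union is the part of `O` over `U` together with everything over `U \ Z`.
  refine isOpen_induced_iff.2 ⟨Subtype.val '' s ∪ U \ Z, ?_, ?_⟩
  · rw [← hq.isOpen_preimage]
    convert ((hO.inter (hU.preimage hq.continuous)).union
      ((hU.preimage hq.continuous).sdiff (hZ.preimage hq.continuous))) using 1
    ext c
    constructor
    · rintro (⟨w, hw, hwc⟩ | hc)
      · have hc : q c ∈ U ∩ Z := hwc ▸ w.2
        obtain rfl : w = ⟨q c, hc⟩ := Subtype.ext hwc
        exact Or.inl ⟨(hOs' c hc).2 hw, hc.1⟩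
      · exact Or.inr hc
    · rintro (hc | hc)
      · by_cases hz : q c ∈ Z
        · exact Or.inl ⟨⟨q c, hc.2, hz⟩, (hOs' c ⟨hc.2, hz⟩).1 hc.1, rfl⟩
        · exact Or.inr ⟨hc.2, hz⟩
      · exact Or.inr hc
  · ext w
    simp only [Set.mem_preimage, Set.mem_union, Set.mem_image, Subtype.val_inj, exists_eq_right]
    exact or_iff_left fun h => h.2 w.2.2

/-- Let `q` be a quotient map over `W`, and let the paths `f c` in `Y` be a homotopy over `W` from
the identity. A path in `W` is then homotopic to the path of the end points of the homotopy,
up to the tracks of its end points. -/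
theorem exists_path_of_tracks {C X : Type*} [TopologicalSpace C] [TopologicalSpace X] {q : C → X}
    {W Y : Set X} (hq : IsQuotientMap (W.restrictPreimage q)) {f : C → C(I, X)}
    (hf : ContinuousOn f (q ⁻¹' W))
    (hqf : ∀ c c', q c = q c' → q c ∈ W → f c = f c')
    (hY : ∀ c, q c ∈ W → ∀ s, f c s ∈ Y) (h0 : ∀ c, q c ∈ W → f c 0 = q c)
    {x y x' y' : Y} (γ : Path x y) (hγ : ∀ t, (γ t : X) ∈ W) (a : Path x x') (b : Path y y')
    (ha : ∀ c, q c = x → ∀ s, (a s : X) = f c s) (hb : ∀ c, q c = y → ∀ s, (b s : X) = f c s) :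
    ∃ δ : Path x' y', (∀ t c, q c = γ t → (δ t : X) = f c 1) ∧
      (Path.Homotopic.Quotient.mk γ).trans (.mk b) = (Path.Homotopic.Quotient.mk a).trans (.mk δ) := by
  have hfc : Continuous fun c : q ⁻¹' W => f c := continuousOn_iff_continuous_domRestrict.1 hf
  choose g hg using hq.surjective
  let F : W → C(I, X) := fun w => f (g w)
  have hgW : ∀ w, q (g w) = w := fun w => congrArg Subtype.val (hg w)
  have hFq : F ∘ W.restrictPreimage q = fun c : q ⁻¹' W => f c := by
    funext c
    exact hqf _ _ (hgW _) (g _).2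
  -- With the homotopy written as a map to `C(I, X)`, continuity descends along `q` alone. Nothing
  -- is needed about the product of a quotient map with the interval.
  have hF : Continuous F := hq.continuous_iff.2 (hFq ▸ hfc)
  have hF2 : ∀ c (hc : q c ∈ W), F ⟨q c, hc⟩ = f c := fun c hc => congrFun hFq ⟨c, hc⟩
  let K : I × I → Y := fun p => ⟨F ⟨γ p.1, hγ p.1⟩ p.2, hY _ (g _).2 _⟩
  have hK : Continuous K := by
    refine Continuous.subtype_mk ?_ _
    have : Continuous fun p : I × I => F ⟨γ p.1, hγ p.1⟩ :=
      hF.comp (Continuous.subtype_mk (by fun_prop) _)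
    exact this.eval continuous_snd
  have e0 : ∀ t, γ t = K (t, 0) := fun t => Subtype.ext (by
    change (γ t : X) = f (g ⟨γ t, hγ t⟩) 0
    rw [h0 _ (g _).2, hgW])
  have ea : ∀ s, a s = K (0, s) := fun s => Subtype.ext (ha _ (by rw [hgW]; simp) s)
  have eb : ∀ s, b s = K (1, s) := fun s => Subtype.ext (hb _ (by rw [hgW]; simp) s)
  let δ : Path x' y' := ⟨⟨fun t => K (t, 1), by fun_prop⟩, by simp [← ea], by simp [← eb]⟩
  refine ⟨δ, fun t c hc => ?_, ?_⟩
  · change F ⟨γ t, hγ t⟩ 1 = _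
    rw [← hF2 c (hc ▸ hγ t)]
    congr 2
    exact Subtype.ext hc.symm
  · exact Path.Homotopic.Quotient.trans_eq_trans_of_square hK e0 (fun _ => rfl) ea eb

end Descent

/-! ### The boundary circle, normal forms of points, and the graph inside the complex -/

namespace Cayley

section Circle

theorem circlePoint_eq_iff {a b : ℝ} : circlePoint a = circlePoint b ↔ ∃ k : ℤ, a = b + k := by
  have hpi := Real.pi_ne_zero
  rw [Subtype.ext_iff]
  simp only [circlePoint]
  rw [Complex.exp_eq_exp_iff_exists_int]
  refine exists_congr fun k => ?_
  constructor
  · intro h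
    have h2 := congrArg Complex.im h
    simp at h2
    have : 2 * Real.pi * a = 2 * Real.pi * (b + k) := by linarith
    exact mul_left_cancel₀ (by positivity) this
  · rintro rfl
    push_cast
    ring

theorem norm_circlePoint (a : ℝ) : ‖(circlePoint a : ℂ)‖ = 1 :=
  Complex.norm_exp_ofReal_mul_I _

theorem continuous_circlePoint : Continuous circlePoint := by
  unfold circlePoint; fun_prop

theorem exists_circlePoint_eq {z : Metric.closedBall (0 : ℂ) 1} (hz : ‖(z : ℂ)‖ = 1) (a : ℝ) :
    ∃ b, a ≤ b ∧ b < a + 1 ∧ circlePoint b = z := by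
  have hpi := Real.pi_ne_zero
  set c := Complex.arg z / (2 * Real.pi)
  refine ⟨toIcoMod one_pos a c, left_le_toIcoMod _ _ _, toIcoMod_lt_right _ _ _, ?_⟩
  have h1 : circlePoint (toIcoMod one_pos a c) = circlePoint c :=
    circlePoint_eq_iff.2 ⟨-toIcoDiv one_pos a c, by rw [toIcoMod]; simp; ring⟩
  rw [h1]
  refine Subtype.ext ?_
  have h2 := Complex.norm_mul_exp_arg_mul_I z
  rw [hz] at h2
  simp only [circlePoint]
  rw [← h2]
  simp only [c, Complex.ofReal_one, one_mul]
  congr 3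
  field_simp

theorem exists_corner {n : ℕ} (hn : n ≠ 0) {z : Metric.closedBall (0 : ℂ) 1}
    (hz : ‖(z : ℂ)‖ = 1) :
    ∃ (i : Fin n) (u : I), (u : ℝ) < 1 ∧ z = circlePoint (((i : ℕ) + (u : ℝ)) / n) := by
  obtain ⟨b, hb0, hb1, rfl⟩ := exists_circlePoint_eq hz 0
  have hn' : (0 : ℝ) < n := by positivity
  have h0 : 0 ≤ b * n := by positivity
  have h1 : b * n < n := by nlinarith
  have hf := Nat.floor_le h0
  have hf' := Nat.lt_floor_add_one (b * n)
  refine ⟨⟨⌊b * n⌋₊, (Nat.floor_lt h0).2 h1⟩, ⟨b * n - ⌊b * n⌋₊, by linarith, by linarith⟩,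
    by simp only; linarith, ?_⟩
  congr 1
  field_simp
  simp

/-- The half-open arcs partition the circle. This makes the choice in `boundaryPoint` harmless. -/
theorem corner_unique {n : ℕ} {i i' : Fin n} {u u' : I} (hu : (u : ℝ) < 1) (hu' : (u' : ℝ) < 1)
    (h : circlePoint (((i : ℕ) + (u : ℝ)) / n) = circlePoint (((i' : ℕ) + (u' : ℝ)) / n)) :
    i = i' ∧ u = u' := by
  obtain ⟨k, hk⟩ := circlePoint_eq_iff.1 h
  have hn : (0 : ℝ) < n := by exact_mod_cast i.pos
  have hk2 : (i : ℕ) + (u : ℝ) = (i' : ℕ) + (u' : ℝ) + k * n := by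
    field_simp at hk
    linarith
  have hi : ((i : ℕ) : ℝ) + 1 ≤ n := by exact_mod_cast i.2
  have hi' : ((i' : ℕ) : ℝ) + 1 ≤ n := by exact_mod_cast i'.2
  have := u.2.1
  have := u'.2.1
  have : (0 : ℝ) ≤ (i : ℕ) := by positivity
  have : (0 : ℝ) ≤ (i' : ℕ) := by positivity
  have hk0 : k = 0 := by
    have h1 : (k : ℝ) < 1 := by by_contra hc; push Not at hc; nlinarith
    have h2 : (-1 : ℝ) < k := by by_contra hc; push Not at hc; nlinarith
    have h1' : k < 1 := by exact_mod_cast h1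
    have h2' : -1 < k := by exact_mod_cast h2
    omega
  subst hk0
  have hii : (i : ℕ) = i' := by
    have h1 : ((i : ℕ) : ℝ) < (i' : ℕ) + 1 := by push_cast at hk2; linarith
    have h2 : ((i' : ℕ) : ℝ) < (i : ℕ) + 1 := by push_cast at hk2; linarith
    have h1' : (i : ℕ) < i' + 1 := by exact_mod_cast h1
    have h2' : (i' : ℕ) < i + 1 := by exact_mod_cast h2
    omega
  refine ⟨Fin.ext hii, Subtype.ext ?_⟩
  rw [hii] at hk2
  push_cast at hk2
  linarith

end Circle

variable {S : Type*} {R : Set (GenWord S)}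

/-- The element of `⟨S : R⟩` given by a letter. -/
def letterVal (R : Set (GenWord S)) (p : S × Bool) : PresGroup R := PresGroup.val R [p]

theorem val_append (l l' : GenWord S) :
    PresGroup.val R (l ++ l') = PresGroup.val R l * PresGroup.val R l' := by
  simp only [PresGroup.val, ← map_mul, FreeGroup.mul_mk]

theorem val_cons (p : S × Bool) (l : GenWord S) :
    PresGroup.val R (p :: l) = letterVal R p * PresGroup.val R l :=
  val_append [p] l

@[simp] theorem val_nil : PresGroup.val R [] = 1 := map_one (PresentedGroup.mk (FreeGroup.mk '' R))

@[simp] theorem letterVal_true (s : S) : letterVal R (s, true) = PresGroup.gen R s := rfl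

@[simp] theorem letterVal_false (s : S) : letterVal R (s, false) = (PresGroup.gen R s)⁻¹ := by
  rw [PresGroup.gen, PresentedGroup.of, ← map_inv]; rfl

theorem val_eq_one {r : GenWord S} (hr : r ∈ R) : PresGroup.val R r = 1 :=
  PresentedGroup.one_of_mem ⟨r, hr, rfl⟩

theorem val_take_succ (r : GenWord S) (i : Fin r.length) :
    PresGroup.val R (r.take (i + 1)) = PresGroup.val R (r.take i) * letterVal R (r.get i) := by
  rw [List.take_succ_eq_append_getElem i.2, val_append]; rfl

variable (R) in
/-- The 0-cells and the closed 1-cells. -/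
abbrev Cells1 : Type _ := (Σ _ : PresGroup R, Unit) ⊕ (Σ _ : PresGroup R × S, I)

/-- The 0-cell `g`. -/
def vert (g : PresGroup R) : Cells1 R := Sum.inl ⟨g, ()⟩

/-- The point with parameter `u` on the 1-cell at `g` labelled `s`. -/
def edge (g : PresGroup R) (s : S) (u : I) : Cells1 R := Sum.inr ⟨(g, s), u⟩

variable (R) in
/-- The quotient map onto the Cayley 2-complex. -/
def toComplex : Cells R → Complex2 R := Quot.mk (Glue R)

variable (R) in
/-- The inclusion of the cells of dimension at most one. -/
def incl : Cells1 R → Cells R := Sum.map id Sum.inl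

variable (R) in
/-- The map of the cells of dimension at most one to the Cayley 2-complex. -/
def toGraph (c : Cells1 R) : Complex2 R := toComplex R (incl R c)

/-- The point with parameter `u` on the edge that starts at `g` and is read as the given letter. -/
def letterEdge (g : PresGroup R) : S × Bool → I → Cells1 R
  | (s, true), u => edge g s u
  | (s, false), u => edge (g * (PresGroup.gen R s)⁻¹) s (unitInterval.symm u)

theorem incl_letterEdge (g : PresGroup R) (p : S × Bool) (u : I) :
    incl R (letterEdge g p u) = letterPoint R g p u := by
  obtain ⟨s, _ | _⟩ := p <;> rfl

open Classical in
/-- Replaces the end points of a 1-cell by 0-cells. -/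
noncomputable def normalize : Cells1 R → Cells1 R
  | Sum.inl v => Sum.inl v
  | Sum.inr ⟨(g, s), u⟩ =>
    if u = 0 then vert g else if u = 1 then vert (g * PresGroup.gen R s) else edge g s u

@[simp] theorem normalize_vert (g : PresGroup R) : normalize (vert g) = vert g := rfl

@[simp] theorem normalize_edge_zero (g : PresGroup R) (s : S) :
    normalize (edge g s 0) = vert g := by simp [normalize, edge]

@[simp] theorem normalize_edge_one (g : PresGroup R) (s : S) :
    normalize (edge g s 1) = vert (g * PresGroup.gen R s) := by simp [normalize, edge]

theorem normalize_edge {g : PresGroup R} {s : S} {u : I} (h0 : u ≠ 0) (h1 : u ≠ 1) :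
    normalize (edge g s u) = edge g s u := by simp [normalize, edge, h0, h1]

theorem normalize_letterEdge_zero (g : PresGroup R) (p : S × Bool) :
    normalize (letterEdge g p 0) = vert g := by
  obtain ⟨s, _ | _⟩ := p <;> simp [letterEdge]

theorem normalize_letterEdge_one (g : PresGroup R) (p : S × Bool) :
    normalize (letterEdge g p 1) = vert (g * letterVal R p) := by
  obtain ⟨s, _ | _⟩ := p <;> simp [letterEdge]

theorem toGraph_edge_zero (g : PresGroup R) (s : S) : toGraph R (edge g s 0) = toGraph R (vert g) :=
  Quot.sound (Glue.source g s)

theorem toGraph_edge_one (g : PresGroup R) (s : S) :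
    toGraph R (edge g s 1) = toGraph R (vert (g * PresGroup.gen R s)) :=
  Quot.sound (Glue.target g s)

theorem cells1_cases (c : Cells1 R) : (∃ g, c = vert g) ∨ ∃ g s u, c = edge g s u := by
  obtain ⟨g, ⟨⟩⟩ | ⟨⟨g, s⟩, u⟩ := c
  · exact Or.inl ⟨g, rfl⟩
  · exact Or.inr ⟨g, s, u, rfl⟩

theorem cells_cases (c : Cells R) : (∃ c', c = incl R c') ∨ ∃ g r z, c = cell2 R g r z := by
  obtain c | c | ⟨⟨g, s⟩, u⟩ := c
  · exact Or.inl ⟨Sum.inl c, rfl⟩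
  · exact Or.inl ⟨Sum.inr c, rfl⟩
  · exact Or.inr ⟨g, s, u, rfl⟩

theorem toGraph_normalize (c : Cells1 R) : toGraph R (normalize c) = toGraph R c := by
  obtain ⟨g, rfl⟩ | ⟨g, s, u, rfl⟩ := cells1_cases c
  · rfl
  · by_cases h0 : u = 0
    · rw [h0, normalize_edge_zero, toGraph_edge_zero]
    by_cases h1 : u = 1
    · rw [h1, normalize_edge_one, toGraph_edge_one]
    rw [normalize_edge h0 h1]

theorem toComplex_boundary (g : PresGroup R) (r : R) (i : Fin r.1.length) (u : I) :
    toComplex R (cell2 R g r (circlePoint (((i : ℕ) + (u : ℝ)) / (r.1.length : ℝ)))) =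
      toGraph R (letterEdge (g * PresGroup.val R (r.1.take i)) (r.1.get i) u) := by
  rw [toGraph, incl_letterEdge]
  exact Quot.sound (Glue.boundary g r i u)

open Classical in
/-- The point of the graph to which a boundary point of a 2-cell is glued, in normal form. -/
noncomputable def boundaryPoint (g : PresGroup R) (r : R) (z : Metric.closedBall (0 : ℂ) 1) :
    Cells1 R :=
  if h : ∃ (i : Fin r.1.length) (u : I),
      (u : ℝ) < 1 ∧ z = circlePoint (((i : ℕ) + (u : ℝ)) / r.1.length) then
    normalize (letterEdge (g * PresGroup.val R (r.1.take h.choose)) (r.1.get h.choose)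
      h.choose_spec.choose)
  else vert g

theorem boundaryPoint_of_lt (g : PresGroup R) (r : R) (i : Fin r.1.length) {u : I}
    (hu : (u : ℝ) < 1) :
    boundaryPoint g r (circlePoint (((i : ℕ) + (u : ℝ)) / r.1.length)) =
      normalize (letterEdge (g * PresGroup.val R (r.1.take i)) (r.1.get i) u) := by
  have h : ∃ (i' : Fin r.1.length) (u' : I), (u' : ℝ) < 1 ∧
      circlePoint (((i : ℕ) + (u : ℝ)) / r.1.length) =
        circlePoint (((i' : ℕ) + (u' : ℝ)) / r.1.length) := ⟨i, u, hu, rfl⟩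
  rw [boundaryPoint, dif_pos h]
  obtain ⟨h1, h2⟩ := corner_unique hu h.choose_spec.choose_spec.1 h.choose_spec.choose_spec.2
  rw [← h2]
  congr 2 <;> rw [← h1]

/-- The end of an arc is the start of the next one. After the last arc the path is back at its first
vertex, since a relator is trivial in the group. -/
theorem boundaryPoint_eq (g : PresGroup R) (r : R) (i : Fin r.1.length) (u : I) :
    boundaryPoint g r (circlePoint (((i : ℕ) + (u : ℝ)) / r.1.length)) =
      normalize (letterEdge (g * PresGroup.val R (r.1.take i)) (r.1.get i) u) := by
  obtain hu | hu := lt_or_eq_of_le u.2.2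
  · exact boundaryPoint_of_lt g r i hu
  obtain rfl : u = 1 := Subtype.ext hu
  rw [normalize_letterEdge_one, mul_assoc, ← val_take_succ]
  have hn : (0 : ℝ) < r.1.length := by exact_mod_cast i.pos
  obtain hi | hi := Nat.lt_or_eq_of_le (Nat.succ_le_of_lt i.2)
  · have := boundaryPoint_of_lt g r ⟨i + 1, hi⟩ (u := 0) (by simp)
    rw [normalize_letterEdge_zero] at this
    simpa using this
  · have := boundaryPoint_of_lt g r ⟨0, i.pos⟩ (u := 0) (by simp)
    rw [normalize_letterEdge_zero] at this
    have h1 : r.1.take (i + 1) = r.1 := List.take_of_length_le (by omega)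
    rw [h1, val_eq_one r.2]
    have h2 : circlePoint (((i : ℕ) + ((1 : I) : ℝ)) / r.1.length) =
        circlePoint ((((⟨0, i.pos⟩ : Fin r.1.length) : ℕ) + ((0 : I) : ℝ)) / r.1.length) := by
      refine circlePoint_eq_iff.2 ⟨1, ?_⟩
      have : ((i : ℕ) : ℝ) + 1 = r.1.length := by exact_mod_cast hi
      simp [this, hn.ne']
    rw [h2, this]
    simp

open Classical in
/-- The normal form of a point of a closed cell. -/
noncomputable def normalForm : Cells R → Cells1 R ⊕ Cells R
  | Sum.inl v => Sum.inl (Sum.inl v)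
  | Sum.inr (Sum.inl e) => Sum.inl (normalize (Sum.inr e))
  | Sum.inr (Sum.inr ⟨(g, r), z⟩) =>
    if ‖(z : ℂ)‖ = 1 then Sum.inl (boundaryPoint g r z) else Sum.inr (cell2 R g r z)

theorem normalForm_incl (c : Cells1 R) : normalForm (incl R c) = Sum.inl (normalize c) := by
  obtain c | c := c <;> rfl

theorem normalForm_cell2_of_eq {g : PresGroup R} {r : R} {z : Metric.closedBall (0 : ℂ) 1}
    (hz : ‖(z : ℂ)‖ = 1) : normalForm (cell2 R g r z) = Sum.inl (boundaryPoint g r z) :=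
  if_pos hz

theorem normalForm_cell2_of_ne {g : PresGroup R} {r : R} {z : Metric.closedBall (0 : ℂ) 1}
    (hz : ‖(z : ℂ)‖ ≠ 1) : normalForm (cell2 R g r z) = Sum.inr (cell2 R g r z) :=
  if_neg hz

/-- This gives an invariant of the equivalence relation generated by the gluing. Identifications in
the quotient can then be read off from normal forms, without analysing chains of gluings. -/
theorem normalForm_eq_of_glue {c c' : Cells R} (h : Glue R c c') :
    normalForm c = normalForm c' := by
  cases h with
  | source g s => exact (normalForm_incl (edge g s 0)).trans (by simp; rfl)
  | target g s => exact (normalForm_incl (edge g s 1)).trans (by simp; rfl)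
  | boundary g r i u =>
    rw [normalForm_cell2_of_eq (norm_circlePoint _), boundaryPoint_eq, ← incl_letterEdge,
      normalForm_incl]
  | constant g r hr z hz =>
    rw [normalForm_cell2_of_eq hz, boundaryPoint, dif_neg]
    · rfl
    · rintro ⟨i, -⟩
      exact absurd i.2 (by simp [hr])

theorem normalForm_eq_of_toComplex_eq {c c' : Cells R} (h : toComplex R c = toComplex R c') :
    normalForm c = normalForm c' :=
  congrArg (Quot.lift normalForm fun _ _ => normalForm_eq_of_glue) h

theorem toGraph_eq_iff {c c' : Cells1 R} :
    toGraph R c = toGraph R c' ↔ normalize c = normalize c' := by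
  constructor
  · intro h
    have := normalForm_eq_of_toComplex_eq h
    rwa [normalForm_incl, normalForm_incl, Sum.inl.injEq] at this
  · intro h
    rw [← toGraph_normalize, h, toGraph_normalize]

theorem toGraph_vert_injective : Function.Injective fun g => toGraph R (vert g) := by
  intro g g' h
  have := toGraph_eq_iff.1 h
  rw [normalize_vert, normalize_vert] at this
  simpa [vert] using this

/-- A boundary point of a 2-cell lies in the graph. -/
theorem exists_toComplex_cell2_eq (g : PresGroup R) (r : R) {z : Metric.closedBall (0 : ℂ) 1}
    (hz : ‖(z : ℂ)‖ = 1) : ∃ c, toComplex R (cell2 R g r z) = toGraph R c := by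
  by_cases hr : r.1 = []
  · exact ⟨vert g, Quot.sound (Glue.constant g r hr z hz)⟩
  · obtain ⟨i, u, -, rfl⟩ := exists_corner (n := r.1.length) (by simpa using hr) hz
    exact ⟨_, toComplex_boundary g r i u⟩

theorem toComplex_cell2_ne_toGraph {g : PresGroup R} {r : R} {z : Metric.closedBall (0 : ℂ) 1}
    (hz : ‖(z : ℂ)‖ ≠ 1) (c : Cells1 R) : toComplex R (cell2 R g r z) ≠ toGraph R c := fun h => by
  have := normalForm_eq_of_toComplex_eq h
  rw [normalForm_cell2_of_ne hz, normalForm_incl] at this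
  cases this

/-- Interior points of 2-cells are their own normal forms, so nothing else is glued to them. -/
theorem eq_of_toComplex_eq_cell2 {g : PresGroup R} {r : R} {z : Metric.closedBall (0 : ℂ) 1}
    (hz : ‖(z : ℂ)‖ ≠ 1) {c : Cells R} (h : toComplex R c = toComplex R (cell2 R g r z)) :
    c = cell2 R g r z := by
  obtain ⟨c, rfl⟩ | ⟨g', r', z', rfl⟩ := cells_cases c
  · exact (toComplex_cell2_ne_toGraph hz c h.symm).elim
  · by_cases hz' : ‖(z' : ℂ)‖ = 1
    · obtain ⟨c, hc⟩ := exists_toComplex_cell2_eq g' r' hz'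
      exact (toComplex_cell2_ne_toGraph hz c (h.symm.trans hc)).elim
    · have := normalForm_eq_of_toComplex_eq h
      rwa [normalForm_cell2_of_ne hz, normalForm_cell2_of_ne hz', Sum.inr.injEq] at this

theorem isQuotientMap_toComplex : IsQuotientMap (toComplex R) := isQuotientMap_quot_mk

theorem isClosed_cells_iff {A : Set (Cells R)} : IsClosed A ↔
    (∀ g s, IsClosed {u | cell1 R g s u ∈ A}) ∧ ∀ g r, IsClosed {z | cell2 R g r z ∈ A} := by
  rw [isClosed_sum_iff, isClosed_sum_iff, isClosed_sigma_iff, isClosed_sigma_iff,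
    isClosed_sigma_iff]
  constructor
  · rintro ⟨-, h1, h2⟩
    exact ⟨fun g s => h1 (g, s), fun g r => h2 (g, r)⟩
  · rintro ⟨h1, h2⟩
    exact ⟨fun _ => isClosed_discrete _, fun i => h1 i.1 i.2, fun i => h2 i.1 i.2⟩

theorem isClosed_cells1_iff {A : Set (Cells1 R)} : IsClosed A ↔
    ∀ g s, IsClosed {u | edge g s u ∈ A} := by
  rw [isClosed_sum_iff, isClosed_sigma_iff, isClosed_sigma_iff]
  exact ⟨fun h g s => h.2 (g, s), fun h => ⟨fun _ => isClosed_discrete _, fun i => h i.1 i.2⟩⟩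

theorem continuous_toGraph : Continuous (toGraph R) :=
  isQuotientMap_toComplex.continuous.comp (continuous_id.sumMap continuous_inl)

theorem continuous_edge (g : PresGroup R) (s : S) : Continuous (edge g s) := by
  exact continuous_inr.comp continuous_sigmaMk

theorem continuous_cell2 (g : PresGroup R) (r : R) : Continuous (cell2 R g r) := by
  exact continuous_inr.comp (continuous_inr.comp continuous_sigmaMk)

/-- Closedness in the complex is tested on each cell. A 1-cell picks up at most its two end points
in addition to `C`, and the boundary of a 2-cell is a finite union of compact arcs. Because of this,
maps on the graph can be handled on the disjoint union of its cells. -/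
theorem isClosedMap_toGraph : IsClosedMap (toGraph R) := by
  intro C hC
  rw [← isQuotientMap_toComplex.isClosed_preimage]
  have h1 : ∀ g s, IsClosed {u | toGraph R (edge g s u) ∈ toGraph R '' C} := by
    intro g s
    have : {u | toGraph R (edge g s u) ∈ toGraph R '' C} =
        {u | edge g s u ∈ C} ∪ {u | (u = 0 ∨ u = 1) ∧ toGraph R (edge g s u) ∈ toGraph R '' C} := by
      ext u
      constructor
      · rintro ⟨c, hc, h⟩
        by_cases hu : u = 0 ∨ u = 1
        · exact Or.inr ⟨hu, c, hc, h⟩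
        · push Not at hu
          rw [toGraph_eq_iff, normalize_edge hu.1 hu.2] at h
          obtain ⟨g', rfl⟩ | ⟨g', s', u', rfl⟩ := cells1_cases c
          · cases h
          · left
            by_cases h0 : u' = 0
            · rw [h0, normalize_edge_zero] at h; cases h
            by_cases h1 : u' = 1
            · rw [h1, normalize_edge_one] at h; cases h
            rw [normalize_edge h0 h1] at h
            rwa [Set.mem_ofPred_eq, ← h]
      · rintro (h | h)
        · exact ⟨_, h, rfl⟩
        · exact h.2
    rw [this]
    refine (isClosed_cells1_iff.1 hC g s).union (Set.Finite.isClosed ?_)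
    exact (Set.toFinite {0, 1}).subset fun u hu => hu.1
  rw [isClosed_cells_iff]
  refine ⟨h1, fun g r => ?_⟩
  change IsClosed {z | toComplex R (cell2 R g r z) ∈ toGraph R '' C}
  -- For the empty relator there are no arcs: the whole boundary circle is collapsed to the vertex
  -- `g`.
  by_cases hr : r.1 = []
  · by_cases hg : toGraph R (vert g) ∈ toGraph R '' C
    · convert isClosed_eq (continuous_norm.comp continuous_subtype_val)
        (continuous_const (y := (1 : ℝ))) using 1
      · ext z
        refine ⟨fun h => ?_, fun h => ?_⟩
        · by_contra hz
          obtain ⟨c, -, hc⟩ := h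
          exact toComplex_cell2_ne_toGraph hz c hc.symm
        · have : toComplex R (cell2 R g r z) = toGraph R (vert g) :=
            Quot.sound (Glue.constant g r hr z h)
          rwa [Set.mem_ofPred_eq, this]
    · convert isClosed_empty
      refine Set.eq_empty_of_forall_notMem fun z h => ?_
      by_cases hz : ‖(z : ℂ)‖ = 1
      · have : toComplex R (cell2 R g r z) = toGraph R (vert g) :=
          Quot.sound (Glue.constant g r hr z hz)
        exact hg (this ▸ h)
      · obtain ⟨c, -, hc⟩ := h
        exact toComplex_cell2_ne_toGraph hz c hc.symm
  · have : {z | toComplex R (cell2 R g r z) ∈ toGraph R '' C} = ⋃ i : Fin r.1.length,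
        (fun u : I => circlePoint (((i : ℕ) + (u : ℝ)) / r.1.length)) ''
          {u | toGraph R (letterEdge (g * PresGroup.val R (r.1.take i)) (r.1.get i) u) ∈
            toGraph R '' C} := by
      ext z
      simp only [Set.mem_ofPred_eq, Set.mem_iUnion]
      constructor
      · intro h
        by_cases hz : ‖(z : ℂ)‖ = 1
        · obtain ⟨i, u, -, rfl⟩ := exists_corner (n := r.1.length) (by simpa using hr) hz
          rw [toComplex_boundary] at h
          exact ⟨i, u, h, rfl⟩
        · obtain ⟨c, -, hc⟩ := h
          exact (toComplex_cell2_ne_toGraph hz c hc.symm).elim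
      · rintro ⟨i, u, hu, rfl⟩
        rw [toComplex_boundary]
        exact hu
    rw [this]
    refine isClosed_iUnion_of_finite fun i => IsCompact.isClosed (IsCompact.image ?_ ?_)
    · refine IsClosed.isCompact ?_
      generalize g * PresGroup.val R (r.1.take i) = g'
      obtain ⟨s, _ | _⟩ := r.1.get i
      · exact (h1 _ s).preimage unitInterval.continuous_symm
      · exact h1 _ s
    · exact continuous_circlePoint.comp (by fun_prop)

end Cayley

/-! ### Parts of the complex that fit a vertex set, and stable sets of path classes -/

namespace Cayley

variable {S : Type*} {R : Set (GenWord S)}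

/-- The part `Y` of the Cayley 2-complex contains all cells with vertices in `V`, and every other
cell meets `Y` in a set that can be pushed into the boundary, towards `V`. -/
structure Fits (V : Set (PresGroup R)) (Y : Set (Complex2 R)) : Prop where
  isLocallyClosed : IsLocallyClosed Y
  vert_mem : ∀ {g}, toGraph R (vert g) ∈ Y ↔ g ∈ V
  edge_mem : ∀ {g s}, g ∈ V → g * PresGroup.gen R s ∈ V → ∀ u, toGraph R (edge g s u) ∈ Y
  edge_mixed : ∀ {g s u}, ¬(g ∈ V ∧ g * PresGroup.gen R s ∈ V) → toGraph R (edge g s u) ∈ Y →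
    (g ∈ V ∧ ∀ u' ≤ u, toGraph R (edge g s u') ∈ Y) ∨
      (g * PresGroup.gen R s ∈ V ∧ ∀ u' ≥ u, toGraph R (edge g s u') ∈ Y)
  disc_interior : ∀ {g r} {z z' : Metric.closedBall (0 : ℂ) 1}, ‖(z : ℂ)‖ < 1 → ‖(z' : ℂ)‖ < 1 →
    toComplex R (cell2 R g r z) ∈ Y → toComplex R (cell2 R g r z') ∈ Y
  disc_mem : ∀ {g} {r : R}, (∀ i ≤ r.1.length, g * PresGroup.val R (r.1.take i) ∈ V) →
    ∀ z, toComplex R (cell2 R g r z) ∈ Y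
  disc_mixed : ∀ g r, (¬ ∀ z, toComplex R (cell2 R g r z) ∈ Y) →
    ∃ ρ : Metric.closedBall (0 : ℂ) 1 → Metric.closedBall (0 : ℂ) 1,
      ContinuousOn ρ {z | toComplex R (cell2 R g r z) ∈ Y} ∧
      ∀ z, toComplex R (cell2 R g r z) ∈ Y → toComplex R (cell2 R g r (ρ z)) ∈ Y ∧
        ‖(ρ z : ℂ)‖ = 1 ∧ (‖(z : ℂ)‖ = 1 → ρ z = z)

namespace Fits

variable {V : Set (PresGroup R)} {Y : Set (Complex2 R)} (hY : Fits V Y)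

/-- A vertex in `V`, as a point of `Y`. -/
def vertex (g : V) : Y := ⟨toGraph R (vert g), hY.vert_mem.2 g.2⟩

theorem vertex_injective : Function.Injective hY.vertex := fun _ _ h =>
  Subtype.ext (toGraph_vert_injective (congrArg Subtype.val h))

/-- A constant path, or a straight path in an edge to one of its end points. -/
def Short {x : Y} {g : V} (δ : Path x (hY.vertex g)) : Prop :=
  (∀ t, δ t = x) ∨ ∃ (g' : PresGroup R) (s : S) (u ε : I), (ε = 0 ∨ ε = 1) ∧
    ∀ t, (δ t : Complex2 R) = toGraph R (edge g' s (convexComb u ε t))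

variable {x₀ : Y}

/-- A set of classes of paths from `x₀` to vertices is stable if it is closed under appending and
removing edges. -/
def Stable (T : ∀ g : V, Path.Homotopic.Quotient x₀ (hY.vertex g) → Prop) : Prop :=
  ∀ (g g' : V) (s : S) (δ : Path (hY.vertex g) (hY.vertex g')),
    (∀ t, (δ t : Complex2 R) = toGraph R (edge g.1 s t)) →
      ∀ k, T g k ↔ T g' (k.trans (.mk δ))

variable {T : ∀ g : V, Path.Homotopic.Quotient x₀ (hY.vertex g) → Prop} {hY}

theorem Stable.const_iff {g g' : V} (δ : Path (hY.vertex g) (hY.vertex g'))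
    (hδ : ∀ t, δ t = hY.vertex g) (k : Path.Homotopic.Quotient x₀ (hY.vertex g)) :
    T g k ↔ T g' (k.trans (.mk δ)) := by
  obtain rfl : g' = g := hY.vertex_injective (by rw [← δ.target, hδ])
  rw [Path.Homotopic.Quotient.mk_eq_refl hδ, Path.Homotopic.Quotient.trans_refl]

theorem eq_zero_or_one_of_toGraph_edge_eq {g g' : PresGroup R} {s : S} {u : I}
    (h : toGraph R (edge g s u) = toGraph R (vert g')) : u = 0 ∨ u = 1 := by
  by_contra hu
  push Not at hu
  rw [toGraph_eq_iff, normalize_edge hu.1 hu.2] at h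
  cases h

/-- A short path between two vertices is constant, an edge, or an edge traversed backwards. The last
case is covered because stability is an equivalence. -/
theorem Stable.short_vertex_iff (hT : hY.Stable T) {g g' : V}
    {δ : Path (hY.vertex g) (hY.vertex g')} (hδ : hY.Short δ)
    (k : Path.Homotopic.Quotient x₀ (hY.vertex g)) : T g k ↔ T g' (k.trans (.mk δ)) := by
  obtain hδ | ⟨g₁, s, u, ε, hε, hδ⟩ := hδ
  · exact Stable.const_iff δ hδ k
  have h0 : toGraph R (edge g₁ s u) = toGraph R (vert g) := by
    rw [← convexComb_zero u ε, ← hδ 0, δ.source]; rfl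
  have h1 : toGraph R (edge g₁ s ε) = toGraph R (vert g') := by
    rw [← convexComb_one u ε, ← hδ 1, δ.target]; rfl
  have hconst : u = ε → (T g k ↔ T g' (k.trans (.mk δ))) := by
    rintro rfl
    refine Stable.const_iff δ (fun t => Subtype.ext ?_) k
    rw [hδ, convexComb_eq, h0]; rfl
  obtain rfl | rfl := eq_zero_or_one_of_toGraph_edge_eq h0 <;> obtain rfl | rfl := hε
  · exact hconst rfl
  · rw [toGraph_edge_zero] at h0
    obtain rfl := toGraph_vert_injective h0
    refine hT g g' s δ (fun t => ?_) k
    rw [hδ]; simp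
  · rw [toGraph_edge_zero] at h1
    obtain rfl := toGraph_vert_injective h1
    have := hT g' g s δ.symm (fun t => ?_) (k.trans (.mk δ))
    · rw [this, Path.Homotopic.Quotient.mk_symm, Path.Homotopic.Quotient.trans_assoc,
        Path.Homotopic.Quotient.trans_symm, Path.Homotopic.Quotient.trans_refl]
    · change (δ (σ t) : Complex2 R) = _
      rw [hδ]; simp
  · exact hconst rfl

/-- The ways from a point of an edge to its two ends differ by the whole edge. That edge lies in `Y`
because both its ends are in `V`. -/
theorem Stable.short_iff_of_ends (hT : hY.Stable T) {x : Y} {g g' : V} {g₁ : PresGroup R} {s : S}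
    {u : I} {δ : Path x (hY.vertex g)} {δ' : Path x (hY.vertex g')}
    (hδ : ∀ t, (δ t : Complex2 R) = toGraph R (edge g₁ s (convexComb u 0 t)))
    (hδ' : ∀ t, (δ' t : Complex2 R) = toGraph R (edge g₁ s (convexComb u 1 t)))
    (k : Path.Homotopic.Quotient x₀ x) : T g (k.trans (.mk δ)) ↔ T g' (k.trans (.mk δ')) := by
  have h0 : toGraph R (vert g₁) = toGraph R (vert g) := by
    rw [← toGraph_edge_zero _ s, ← convexComb_one u 0, ← hδ 1, δ.target]; rfl
  obtain rfl := toGraph_vert_injective h0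
  have h1 : toGraph R (vert (g * PresGroup.gen R s)) = toGraph R (vert g') := by
    rw [← toGraph_edge_one, ← convexComb_one u 1, ← hδ' 1, δ'.target]; rfl
  have h1' : g * PresGroup.gen R s = g' := toGraph_vert_injective h1
  have hmem : ∀ t, toGraph R (edge g.1 s t) ∈ Y := hY.edge_mem g.2 (h1' ▸ g'.2)
  have hc : Continuous fun t => (⟨toGraph R (edge g.1 s t), hmem t⟩ : Y) :=
    (continuous_toGraph.comp (continuous_edge _ _)).subtype_mk _
  let η : Path (hY.vertex g) (hY.vertex g') := ⟨⟨_, hc⟩, Subtype.ext (toGraph_edge_zero _ _),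
    Subtype.ext ((toGraph_edge_one _ _).trans h1)⟩
  let p (a b : I) : Path a b := ⟨⟨convexComb a b, by fun_prop⟩, by simp, by simp⟩
  rw [hT g g' s η (fun t => rfl), Path.Homotopic.Quotient.trans_assoc,
    Path.Homotopic.Quotient.trans_eq_of_lift hc (r := δ') (p u 0) (p 0 1) (p u 1)
      (fun t => Subtype.ext (hδ t)) (fun t => Subtype.ext ?_) (fun t => Subtype.ext (hδ' t))]
  change toGraph R (edge g.1 s t) = toGraph R (edge g.1 s (convexComb 0 1 t))
  simp

/-- Membership tested along one short path agrees with membership along any other, so the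
existential in `GraphExt` involves no real choice. -/
theorem Stable.short_unique (hT : hY.Stable T) {x : Y} {g g' : V} {δ : Path x (hY.vertex g)}
    {δ' : Path x (hY.vertex g')} (hδ : hY.Short δ) (hδ' : hY.Short δ')
    {k : Path.Homotopic.Quotient x₀ x} (h : T g (k.trans (.mk δ))) : T g' (k.trans (.mk δ')) := by
  by_cases hx : ∃ h, x = hY.vertex h
  · obtain ⟨h₀, rfl⟩ := hx
    rwa [← hT.short_vertex_iff hδ', hT.short_vertex_iff hδ]
  obtain hδ | ⟨g₁, s, u, ε, hε, hδ⟩ := hδ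
  · exact (hx ⟨g, by rw [← hδ 1, δ.target]⟩).elim
  obtain hδ' | ⟨g₁', s', u', ε', hε', hδ'⟩ := hδ'
  · exact (hx ⟨g', by rw [← hδ' 1, δ'.target]⟩).elim
  have e : (x : Complex2 R) = toGraph R (edge g₁ s u) := by
    rw [← convexComb_zero u ε, ← hδ 0, δ.source]
  have e' : (x : Complex2 R) = toGraph R (edge g₁' s' u') := by
    rw [← convexComb_zero u' ε', ← hδ' 0, δ'.source]
  -- A point that is not a vertex lies in the interior of a unique 1-cell, so both short paths run
  -- in the same edge.
  have hne : ∀ {g₁ s u}, (x : Complex2 R) = toGraph R (edge g₁ s u) → u ≠ 0 ∧ u ≠ 1 := by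
    rintro g₁ s u e
    refine ⟨?_, ?_⟩
    · rintro rfl
      rw [toGraph_edge_zero] at e
      exact hx ⟨⟨g₁, hY.vert_mem.1 (e ▸ x.2)⟩, Subtype.ext e⟩
    · rintro rfl
      rw [toGraph_edge_one] at e
      exact hx ⟨⟨_, hY.vert_mem.1 (e ▸ x.2)⟩, Subtype.ext e⟩
  have hee := toGraph_eq_iff.1 (e.symm.trans e')
  rw [normalize_edge (hne e).1 (hne e).2, normalize_edge (hne e').1 (hne e').2] at hee
  simp only [edge, Sum.inr.injEq, Sigma.mk.injEq, Prod.mk.injEq, heq_eq_eq] at hee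
  obtain ⟨⟨rfl, rfl⟩, rfl⟩ := hee
  have hsame : ε = ε' → T g' (k.trans (.mk δ')) := by
    rintro rfl
    obtain rfl : g = g' := hY.vertex_injective (by
      rw [← δ.target, ← δ'.target]; exact Subtype.ext ((hδ 1).trans (hδ' 1).symm))
    obtain rfl : δ = δ' := Path.ext (funext fun t => Subtype.ext ((hδ t).trans (hδ' t).symm))
    exact h
  obtain rfl | rfl := hε <;> obtain rfl | rfl := hε'
  · exact hsame rfl
  · exact (hT.short_iff_of_ends hδ hδ' k).1 h
  · exact (hT.short_iff_of_ends hδ' hδ k).2 h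
  · exact hsame rfl

/-- The extension of a stable set of path classes to paths that end in the graph. -/
def GraphExt (T : ∀ g : V, Path.Homotopic.Quotient x₀ (hY.vertex g) → Prop) (x : Y)
    (k : Path.Homotopic.Quotient x₀ x) : Prop :=
  ∃ (g : V) (δ : Path x (hY.vertex g)), hY.Short δ ∧ T g (k.trans (.mk δ))

theorem graphExt_vertex_iff (hT : hY.Stable T) {g : V}
    {k : Path.Homotopic.Quotient x₀ (hY.vertex g)} : GraphExt T (hY.vertex g) k ↔ T g k := by
  constructor
  · rintro ⟨g', δ, hδ, h⟩
    exact (hT.short_vertex_iff hδ k).2 h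
  · intro h
    refine ⟨g, Path.refl _, Or.inl fun t => rfl, ?_⟩
    rwa [Path.Homotopic.Quotient.mk_refl, Path.Homotopic.Quotient.trans_refl]

theorem GraphExt.mem_range {x : Y} {k : Path.Homotopic.Quotient x₀ x} (h : GraphExt T x k) :
    (x : Complex2 R) ∈ Set.range (toGraph R) := by
  obtain ⟨g, δ, hδ | ⟨g', s, u, ε, -, hδ⟩, -⟩ := h
  · exact ⟨vert g, by rw [← hδ 1, δ.target]; rfl⟩
  · exact ⟨_, by rw [← δ.source, hδ]⟩

/-- Paths in a part of the graph that is pushed along edges to a single vertex preserve the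
extension of a stable set. -/
theorem Stable.moves_of_tracks (hT : hY.Stable T) {W : Set (Complex2 R)} {g : V}
    (hW : W ⊆ Set.range (toGraph R)) {f : Cells1 R → C(I, Complex2 R)}
    (hf : ContinuousOn f (toGraph R ⁻¹' W))
    (hqf : ∀ c c', toGraph R c = toGraph R c' → toGraph R c ∈ W → f c = f c')
    (hfY : ∀ c, toGraph R c ∈ W → ∀ s, f c s ∈ Y)
    (h0 : ∀ c, toGraph R c ∈ W → f c 0 = toGraph R c)
    (h1 : ∀ c, toGraph R c ∈ W → f c 1 = toGraph R (vert g))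
    (hS : ∀ c, toGraph R c ∈ W → (∀ t, f c t = toGraph R c) ∨
      ∃ (g' : PresGroup R) (s : S) (u ε : I), (ε = 0 ∨ ε = 1) ∧
        ∀ t, f c t = toGraph R (edge g' s (convexComb u ε t)))
    {x y : Y} (γ : Path x y) (hγ : ∀ t, (γ t : Complex2 R) ∈ W) :
    Moves (GraphExt T) (Path.Homotopic.Quotient.mk γ) := by
  have hq : IsQuotientMap (W.restrictPreimage (toGraph R)) := by
    refine (isClosedMap_toGraph.restrictPreimage W).isQuotientMap
      continuous_toGraph.restrictPreimage fun w => ?_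
    obtain ⟨c, hc⟩ := hW w.2
    exact ⟨⟨c, by rw [Set.mem_preimage, hc]; exact w.2⟩, Subtype.ext hc⟩
  have key : ∀ z : Y, (z : Complex2 R) ∈ W → ∃ a : Path z (hY.vertex g), hY.Short a ∧
      ∀ c, toGraph R c = z → ∀ s, (a s : Complex2 R) = f c s := by
    intro z hz
    obtain ⟨c, hc⟩ := hW hz
    have hcW : toGraph R c ∈ W := hc ▸ hz
    have hcont : Continuous fun s => (⟨f c s, hfY c hcW s⟩ : Y) :=
      (f c).continuous.subtype_mk _
    refine ⟨⟨⟨_, hcont⟩, Subtype.ext ((h0 c hcW).trans hc), Subtype.ext (h1 c hcW)⟩, ?_, ?_⟩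
    · obtain h | h := hS c hcW
      · exact Or.inl fun t => Subtype.ext ((h t).trans hc)
      · exact Or.inr h
    · intro c' hc' s
      rw [hqf c' c (hc'.trans hc.symm) (hc'.symm ▸ hz)]
      rfl
  obtain ⟨a, haS, ha⟩ := key x (by simpa using hγ 0)
  obtain ⟨b, hbS, hb⟩ := key y (by simpa using hγ 1)
  obtain ⟨δ, hδ, he⟩ := exists_path_of_tracks hq hf hqf hfY h0 γ hγ a b ha hb
  have hδc : ∀ t, δ t = hY.vertex g := fun t => by
    obtain ⟨c, hc⟩ := hW (hγ t)
    exact Subtype.ext ((hδ t c hc).trans (h1 c (hc ▸ hγ t)))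
  -- All tracks end at the same vertex, so the pushed path is constant. Hence `γ` followed by the
  -- track of `y` is homotopic to the track of `x`.
  rw [Path.Homotopic.Quotient.mk_eq_refl hδc, Path.Homotopic.Quotient.trans_refl] at he
  rintro k ⟨g', δ', hδ', h⟩
  refine ⟨g, b, hbS, ?_⟩
  rw [Path.Homotopic.Quotient.trans_assoc, he]
  exact hT.short_unique hδ' haS h

end Fits

end Cayley

/-! ### Pushing points of the graph along edges to vertices -/

namespace Cayley

variable {S : Type*} {R : Set (GenWord S)}

/-- The straight paths in a 1-cell to the point with parameter `ε`. -/
def edgeLine (g : PresGroup R) (s : S) (ε : I) : C(I, C(I, Complex2 R)) :=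
  ContinuousMap.curry ⟨fun p => toGraph R (edge g s (convexComb p.1 ε p.2)),
    (continuous_toGraph.comp (continuous_edge g s)).comp (by fun_prop)⟩

@[simp] theorem edgeLine_apply (g : PresGroup R) (s : S) (ε u t : I) :
    edgeLine g s ε u t = toGraph R (edge g s (convexComb u ε t)) := rfl

theorem isOpenEmbedding_edge (g : PresGroup R) (s : S) : IsOpenEmbedding (edge g s) :=
  IsOpenEmbedding.inr.comp IsOpenEmbedding.sigmaMk

theorem isOpen_singleton_vert (g : PresGroup R) : IsOpen {vert g} := by
  have : {vert g} = Set.range (fun u : Unit =>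
      (Sum.inl (Sigma.mk g u : Σ _ : PresGroup R, Unit) : Cells1 R)) := by
    ext c
    rw [Set.mem_singleton_iff, Set.mem_range]
    exact ⟨fun h => ⟨(), h.symm⟩, fun ⟨_, h⟩ => h.symm⟩
  rw [this]
  exact (IsOpenEmbedding.inl.comp IsOpenEmbedding.sigmaMk).isOpen_range

theorem continuousAt_vert {Z : Type*} [TopologicalSpace Z] (f : Cells1 R → Z) (g : PresGroup R) :
    ContinuousAt f (vert g) := by
  rw [ContinuousAt, (isOpen_singleton_iff_nhds_eq_pure _).1 (isOpen_singleton_vert g)]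
  exact tendsto_pure_nhds _ _

/-- A family of paths on the cells of dimension at most one: constant at the 0-cells, and straight
to given end points on the 1-cells. -/
noncomputable def graphHomotopy (ε : PresGroup R → S → I → I) : Cells1 R → C(I, Complex2 R)
  | Sum.inl v => ContinuousMap.const I (toGraph R (Sum.inl v))
  | Sum.inr ⟨(g, s), u⟩ => edgeLine g s (ε g s u) u

theorem graphHomotopy_vert (ε : PresGroup R → S → I → I) (g : PresGroup R) :
    graphHomotopy ε (vert g) = ContinuousMap.const I (toGraph R (vert g)) := rfl

theorem graphHomotopy_edge (ε : PresGroup R → S → I → I) (g : PresGroup R) (s : S) (u : I) :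
    graphHomotopy ε (edge g s u) = edgeLine g s (ε g s u) u := rfl

theorem graphHomotopy_zero (ε : PresGroup R → S → I → I) (c : Cells1 R) :
    graphHomotopy ε c 0 = toGraph R c := by
  obtain ⟨g, rfl⟩ | ⟨g, s, u, rfl⟩ := cells1_cases c
  · rfl
  · rw [graphHomotopy_edge, edgeLine_apply, convexComb_zero]

theorem continuousAt_graphHomotopy_edge {ε : PresGroup R → S → I → I} {g : PresGroup R} {s : S}
    {u : I} (h : ∀ᶠ u' in 𝓝 u, ε g s u' = ε g s u) :
    ContinuousAt (graphHomotopy ε) (edge g s u) := by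
  rw [← (isOpenEmbedding_edge g s).continuousAt_iff]
  refine ((edgeLine g s (ε g s u)).continuous.continuousAt (x := u)).congr ?_
  filter_upwards [h] with u' hu'
  rw [Function.comp, graphHomotopy_edge, hu']

namespace Fits

variable {V : Set (PresGroup R)} {Y : Set (Complex2 R)} {hY : Fits V Y} {x₀ : Y}
  {T : ∀ g : V, Path.Homotopic.Quotient x₀ (hY.vertex g) → Prop}

/-- Every point is pushed to the source of the edge. Open edges are needed in the cover because the
push to the nearest end jumps at their midpoints. -/
theorem Stable.moves_of_open_edge (hT : hY.Stable T) {g : PresGroup R} {s : S} (hg : g ∈ V)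
    (hgs : g * PresGroup.gen R s ∈ V) {x y : Y} (γ : Path x y)
    (hγ : ∀ t, (γ t : Complex2 R) ∈ toGraph R '' (edge g s '' Set.Ioo 0 1)) :
    Moves (GraphExt T) (Path.Homotopic.Quotient.mk γ) := by
  have hc : ∀ c, toGraph R c ∈ toGraph R '' (edge g s '' Set.Ioo 0 1) →
      ∃ u ∈ Set.Ioo (0 : I) 1, c = edge g s u := by
    rintro c ⟨_, ⟨u, hu, rfl⟩, h⟩
    refine ⟨u, hu, ?_⟩
    rw [toGraph_eq_iff, normalize_edge hu.1.ne' hu.2.ne] at h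
    obtain ⟨g', rfl⟩ | ⟨g', s', u', rfl⟩ := cells1_cases c
    · cases h
    by_cases h0 : u' = 0
    · rw [h0, normalize_edge_zero] at h; cases h
    by_cases h1 : u' = 1
    · rw [h1, normalize_edge_one] at h; cases h
    rw [normalize_edge h0 h1] at h
    exact h.symm
  refine hT.moves_of_tracks (g := ⟨g, hg⟩) (f := graphHomotopy fun _ _ _ => 0)
    (Set.image_subset_range _ _) ?_ ?_ ?_ (fun c _ => graphHomotopy_zero _ c) ?_ ?_ γ hγ
  · intro c hcW
    obtain ⟨u, hu, rfl⟩ := hc c hcW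
    exact (continuousAt_graphHomotopy_edge (.of_forall fun _ => rfl)).continuousWithinAt
  · intro c c' h hcW
    obtain ⟨u, hu, rfl⟩ := hc c hcW
    obtain ⟨u', hu', rfl⟩ := hc c' (h ▸ hcW)
    rw [toGraph_eq_iff, normalize_edge hu.1.ne' hu.2.ne, normalize_edge hu'.1.ne' hu'.2.ne] at h
    rw [h]
  · intro c hcW t
    obtain ⟨u, hu, rfl⟩ := hc c hcW
    exact hY.edge_mem hg hgs _
  · intro c hcW
    obtain ⟨u, hu, rfl⟩ := hc c hcW
    rw [graphHomotopy_edge, edgeLine_apply, convexComb_one, toGraph_edge_zero]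
  · intro c hcW
    obtain ⟨u, hu, rfl⟩ := hc c hcW
    exact Or.inr ⟨g, s, u, 0, Or.inl rfl, fun t => rfl⟩

open Classical in
variable (V) in
/-- The end point to which a point of a 1-cell is pushed: the nearest end point if both are in `V`,
and otherwise the end point that is in `V`. -/
noncomputable def endParam (g : PresGroup R) (s : S) (u : I) : I :=
  if g ∈ V ∧ g * PresGroup.gen R s ∈ V then if (u : ℝ) < 1 / 2 then 0 else 1
  else if g ∈ V then 0 else 1

variable (V) in
theorem endParam_eq (g : PresGroup R) (s : S) (u : I) :
    endParam V g s u = 0 ∨ endParam V g s u = 1 := by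
  unfold endParam; split_ifs <;> simp

variable (V) in
/-- The vertex to which a point of a cell of dimension at most one is pushed. -/
noncomputable def endVertex : Cells1 R → PresGroup R
  | Sum.inl v => v.1
  | Sum.inr ⟨(g, s), u⟩ => open Classical in
    if endParam V g s u = 0 then g else g * PresGroup.gen R s

@[simp] theorem endVertex_vert (g : PresGroup R) : endVertex V (vert g) = g := rfl

open Classical in
theorem endVertex_edge (g : PresGroup R) (s : S) (u : I) : endVertex V (edge g s u) =
    if endParam V g s u = 0 then g else g * PresGroup.gen R s := rfl

theorem graphHomotopy_endParam_one (c : Cells1 R) :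
    graphHomotopy (endParam V) c 1 = toGraph R (vert (endVertex V c)) := by
  obtain ⟨g, rfl⟩ | ⟨g, s, u, rfl⟩ := cells1_cases c
  · rfl
  · rw [graphHomotopy_edge, edgeLine_apply, convexComb_one, endVertex_edge]
    obtain h | h := endParam_eq V g s u
    · rw [h, if_pos rfl, toGraph_edge_zero]
    · rw [h, if_neg one_ne_zero, toGraph_edge_one]

include hY in
theorem graphHomotopy_endParam_mem (c : Cells1 R) (hc : toGraph R c ∈ Y) (t : I) :
    graphHomotopy (endParam V) c t ∈ Y := by
  obtain ⟨g, rfl⟩ | ⟨g, s, u, rfl⟩ := cells1_cases c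
  · exact hc
  · rw [graphHomotopy_edge, edgeLine_apply]
    by_cases h : g ∈ V ∧ g * PresGroup.gen R s ∈ V
    · exact hY.edge_mem h.1 h.2 _
    · rw [endParam, if_neg h]
      obtain ⟨h1, h2⟩ | ⟨h1, h2⟩ := hY.edge_mixed h hc
      · rw [if_pos h1]
        exact h2 _ (by
          rw [← convexComb_symm]; exact convexComb_le u.2.1 _)
      · rw [if_neg fun h' => h ⟨h', h1⟩]
        exact h2 _ (le_convexComb u.2.2 _)

include hY in
theorem endVertex_mem (c : Cells1 R) (hc : toGraph R c ∈ Y) : endVertex V c ∈ V := by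
  rw [← hY.vert_mem, ← graphHomotopy_endParam_one]
  exact graphHomotopy_endParam_mem (hY := hY) c hc 1

-- At an end point of a 1-cell that lies in `Y`, the push goes to that same end and is constant.
-- This is why the push respects the gluing of edges to vertices.
include hY in
theorem normalize_eq_or_of_mem (c : Cells1 R) (hc : toGraph R c ∈ Y) :
    normalize c = c ∨ normalize c = vert (endVertex V c) ∧
      graphHomotopy (endParam V) c = ContinuousMap.const I (toGraph R c) := by
  obtain ⟨g, rfl⟩ | ⟨g, s, u, rfl⟩ := cells1_cases c
  · exact Or.inl rfl
  by_cases h0 : u = 0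
  · subst h0
    rw [toGraph_edge_zero, hY.vert_mem] at hc
    have he : endParam V g s 0 = 0 := by simp [endParam, hc]
    refine Or.inr ⟨by rw [normalize_edge_zero, endVertex_edge, he, if_pos rfl], ?_⟩
    ext t
    rw [graphHomotopy_edge, edgeLine_apply, he, convexComb_eq]; rfl
  by_cases h1 : u = 1
  · subst h1
    rw [toGraph_edge_one, hY.vert_mem] at hc
    have he : endParam V g s 1 = 1 := by
      by_cases hg : g ∈ V <;> simp only [endParam, hc, hg, and_true, if_true, if_false]
      exact if_neg (by norm_num)
    refine Or.inr ⟨by rw [normalize_edge_one, endVertex_edge, he, if_neg one_ne_zero], ?_⟩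
    ext t
    rw [graphHomotopy_edge, edgeLine_apply, he, convexComb_eq]; rfl
  exact Or.inl (normalize_edge h0 h1)

include hY in
theorem endVertex_normalize (c : Cells1 R) (hc : toGraph R c ∈ Y) :
    endVertex V (normalize c) = endVertex V c := by
  obtain h | h := normalize_eq_or_of_mem (hY := hY) c hc
  · rw [h]
  · rw [h.1, endVertex_vert]

include hY in
theorem graphHomotopy_normalize (c : Cells1 R) (hc : toGraph R c ∈ Y) :
    graphHomotopy (endParam V) (normalize c) = graphHomotopy (endParam V) c := by
  obtain h | h := normalize_eq_or_of_mem (hY := hY) c hc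
  · rw [h]
  · rw [h.2, ← toGraph_normalize, h.1, graphHomotopy_vert]

variable (V) in
/-- The midpoints of the 1-cells with both end points in `V`. -/
def midpoints : Set (Cells1 R) :=
  {c | ∃ (g : PresGroup R) (s : S) (u : I), (g ∈ V ∧ g * PresGroup.gen R s ∈ V) ∧ (u : ℝ) = 1 / 2 ∧ c = edge g s u}

/-- The chosen end changes only at the midpoint of an edge with both ends in `V`. On any other edge
it does not depend on the point. -/
theorem endParam_eventuallyEq {g : PresGroup R} {s : S} {u : I}
    (h : edge g s u ∉ midpoints V) : ∀ᶠ u' in 𝓝 u, endParam V g s u' = endParam V g s u := by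
  by_cases hV : g ∈ V ∧ g * PresGroup.gen R s ∈ V
  · simp only [endParam, if_pos hV]
    have hu : (u : ℝ) ≠ 1 / 2 := fun hu => h ⟨g, s, u, hV, hu, rfl⟩
    obtain hu | hu := lt_or_gt_of_ne hu
    · filter_upwards [continuous_subtype_val.continuousAt.eventually (gt_mem_nhds hu)] with u' hu'
      rw [if_pos hu, if_pos hu']
    · filter_upwards [continuous_subtype_val.continuousAt.eventually (lt_mem_nhds hu)] with u' hu'
      rw [if_neg (not_lt.2 hu.le), if_neg (not_lt.2 hu'.le)]
  · simp only [endParam, if_neg hV]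
    exact .of_forall fun _ => trivial

theorem continuousAt_graphHomotopy_endParam {c : Cells1 R} (h : c ∉ midpoints V) :
    ContinuousAt (graphHomotopy (endParam V)) c := by
  obtain ⟨g, rfl⟩ | ⟨g, s, u, rfl⟩ := cells1_cases c
  · exact continuousAt_vert _ _
  · exact continuousAt_graphHomotopy_edge (endParam_eventuallyEq h)

theorem normalize_midpoint {c : Cells1 R} (h : c ∈ midpoints V) : normalize c = c := by
  obtain ⟨g, s, u, -, hu, rfl⟩ := h
  refine normalize_edge ?_ ?_ <;> rintro rfl <;> norm_num at hu

theorem eq_of_normalize_mem_midpoints {c : Cells1 R} (h : normalize c ∈ midpoints V) :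
    normalize c = c := by
  obtain ⟨g, rfl⟩ | ⟨g, s, u, rfl⟩ := cells1_cases c
  · rfl
  by_cases h0 : u = 0
  · rw [h0, normalize_edge_zero] at h
    obtain ⟨_, _, _, _, _, h⟩ := h
    cases h
  by_cases h1 : u = 1
  · rw [h1, normalize_edge_one] at h
    obtain ⟨_, _, _, _, _, h⟩ := h
    cases h
  exact normalize_edge h0 h1

variable (V) in
/-- The points that are pushed to the vertex `g`. -/
def star (g : PresGroup R) : Set (Cells1 R) := {c | endVertex V c = g ∧ c ∉ midpoints V}

theorem isOpen_star (g : PresGroup R) : IsOpen (star V g) := by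
  rw [isOpen_iff_mem_nhds]
  rintro c ⟨hc, hm⟩
  obtain ⟨g', rfl⟩ | ⟨g', s, u, rfl⟩ := cells1_cases c
  · exact Filter.mem_of_superset ((isOpen_singleton_vert g').mem_nhds rfl)
      (Set.singleton_subset_iff.2 ⟨hc, hm⟩)
  · rw [← (isOpenEmbedding_edge g' s).map_nhds_eq, Filter.mem_map]
    have h2 : ∀ᶠ u' in 𝓝 u, edge g' s u' ∉ midpoints V := by
      by_cases hV : g' ∈ V ∧ g' * PresGroup.gen R s ∈ V
      · have hu : (u : ℝ) ≠ 1 / 2 := fun hu => hm ⟨g', s, u, hV, hu, rfl⟩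
        filter_upwards [continuous_subtype_val.continuousAt.eventually_ne hu] with u' hu'
        rintro ⟨_, _, _, -, h, h'⟩
        cases h'
        exact hu' h
      · refine .of_forall fun u' => ?_
        rintro ⟨_, _, _, h, -, h'⟩
        cases h'
        exact hV h
    filter_upwards [endParam_eventuallyEq hm, h2] with u' h1 h2
    refine ⟨?_, h2⟩
    rw [← hc, endVertex_edge, endVertex_edge, h1]

include hY in
theorem mem_star_iff_of_toGraph_eq {g : PresGroup R} {c c' : Cells1 R}
    (h : toGraph R c = toGraph R c') (hc : toGraph R c ∈ Y) : c ∈ star V g ↔ c' ∈ star V g := by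
  have h1 := toGraph_eq_iff.1 h
  have h2 : c ∈ midpoints V ↔ c' ∈ midpoints V := by
    constructor
    · intro hm
      have h3 := normalize_midpoint hm
      have h4 := eq_of_normalize_mem_midpoints (c := c') (by rwa [← h1, h3])
      rwa [← h4, ← h1, h3]
    · intro hm
      have h3 := normalize_midpoint hm
      have h4 := eq_of_normalize_mem_midpoints (c := c) (by rwa [h1, h3])
      rwa [← h4, h1, h3]
  rw [star, Set.mem_ofPred_eq, Set.mem_ofPred_eq, h2, ← endVertex_normalize (hY := hY) c hc, h1,
    endVertex_normalize (hY := hY) c' (h ▸ hc)]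

theorem Stable.moves_of_star (hT : hY.Stable T) {g : PresGroup R} {x y : Y} (γ : Path x y)
    (hγ : ∀ t, (γ t : Complex2 R) ∈ toGraph R '' star V g) :
    Moves (GraphExt T) (Path.Homotopic.Quotient.mk γ) := by
  have hc : ∀ c, toGraph R c ∈ toGraph R '' star V g ∩ Y → c ∈ star V g := by
    rintro c ⟨⟨c', hc', h⟩, h2⟩
    exact (mem_star_iff_of_toGraph_eq (hY := hY) h (h ▸ h2)).1 hc'
  have hg : g ∈ V := by
    obtain ⟨c, hc, h⟩ := hγ 0
    rw [← hc.1]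
    exact endVertex_mem (hY := hY) c (h ▸ (γ 0).2)
  refine hT.moves_of_tracks (W := toGraph R '' star V g ∩ Y) (g := ⟨g, hg⟩)
    (f := graphHomotopy (endParam V)) (Set.inter_subset_left.trans (Set.image_subset_range _ _))
    ?_ ?_ ?_ (fun c _ => graphHomotopy_zero _ c) ?_ ?_ γ fun t => ⟨hγ t, (γ t).2⟩
  · intro c hcW
    exact (continuousAt_graphHomotopy_endParam (hc c hcW).2).continuousWithinAt
  · intro c c' h hcW
    rw [← graphHomotopy_normalize (hY := hY) c hcW.2, toGraph_eq_iff.1 h,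
      graphHomotopy_normalize (hY := hY) c' (h ▸ hcW.2)]
  · exact fun c hcW t => graphHomotopy_endParam_mem (hY := hY) c hcW.2 t
  · intro c hcW
    rw [graphHomotopy_endParam_one, (hc c hcW).1]
  · intro c hcW
    obtain ⟨g', rfl⟩ | ⟨g', s, u, rfl⟩ := cells1_cases c
    · exact Or.inl fun t => rfl
    · exact Or.inr ⟨g', s, u, _, endParam_eq V g' s u, fun t => rfl⟩

/-- Paths in the graph preserve the extension of a stable set. -/
theorem Stable.moves_of_graph (hT : hY.Stable T) {x y : Y} (γ : Path x y)
    (hγ : ∀ t, (γ t : Complex2 R) ∈ Set.range (toGraph R)) :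
    Moves (GraphExt T) (Path.Homotopic.Quotient.mk γ) := by
  -- The image of a saturated open set need not be open in the complex, but its trace on a path in
  -- the graph is. Its complement there comes from the closed image of `Oᶜ`.
  have hopen : ∀ O : Set (Cells1 R), IsOpen O →
      (∀ c c', toGraph R c = toGraph R c' → toGraph R c ∈ Y → c ∈ O → c' ∈ O) →
      IsOpen (γ ⁻¹' {y | (y : Complex2 R) ∈ toGraph R '' O}) := by
    intro O hO hsat
    have h1 : IsClosed (toGraph R '' Oᶜ) := isClosedMap_toGraph _ hO.isClosed_compl
    have h2 : IsClosed (γ ⁻¹' {y | (y : Complex2 R) ∈ toGraph R '' Oᶜ}) :=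
      h1.preimage (continuous_subtype_val.comp γ.continuous)
    convert h2.isOpen_compl using 1
    ext t
    constructor
    · rintro ⟨c, hc, h⟩ ⟨c', hc', h'⟩
      exact hc' (hsat c c' (h.trans h'.symm) (h ▸ (γ t).2) hc)
    · intro h
      obtain ⟨c, hc⟩ := hγ t
      by_contra h2
      exact h ⟨c, fun hcO => h2 ⟨c, hcO, hc⟩, hc⟩
  let ι := PresGroup R ⊕ {e : PresGroup R × S // e.1 ∈ V ∧ e.1 * PresGroup.gen R e.2 ∈ V}
  let O : ι → Set (Cells1 R) := Sum.elim (star V) fun e => edge e.1.1 e.1.2 '' Set.Ioo 0 1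
  refine Moves.of_cover (U := fun i => {y | (y : Complex2 R) ∈ toGraph R '' O i}) ?_ ?_ ?_
  · rintro (g | e)
    · exact hopen _ (isOpen_star g) fun c c' h hc => (mem_star_iff_of_toGraph_eq (hY := hY) h hc).1
    · refine hopen _ ((isOpenEmbedding_edge _ _).isOpenMap _ isOpen_Ioo) ?_
      rintro _ c' h - ⟨u, hu, rfl⟩
      rw [toGraph_eq_iff, normalize_edge hu.1.ne' hu.2.ne] at h
      obtain ⟨g', rfl⟩ | ⟨g', s', u', rfl⟩ := cells1_cases c'
      · cases h
      by_cases h0 : u' = 0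
      · rw [h0, normalize_edge_zero] at h; cases h
      by_cases h1 : u' = 1
      · rw [h1, normalize_edge_one] at h; cases h
      rw [normalize_edge h0 h1] at h
      exact ⟨u, hu, h⟩
  · intro t
    obtain ⟨c, hc⟩ := hγ t
    -- The stars cover everything except the midpoints, and each midpoint lies in an open edge with
    -- both ends in `V`.
    by_cases hm : c ∈ midpoints V
    · obtain ⟨g, s, u, hV, hu, rfl⟩ := hm
      refine ⟨Sum.inr ⟨(g, s), hV⟩, _, ⟨u, ⟨?_, ?_⟩, rfl⟩, hc⟩
      · rw [← Subtype.coe_lt_coe, hu]; norm_num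
      · rw [← Subtype.coe_lt_coe, hu]; norm_num
    · exact ⟨Sum.inl (endVertex V c), c, ⟨rfl, hm⟩, hc⟩
  · rintro (g | e) a b δ hδ -
    · exact hT.moves_of_star δ hδ
    · exact hT.moves_of_open_edge e.2.1 e.2.2 δ hδ

end Fits

end Cayley

/-! ### Pushing 2-cells to their boundaries, and the extension of stable sets to all paths -/

namespace Cayley

instance : SimplyConnectedSpace 𝔻 :=
  have : ContractibleSpace 𝔻 := (convex_closedBall (0 : ℂ) 1).contractibleSpace ⟨0, by simp⟩
  inferInstance

/-- The point with parameter `t` on the segment from `z` to `w`. -/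
noncomputable def discLine (z w : 𝔻) (t : I) : 𝔻 :=
  ⟨(1 - (t : ℝ)) • (z : ℂ) + (t : ℝ) • (w : ℂ), convex_closedBall (0 : ℂ) 1 z.2 w.2
    (sub_nonneg.2 t.2.2) t.2.1 (by ring)⟩

theorem coe_discLine (z w : 𝔻) (t : I) :
    (discLine z w t : ℂ) = (1 - (t : ℝ)) • (z : ℂ) + (t : ℝ) • (w : ℂ) := rfl

@[simp] theorem discLine_zero (z w : 𝔻) : discLine z w 0 = z := by
  ext; simp [discLine]

@[simp] theorem discLine_one (z w : 𝔻) : discLine z w 1 = w := by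
  ext; simp [discLine]

@[simp] theorem discLine_self (z : 𝔻) (t : I) : discLine z z t = z := by
  ext
  rw [coe_discLine, ← add_smul]
  simp

@[fun_prop]
theorem continuous_discLine : Continuous fun p : (𝔻 × 𝔻) × I => discLine p.1.1 p.1.2 p.2 := by
  unfold discLine
  fun_prop

theorem norm_discLine_lt {z w : 𝔻} {t : I} (hz : ‖(z : ℂ)‖ < 1) (ht : t ≠ 1) :
    ‖(discLine z w t : ℂ)‖ < 1 := by
  have ht1 : (t : ℝ) < 1 := lt_of_le_of_ne t.2.2 fun h => ht (Subtype.ext h)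
  have ht0 : 0 ≤ (t : ℝ) := t.2.1
  have hw : ‖(w : ℂ)‖ ≤ 1 := mem_closedBall_zero_iff.1 w.2
  calc _ ≤ ‖(1 - (t : ℝ)) • (z : ℂ)‖ + ‖(t : ℝ) • (w : ℂ)‖ := norm_add_le _ _
    _ = (1 - t) * ‖(z : ℂ)‖ + t * ‖(w : ℂ)‖ := by
      rw [norm_smul, norm_smul, Real.norm_of_nonneg (sub_nonneg.2 ht1.le), Real.norm_of_nonneg ht0]
    _ < 1 := by nlinarith

/-- The segment from `z` to `w`, as a path. -/
noncomputable def discPath (z w : 𝔻) : Path z w :=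
  ⟨⟨discLine z w, continuous_discLine.comp (by fun_prop : Continuous fun t : I => ((z, w), t))⟩,
    discLine_zero z w, discLine_one z w⟩

/-- The radial projection to the boundary of the disc; the center is fixed. -/
noncomputable def radial (z : 𝔻) : 𝔻 :=
  ⟨(‖(z : ℂ)‖⁻¹ : ℝ) • (z : ℂ), by
    rw [mem_closedBall_zero_iff, norm_smul, norm_inv, norm_norm]
    exact inv_mul_le_one⟩

theorem norm_radial {z : 𝔻} (hz : (z : ℂ) ≠ 0) : ‖(radial z : ℂ)‖ = 1 := by
  rw [radial, norm_smul, norm_inv, norm_norm, inv_mul_cancel₀ (norm_ne_zero_iff.2 hz)]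

theorem radial_eq_self {z : 𝔻} (hz : ‖(z : ℂ)‖ = 1) : radial z = z := by
  ext; simp [radial, hz]

theorem continuousOn_radial : ContinuousOn radial {z | (z : ℂ) ≠ 0} := by
  rw [Topology.IsInducing.subtypeVal.continuousOn_iff]
  exact ((continuous_norm.comp continuous_subtype_val).continuousOn.inv₀
    fun z hz => norm_ne_zero_iff.2 hz).smul continuous_subtype_val.continuousOn

variable {S : Type*} {R : Set (GenWord S)}

theorem continuous_disc (g : PresGroup R) (r : R) :
    Continuous fun z => toComplex R (cell2 R g r z) :=
  isQuotientMap_toComplex.continuous.comp (continuous_cell2 g r)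

/-- The straight paths in a 2-cell. -/
noncomputable def discSegment (g : PresGroup R) (r : R) : C(𝔻 × 𝔻, C(I, Complex2 R)) :=
  ContinuousMap.curry ⟨fun p => toComplex R (cell2 R g r (discLine p.1.1 p.1.2 p.2)),
    (continuous_disc g r).comp continuous_discLine⟩

@[simp] theorem discSegment_apply (g : PresGroup R) (r : R) (z w : 𝔻) (t : I) :
    discSegment g r (z, w) t = toComplex R (cell2 R g r (discLine z w t)) := rfl

/-- A family of paths on the cells: constant at the cells of dimension at most one, and straight to
given end points on the 2-cells. -/
noncomputable def discHomotopy (ρ : PresGroup R → R → 𝔻 → 𝔻) : Cells R → C(I, Complex2 R)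
  | Sum.inl v => ContinuousMap.const I (toComplex R (Sum.inl v))
  | Sum.inr (Sum.inl e) => ContinuousMap.const I (toComplex R (Sum.inr (Sum.inl e)))
  | Sum.inr (Sum.inr ⟨(g, r), z⟩) => discSegment g r (z, ρ g r z)

theorem discHomotopy_incl (ρ : PresGroup R → R → 𝔻 → 𝔻) (c : Cells1 R) :
    discHomotopy ρ (incl R c) = ContinuousMap.const I (toGraph R c) := by
  obtain c | c := c <;> rfl

theorem discHomotopy_cell2 (ρ : PresGroup R → R → 𝔻 → 𝔻) (g : PresGroup R) (r : R) (z : 𝔻) :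
    discHomotopy ρ (cell2 R g r z) = discSegment g r (z, ρ g r z) := rfl

theorem discHomotopy_zero (ρ : PresGroup R → R → 𝔻 → 𝔻) (c : Cells R) :
    discHomotopy ρ c 0 = toComplex R c := by
  obtain ⟨c, rfl⟩ | ⟨g, r, z, rfl⟩ := cells_cases c
  · rw [discHomotopy_incl]; rfl
  · rw [discHomotopy_cell2, discSegment_apply, discLine_zero]

theorem isOpenEmbedding_incl : IsOpenEmbedding (incl R) := by
  refine .of_continuous_injective_isOpenMap (continuous_id.sumMap continuous_inl)
    (Sum.map_injective.2 ⟨Function.injective_id, Sum.inl_injective⟩)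
    (isOpenMap_sum.2 ⟨?_, ?_⟩)
  · exact IsOpenEmbedding.inl.isOpenMap
  · exact (IsOpenEmbedding.inr.comp IsOpenEmbedding.inl).isOpenMap

theorem isOpenEmbedding_cell2 (g : PresGroup R) (r : R) : IsOpenEmbedding (cell2 R g r) :=
  IsOpenEmbedding.inr.comp (IsOpenEmbedding.inr.comp IsOpenEmbedding.sigmaMk)

theorem continuousOn_discHomotopy {ρ : PresGroup R → R → 𝔻 → 𝔻} {P : Set (Cells R)}
    (hρ : ∀ g r, ContinuousOn (ρ g r) {z | cell2 R g r z ∈ P}) :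
    ContinuousOn (discHomotopy ρ) P := by
  intro c hc
  obtain ⟨c, rfl⟩ | ⟨g, r, z, rfl⟩ := cells_cases c
  · refine ContinuousAt.continuousWithinAt ?_
    rw [← isOpenEmbedding_incl.continuousAt_iff]
    have : discHomotopy ρ ∘ incl R = fun c => ContinuousMap.const I (toGraph R c) :=
      funext (discHomotopy_incl ρ)
    rw [this]
    exact (ContinuousMap.const'.continuous.comp continuous_toGraph).continuousAt
  · rw [ContinuousWithinAt, ← (isOpenEmbedding_cell2 g r).map_nhdsWithin_preimage_eq,
      Filter.tendsto_map'_iff]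
    exact (discSegment g r).continuous.continuousAt.comp_continuousWithinAt
      (continuousWithinAt_id.prodMk (hρ g r z hc))

namespace Fits

variable {V : Set (PresGroup R)} {Y : Set (Complex2 R)} {hY : Fits V Y} {x₀ : Y}
  {T : ∀ g : V, Path.Homotopic.Quotient x₀ (hY.vertex g) → Prop}

variable (Y) in
/-- The closed 2-cell is contained in `Y`. -/
def IsFull (g : PresGroup R) (r : R) : Prop := ∀ z, toComplex R (cell2 R g r z) ∈ Y

variable (hY) in
open Classical in
/-- The retraction of a 2-cell that is not contained in `Y`. -/
noncomputable def retraction (g : PresGroup R) (r : R) : 𝔻 → 𝔻 :=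
  if h : IsFull Y g r then id else (hY.disc_mixed g r h).choose

variable (hY) in
open Classical in
/-- The boundary point to which a point of a 2-cell other than its center is pushed. -/
noncomputable def push (g : PresGroup R) (r : R) (z : 𝔻) : 𝔻 :=
  if IsFull Y g r then radial z else hY.retraction g r z

variable (hY) in
open Classical in
/-- A boundary point that can be joined to the given point of a 2-cell. -/
noncomputable def target (g : PresGroup R) (r : R) (z : 𝔻) : 𝔻 :=
  if IsFull Y g r then circlePoint 0 else hY.retraction g r z

theorem retraction_spec {g : PresGroup R} {r : R} (h : ¬ IsFull Y g r) :
    ContinuousOn (hY.retraction g r) {z | toComplex R (cell2 R g r z) ∈ Y} ∧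
      ∀ z, toComplex R (cell2 R g r z) ∈ Y →
        toComplex R (cell2 R g r (hY.retraction g r z)) ∈ Y ∧
        ‖(hY.retraction g r z : ℂ)‖ = 1 ∧ (‖(z : ℂ)‖ = 1 → hY.retraction g r z = z) := by
  rw [retraction, dif_neg h]
  exact (hY.disc_mixed g r h).choose_spec

theorem push_spec {g : PresGroup R} {r : R} {z : 𝔻} (hz : toComplex R (cell2 R g r z) ∈ Y)
    (h0 : IsFull Y g r → (z : ℂ) ≠ 0) : toComplex R (cell2 R g r (hY.push g r z)) ∈ Y ∧
      ‖(hY.push g r z : ℂ)‖ = 1 ∧ (‖(z : ℂ)‖ = 1 → hY.push g r z = z) := by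
  by_cases h : IsFull Y g r
  · rw [push, if_pos h]
    exact ⟨h _, norm_radial (h0 h), radial_eq_self⟩
  · rw [push, if_neg h]
    exact (retraction_spec h).2 z hz

theorem continuousOn_push (g : PresGroup R) (r : R) : ContinuousOn (hY.push g r)
    {z | toComplex R (cell2 R g r z) ∈ Y ∧ (IsFull Y g r → (z : ℂ) ≠ 0)} := by
  unfold push
  by_cases h : IsFull Y g r
  · simp only [if_pos h]
    exact continuousOn_radial.mono fun z hz => hz.2 h
  · simp only [if_neg h]
    exact (retraction_spec h).1.mono fun z hz => hz.1

theorem target_spec {g : PresGroup R} {r : R} {z : 𝔻} (hz : toComplex R (cell2 R g r z) ∈ Y) :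
    toComplex R (cell2 R g r (hY.target g r z)) ∈ Y ∧ ‖(hY.target g r z : ℂ)‖ = 1 := by
  by_cases h : IsFull Y g r
  · rw [target, if_pos h]
    exact ⟨h _, norm_circlePoint _⟩
  · rw [target, if_neg h]
    exact ⟨((retraction_spec h).2 z hz).1, ((retraction_spec h).2 z hz).2.1⟩

-- A segment that starts in the open disc stays there until its last point, so only its end point
-- has to be checked separately.
include hY in
theorem discLine_mem {g : PresGroup R} {r : R} {z w : 𝔻} (hz1 : ‖(z : ℂ)‖ < 1)
    (hz : toComplex R (cell2 R g r z) ∈ Y) (hw : toComplex R (cell2 R g r w) ∈ Y) (t : I) :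
    toComplex R (cell2 R g r (discLine z w t)) ∈ Y := by
  by_cases ht : t = 1
  · rwa [ht, discLine_one]
  · exact hY.disc_interior hz1 (norm_discLine_lt hz1 ht) hz

theorem mem_range_toGraph_iff {g : PresGroup R} {r : R} {z : 𝔻} :
    toComplex R (cell2 R g r z) ∈ Set.range (toGraph R) ↔ ‖(z : ℂ)‖ = 1 := by
  constructor
  · rintro ⟨c, hc⟩
    by_contra hz
    exact toComplex_cell2_ne_toGraph hz c hc.symm
  · intro hz
    obtain ⟨c, hc⟩ := exists_toComplex_cell2_eq g r hz
    exact ⟨c, hc.symm⟩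

theorem norm_lt_one_of_ne {z : 𝔻} (hz : ‖(z : ℂ)‖ ≠ 1) : ‖(z : ℂ)‖ < 1 :=
  lt_of_le_of_ne (mem_closedBall_zero_iff.1 z.2) hz

theorem mem_range_or_interior (x : Complex2 R) : x ∈ Set.range (toGraph R) ∨
    ∃ (g : PresGroup R) (r : R) (z : 𝔻), ‖(z : ℂ)‖ < 1 ∧ x = toComplex R (cell2 R g r z) := by
  obtain ⟨c, rfl⟩ := isQuotientMap_toComplex.surjective x
  obtain ⟨c, rfl⟩ | ⟨g, r, z, rfl⟩ := cells_cases c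
  · exact Or.inl ⟨c, rfl⟩
  by_cases hz : ‖(z : ℂ)‖ = 1
  · exact Or.inl (mem_range_toGraph_iff.2 hz)
  · exact Or.inr ⟨g, r, z, norm_lt_one_of_ne hz, rfl⟩

theorem Stable.graphExt_iff (hT : hY.Stable T) {x y : Y} (γ : Path x y)
    (hγ : ∀ t, (γ t : Complex2 R) ∈ Set.range (toGraph R))
    (k : Path.Homotopic.Quotient x₀ x) : GraphExt T x k ↔ GraphExt T y (k.trans (.mk γ)) := by
  refine ⟨hT.moves_of_graph γ hγ k, fun h => ?_⟩
  have := hT.moves_of_graph γ.symm (fun t => hγ _) _ h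
  rwa [Path.Homotopic.Quotient.mk_symm, Path.Homotopic.Quotient.trans_assoc,
    Path.Homotopic.Quotient.trans_symm, Path.Homotopic.Quotient.trans_refl] at this

/-- In a full cell `target` is one fixed boundary point, which makes sense at the center too,
whereas `push` is the radial projection. The two segments differ by a boundary arc, because the disc
is simply connected, and boundary arcs lie in the graph. In the other cells the two maps coincide.
-/
theorem Stable.graphExt_target_iff (hT : hY.Stable T) {g : PresGroup R} {r : R} {z : 𝔻} {x y y' : Y}
    (hx : (x : Complex2 R) = toComplex R (cell2 R g r z)) (h0 : IsFull Y g r → (z : ℂ) ≠ 0)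
    {δ : Path x y} (hδ : ∀ t, (δ t : Complex2 R) = discSegment g r (z, hY.target g r z) t)
    {a : Path x y'} (ha : ∀ t, (a t : Complex2 R) = discSegment g r (z, hY.push g r z) t)
    (k : Path.Homotopic.Quotient x₀ x) :
    GraphExt T y (k.trans (.mk δ)) ↔ GraphExt T y' (k.trans (.mk a)) := by
  by_cases h : IsFull Y g r
  · obtain ⟨θ, -, -, hθ⟩ := exists_circlePoint_eq
      (push_spec (hY := hY) (hx ▸ x.2) h0).2.1 0
    have hc : Continuous fun w => (⟨toComplex R (cell2 R g r w), h w⟩ : Y) :=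
      (continuous_disc g r).subtype_mk _
    let ζ' : Path (circlePoint 0) (hY.push g r z) := ⟨⟨fun t : I => circlePoint (t * θ),
      continuous_circlePoint.comp (by fun_prop)⟩, by simp, by simp [hθ]⟩
    have htgt : hY.target g r z = circlePoint 0 := if_pos h
    have hy : y = ⟨toComplex R (cell2 R g r (circlePoint 0)), h _⟩ := by
      rw [← δ.target]
      exact Subtype.ext (by rw [hδ, discSegment_apply, discLine_one, htgt])
    have hy' : y' = ⟨toComplex R (cell2 R g r (hY.push g r z)), h _⟩ := by
      rw [← a.target]
      exact Subtype.ext (by rw [ha, discSegment_apply, discLine_one])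
    let ζ : Path y y' := (ζ'.map hc).cast hy hy'
    rw [hT.graphExt_iff ζ (fun t => mem_range_toGraph_iff.2 (norm_circlePoint _)),
      Path.Homotopic.Quotient.trans_assoc,
      Path.Homotopic.Quotient.trans_eq_of_lift hc (r := a) (discPath z (circlePoint 0)) ζ'
        (discPath z (hY.push g r z)) (fun t => Subtype.ext ?_) (fun t => rfl)
        (fun t => Subtype.ext (ha t))]
    rw [hδ, htgt]
    rfl
  · have htgt : hY.target g r z = hY.push g r z := by rw [target, push, if_neg h, if_neg h]
    obtain rfl : y = y' := by
      rw [← δ.target, ← a.target]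
      exact Subtype.ext (by rw [hδ, ha, htgt])
    obtain rfl : δ = a := Path.ext (funext fun t => Subtype.ext (by rw [hδ, ha, htgt]))
    exact Iff.rfl

/-- The extension of a stable set of path classes to all paths. -/
def Ext (T : ∀ g : V, Path.Homotopic.Quotient x₀ (hY.vertex g) → Prop) (x : Y)
    (k : Path.Homotopic.Quotient x₀ x) : Prop :=
  GraphExt T x k ∨ ∃ (g : PresGroup R) (r : R) (z : 𝔻) (y : Y) (δ : Path x y), ‖(z : ℂ)‖ < 1 ∧
    (∀ t, (δ t : Complex2 R) = discSegment g r (z, hY.target g r z) t) ∧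
    GraphExt T y (k.trans (.mk δ))

theorem ext_iff_of_mem_range {x : Y} (hx : (x : Complex2 R) ∈ Set.range (toGraph R))
    (k : Path.Homotopic.Quotient x₀ x) : Ext T x k ↔ GraphExt T x k := by
  refine or_iff_left ?_
  rintro ⟨g, r, z, y, δ, hz, hδ, -⟩
  have := hδ 0
  rw [δ.source, discSegment_apply, discLine_zero] at this
  rw [this, mem_range_toGraph_iff] at hx
  exact hz.ne hx

theorem ext_iff_of_interior {g : PresGroup R} {r : R} {z : 𝔻} (hz : ‖(z : ℂ)‖ < 1) {x y : Y}
    {δ : Path x y} (hδ : ∀ t, (δ t : Complex2 R) = discSegment g r (z, hY.target g r z) t)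
    (k : Path.Homotopic.Quotient x₀ x) : Ext T x k ↔ GraphExt T y (k.trans (.mk δ)) := by
  have hx : (x : Complex2 R) = toComplex R (cell2 R g r z) := by
    rw [← δ.source, hδ, discSegment_apply, discLine_zero]
  constructor
  · rintro (h | ⟨g', r', z', y', δ', hz', hδ', h⟩)
    · have := h.mem_range
      rw [hx, mem_range_toGraph_iff] at this
      exact (hz.ne this).elim
    · have hx' : (x : Complex2 R) = toComplex R (cell2 R g' r' z') := by
        rw [← δ'.source, hδ', discSegment_apply, discLine_zero]
      have hc := eq_of_toComplex_eq_cell2 hz'.ne (hx.symm.trans hx')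
      simp only [cell2, Sum.inr.injEq, Sigma.mk.injEq, Prod.mk.injEq, heq_eq_eq] at hc
      obtain ⟨⟨rfl, rfl⟩, rfl⟩ := hc
      obtain rfl : y = y' := by
        rw [← δ.target, ← δ'.target]
        exact Subtype.ext (by rw [hδ, hδ'])
      obtain rfl : δ = δ' := Path.ext (funext fun t => Subtype.ext (by rw [hδ, hδ']))
      exact h
  · exact fun h => Or.inr ⟨g, r, z, y, δ, hz, hδ, h⟩

/-- All points of the open disc are joined by segments to the same boundary point. These segments
also define `Ext` there, so no stability is needed. -/
theorem moves_of_open_disc {g : PresGroup R} {r : R}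
    (hfull : IsFull Y g r) {x y : Y} (γ : Path x y)
    (hγ : ∀ t, (γ t : Complex2 R) ∈ toComplex R '' (cell2 R g r '' {z | ‖(z : ℂ)‖ < 1})) :
    Moves (Ext T) (Path.Homotopic.Quotient.mk γ) := by
  set W := toComplex R '' (cell2 R g r '' {z | ‖(z : ℂ)‖ < 1}) with hW
  have hc : ∀ c, toComplex R c ∈ W → ∃ z : 𝔻, ‖(z : ℂ)‖ < 1 ∧ c = cell2 R g r z := by
    rintro c ⟨_, ⟨z, hz, rfl⟩, h⟩
    exact ⟨z, hz, eq_of_toComplex_eq_cell2 (ne_of_lt hz) h.symm⟩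
  have hWpre : toComplex R ⁻¹' W = cell2 R g r '' {z | ‖(z : ℂ)‖ < 1} := by
    refine Set.Subset.antisymm ?_ (Set.subset_preimage_image _ _)
    intro c hcW
    obtain ⟨z, hz, rfl⟩ := hc c hcW
    exact ⟨z, hz, rfl⟩
  have hopen : IsOpen W := by
    rw [← isQuotientMap_toComplex.isOpen_preimage, hWpre]
    exact (isOpenEmbedding_cell2 g r).isOpenMap _
      (isOpen_lt (by fun_prop) continuous_const)
  have htgt : ∀ z, hY.target g r z = circlePoint 0 := fun z => if_pos hfull
  let v : Y := ⟨toComplex R (cell2 R g r (circlePoint 0)), hfull _⟩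
  let f := discHomotopy (R := R) fun _ _ _ => circlePoint 0
  have key : ∀ w : Y, (w : Complex2 R) ∈ W → ∃ a : Path w v,
      (∀ c, toComplex R c = w → ∀ s, (a s : Complex2 R) = f c s) ∧
      ∀ k : Path.Homotopic.Quotient x₀ w, Ext T w k ↔ GraphExt T v (k.trans (.mk a)) := by
    intro w hw
    obtain ⟨_, ⟨z, hz, rfl⟩, hzw⟩ := hw
    have hcont : Continuous fun s => (⟨discSegment g r (z, circlePoint 0) s, hfull _⟩ : Y) :=
      (discSegment g r (z, circlePoint 0)).continuous.subtype_mk _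
    refine ⟨⟨⟨_, hcont⟩, Subtype.ext (by simp [hzw]), Subtype.ext (by simp [v])⟩, ?_, ?_⟩
    · intro c hcw s
      obtain rfl := eq_of_toComplex_eq_cell2 (ne_of_lt hz) (hcw.trans hzw.symm)
      rfl
    · refine fun k => ext_iff_of_interior (g := g) (r := r) hz (fun t => ?_) k
      rw [htgt]; rfl
  obtain ⟨a, ha, haE⟩ := key x (by simpa using hγ 0)
  obtain ⟨b, hb, hbE⟩ := key y (by simpa using hγ 1)
  have hqf : ∀ c c', toComplex R c = toComplex R c' → toComplex R c ∈ W → f c = f c' := by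
    intro c c' h hcW
    obtain ⟨z, hz, rfl⟩ := hc c' (h ▸ hcW)
    rw [eq_of_toComplex_eq_cell2 hz.ne h]
  have hfY : ∀ c, toComplex R c ∈ W → ∀ s, f c s ∈ Y := by
    intro c hcW s
    obtain ⟨z, hz, rfl⟩ := hc c hcW
    exact hfull _
  obtain ⟨δ, hδ, he⟩ := exists_path_of_tracks (f := f)
    (isQuotientMap_toComplex.restrictPreimage_isLocallyClosed hopen.isLocallyClosed)
    (continuousOn_discHomotopy fun _ _ => continuousOn_const) hqf hfY
    (fun c _ => discHomotopy_zero _ c) γ hγ a b ha hb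
  have hδc : ∀ t, δ t = v := fun t => by
    obtain ⟨_, ⟨z, hz, rfl⟩, hzt⟩ := hγ t
    refine Subtype.ext ((hδ t _ hzt).trans ?_)
    simp only [f, discHomotopy_cell2, discSegment_apply, discLine_one]; rfl
  rw [Path.Homotopic.Quotient.mk_eq_refl hδc, Path.Homotopic.Quotient.trans_refl] at he
  intro k hk
  rw [hbE, Path.Homotopic.Quotient.trans_assoc, he]
  exact (haE k).1 hk

variable (Y) in
/-- The centers of the 2-cells that are contained in `Y`. -/
def centers : Set (Complex2 R) :=
  {x | ∃ g r, IsFull Y g r ∧ ∃ z : 𝔻, (z : ℂ) = 0 ∧ x = toComplex R (cell2 R g r z)}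

theorem mem_centers_iff {g : PresGroup R} {r : R} {z : 𝔻} :
    toComplex R (cell2 R g r z) ∈ centers Y ↔ IsFull Y g r ∧ (z : ℂ) = 0 := by
  constructor
  · rintro ⟨g', r', h, z', hz', he⟩
    have := eq_of_toComplex_eq_cell2 (by simp [hz']) he
    simp only [cell2, Sum.inr.injEq, Sigma.mk.injEq, Prod.mk.injEq, heq_eq_eq] at this
    obtain ⟨⟨rfl, rfl⟩, rfl⟩ := this
    exact ⟨h, hz'⟩
  · rintro ⟨h, hz⟩
    exact ⟨g, r, h, z, hz, rfl⟩

theorem toGraph_notMem_centers (c : Cells1 R) : toGraph R c ∉ centers Y := by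
  rintro ⟨g, r, -, z, hz, he⟩
  exact toComplex_cell2_ne_toGraph (by simp [hz]) c he.symm

theorem isClosed_centers : IsClosed (centers Y) := by
  rw [← isQuotientMap_toComplex.isClosed_preimage, isClosed_cells_iff]
  constructor
  · intro g s
    convert isClosed_empty
    exact Set.eq_empty_of_forall_notMem fun u hu => toGraph_notMem_centers (edge g s u) hu
  · intro g r
    simp only [Set.mem_preimage, mem_centers_iff]
    by_cases h : IsFull Y g r
    · simp only [h, true_and]
      exact isClosed_eq continuous_subtype_val continuous_const
    · simp [h]

/-- Without the centers of its full 2-cells, `Y` is pushed into its graph. The tracks of the end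
points are absorbed by the definition of `Ext`, and the pushed path is a path in the graph. -/
theorem Stable.moves_of_notMem_centers (hT : hY.Stable T) {x y : Y} (γ : Path x y)
    (hγ : ∀ t, (γ t : Complex2 R) ∉ centers Y) : Moves (Ext T) (Path.Homotopic.Quotient.mk γ) := by
  let f := discHomotopy hY.push
  have h0 : ∀ {g : PresGroup R} {r : R} {z : 𝔻}, toComplex R (cell2 R g r z) ∈ Y \ centers Y →
      IsFull Y g r → (z : ℂ) ≠ 0 := fun h hf hz => h.2 (mem_centers_iff.2 ⟨hf, hz⟩)
  -- The push fixes boundary points, so the homotopy is constant on them whichever cell they are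
  -- viewed in. This makes it compatible with the gluing.
  have hconst : ∀ c, toComplex R c ∈ Y \ centers Y → toComplex R c ∈ Set.range (toGraph R) →
      f c = ContinuousMap.const I (toComplex R c) := by
    intro c hc hr
    obtain ⟨c, rfl⟩ | ⟨g, r, z, rfl⟩ := cells_cases c
    · exact discHomotopy_incl _ c
    · have hz := mem_range_toGraph_iff.1 hr
      ext s
      simp only [f]
      rw [discHomotopy_cell2, discSegment_apply, (push_spec hc.1 (h0 hc)).2.2 hz, discLine_self]
      rfl
  have hfY : ∀ c, toComplex R c ∈ Y \ centers Y → ∀ s, f c s ∈ Y := by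
    intro c hc s
    by_cases hr : toComplex R c ∈ Set.range (toGraph R)
    · rw [hconst c hc hr]; exact hc.1
    · obtain ⟨c, rfl⟩ | ⟨g, r, z, rfl⟩ := cells_cases c
      · exact (hr ⟨c, rfl⟩).elim
      · rw [mem_range_toGraph_iff] at hr
        exact discLine_mem (hY := hY) (norm_lt_one_of_ne hr) hc.1 (push_spec hc.1 (h0 hc)).1 s
  have hf1 : ∀ c, toComplex R c ∈ Y \ centers Y → f c 1 ∈ Set.range (toGraph R) := by
    intro c hc
    by_cases hr : toComplex R c ∈ Set.range (toGraph R)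
    · rw [hconst c hc hr]; exact hr
    · obtain ⟨c, rfl⟩ | ⟨g, r, z, rfl⟩ := cells_cases c
      · exact (hr ⟨c, rfl⟩).elim
      · simp only [f]
        rw [discHomotopy_cell2, discSegment_apply, discLine_one, mem_range_toGraph_iff]
        exact (push_spec hc.1 (h0 hc)).2.1
  have hqf : ∀ c c', toComplex R c = toComplex R c' → toComplex R c ∈ Y \ centers Y →
      f c = f c' := by
    intro c c' h hc
    by_cases hr : toComplex R c ∈ Set.range (toGraph R)
    · rw [hconst c hc hr, hconst c' (h ▸ hc) (h ▸ hr), h]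
    · obtain ⟨c', rfl⟩ | ⟨g, r, z, rfl⟩ := cells_cases c'
      · exact (hr ⟨c', h.symm⟩).elim
      · rw [h, mem_range_toGraph_iff] at hr
        rw [eq_of_toComplex_eq_cell2 hr h]
  have key : ∀ w : Y, (w : Complex2 R) ∉ centers Y → ∃ (w' : Y) (a : Path w w'),
      (∀ c, toComplex R c = w → ∀ s, (a s : Complex2 R) = f c s) ∧
      ∀ k : Path.Homotopic.Quotient x₀ w, Ext T w k ↔ GraphExt T w' (k.trans (.mk a)) := by
    intro w hw
    obtain ⟨c, hc⟩ := isQuotientMap_toComplex.surjective (w : Complex2 R)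
    have hcW : toComplex R c ∈ Y \ centers Y := hc ▸ ⟨w.2, hw⟩
    have hcont : Continuous fun s => (⟨f c s, hfY c hcW s⟩ : Y) :=
      (f c).continuous.subtype_mk _
    let a : Path w ⟨f c 1, hfY c hcW 1⟩ :=
      ⟨⟨_, hcont⟩, Subtype.ext ((discHomotopy_zero _ c).trans hc), rfl⟩
    refine ⟨_, a, fun c' hc' s => congrArg (· s) (hqf c c' (hc.trans hc'.symm) hcW), ?_⟩
    by_cases hr : toComplex R c ∈ Set.range (toGraph R)
    · intro k
      have ha : ∀ t, (a t : Complex2 R) = w := fun t => by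
        change f c t = w
        rw [hconst c hcW hr]; exact hc
      rw [ext_iff_of_mem_range (hc ▸ hr)]
      exact hT.graphExt_iff a (fun t => by rw [ha, ← hc]; exact hr) k
    · intro k
      obtain ⟨c, rfl⟩ | ⟨g, r, z, rfl⟩ := cells_cases c
      · exact (hr ⟨c, rfl⟩).elim
      · rw [mem_range_toGraph_iff] at hr
        have hz := norm_lt_one_of_ne hr
        have hcont' : Continuous fun s => (⟨discSegment g r (z, hY.target g r z) s,
            discLine_mem (hY := hY) hz hcW.1 (target_spec hcW.1).1 s⟩ : Y) :=
          (discSegment g r _).continuous.subtype_mk _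
        let δ : Path w ⟨discSegment g r (z, hY.target g r z) 1, discLine_mem (hY := hY) hz hcW.1
          (target_spec hcW.1).1 1⟩ := ⟨⟨_, hcont'⟩, Subtype.ext (by simp [hc]), rfl⟩
        rw [ext_iff_of_interior hz (δ := δ) (fun t => rfl)]
        exact hT.graphExt_target_iff hc.symm (h0 hcW) (fun t => rfl) (fun t => rfl) k
  obtain ⟨x', a, ha, haE⟩ := key x (by simpa using hγ 0)
  obtain ⟨y', b, hb, hbE⟩ := key y (by simpa using hγ 1)
  obtain ⟨δ, hδ, he⟩ := exists_path_of_tracks (f := f) (W := Y \ centers Y)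
    (isQuotientMap_toComplex.restrictPreimage_isLocallyClosed
      (hY.isLocallyClosed.inter isClosed_centers.isOpen_compl.isLocallyClosed))
    (continuousOn_discHomotopy fun g r => (continuousOn_push g r).mono fun z hz => ⟨hz.1, h0 hz⟩)
    hqf hfY (fun c _ => discHomotopy_zero _ c) γ (fun t => ⟨(γ t).2, hγ t⟩) a b ha hb
  intro k hk
  rw [hbE, Path.Homotopic.Quotient.trans_assoc, he, ← Path.Homotopic.Quotient.trans_assoc,
    ← hT.graphExt_iff δ]
  · exact (haE k).1 hk
  · intro t
    obtain ⟨c, hc⟩ := isQuotientMap_toComplex.surjective (γ t : Complex2 R)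
    rw [hδ t c hc]
    exact hf1 c (hc ▸ ⟨(γ t).2, hγ t⟩)

/-- All paths preserve the extension of a stable set. -/
theorem Stable.moves (hT : hY.Stable T) {x y : Y} (γ : Path x y) :
    Moves (Ext T) (Path.Homotopic.Quotient.mk γ) := by
  let ι := Option {e : PresGroup R × R // IsFull Y e.1 e.2}
  let O : ι → Set (Complex2 R) := fun i => i.elim (centers Y)ᶜ fun e =>
    toComplex R '' (cell2 R e.1.1 e.1.2 '' {z | ‖(z : ℂ)‖ < 1})
  have hO : ∀ i, IsOpen (O i) := by
    rintro (_ | e)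
    · exact isClosed_centers.isOpen_compl
    · change IsOpen (toComplex R '' (cell2 R e.1.1 e.1.2 '' {z | ‖(z : ℂ)‖ < 1}))
      rw [← isQuotientMap_toComplex.isOpen_preimage]
      convert (isOpenEmbedding_cell2 e.1.1 e.1.2).isOpenMap {z | ‖(z : ℂ)‖ < 1}
        (isOpen_lt (by fun_prop) continuous_const) using 1
      refine Set.Subset.antisymm ?_ (Set.subset_preimage_image _ _)
      rintro c ⟨_, ⟨z, hz, rfl⟩, h⟩
      exact ⟨z, hz, (eq_of_toComplex_eq_cell2 (ne_of_lt hz) h.symm).symm⟩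
  refine Moves.of_cover (U := fun i => {y | (y : Complex2 R) ∈ O i}) (fun i => ?_) (fun t => ?_) ?_
  · exact (hO i).preimage (continuous_subtype_val.comp γ.continuous)
  · by_cases h : (γ t : Complex2 R) ∈ centers Y
    · obtain ⟨g, r, hf, z, hz, he⟩ := h
      exact ⟨some ⟨(g, r), hf⟩, _, ⟨z, by simp [hz], rfl⟩, he.symm⟩
    · exact ⟨none, h⟩
  · rintro (_ | e) a b δ hδ -
    · exact hT.moves_of_notMem_centers δ hδ
    · exact moves_of_open_disc e.2 δ hδ

/-- Every point of `Y` can be joined to a vertex. -/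
theorem exists_path_to_vertex (hY : Fits V Y) (x : Y) :
    ∃ g : V, Nonempty (Path x (hY.vertex g)) := by
  have h1 : ∀ x : Y, (x : Complex2 R) ∈ Set.range (toGraph R) →
      ∃ g : V, Nonempty (Path x (hY.vertex g)) := by
    rintro x ⟨c, hc⟩
    have hcY : toGraph R c ∈ Y := hc ▸ x.2
    have hcont : Continuous fun s =>
        (⟨graphHomotopy (endParam V) c s, graphHomotopy_endParam_mem (hY := hY) c hcY s⟩ : Y) :=
      (graphHomotopy (endParam V) c).continuous.subtype_mk _
    exact ⟨⟨endVertex V c, endVertex_mem (hY := hY) c hcY⟩, ⟨⟨⟨_, hcont⟩,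
      Subtype.ext ((graphHomotopy_zero _ c).trans hc), Subtype.ext (graphHomotopy_endParam_one c)⟩⟩⟩
  obtain hx | ⟨g, r, z, hz, hx⟩ := mem_range_or_interior (x : Complex2 R)
  · exact h1 x hx
  have hzY : toComplex R (cell2 R g r z) ∈ Y := hx ▸ x.2
  have hcont : Continuous fun s => (⟨discSegment g r (z, hY.target g r z) s,
      discLine_mem (hY := hY) hz hzY (target_spec hzY).1 s⟩ : Y) :=
    (discSegment g r _).continuous.subtype_mk _
  let y : Y := ⟨toComplex R (cell2 R g r (hY.target g r z)), (target_spec hzY).1⟩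
  let δ : Path x y := ⟨⟨_, hcont⟩, Subtype.ext (by simp [hx]), Subtype.ext (by simp [y])⟩
  obtain ⟨g', ⟨η⟩⟩ := h1 y (mem_range_toGraph_iff.2 (target_spec hzY).2)
  exact ⟨g', ⟨δ.trans η⟩⟩

/-- If at each vertex some stable set contains no class of a loop but the trivial one, all loops
are null-homotopic. -/
theorem loopsNullHomotopicIn (hY : Fits V Y)
    (h : ∀ g : V, ∃ T : ∀ g' : V, Path.Homotopic.Quotient (hY.vertex g) (hY.vertex g') → Prop,
      hY.Stable T ∧ T g (.refl _) ∧ ∀ k, T g k → k = .refl _) : LoopsNullHomotopicIn Y := by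
  intro x α
  obtain ⟨g, ⟨p⟩⟩ := exists_path_to_vertex hY x
  obtain ⟨T, hT, hrefl, htriv⟩ := h g
  -- The loop is conjugated to a loop at a vertex, and its class is reached from the trivial class,
  -- which lies in `T`.
  have h1 := hT.moves ((p.symm.trans α).trans p) (.refl _)
    (Or.inl ((graphExt_vertex_iff hT).2 hrefl))
  rw [ext_iff_of_mem_range ⟨vert g, rfl⟩, graphExt_vertex_iff hT] at h1
  have h2 := htriv _ h1
  rw [Path.Homotopic.Quotient.refl_trans] at h2
  simp only [Path.Homotopic.Quotient.mk_trans, Path.Homotopic.Quotient.mk_symm] at h2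
  rw [← Path.Homotopic.Quotient.eq, Path.Homotopic.Quotient.mk_refl]
  generalize Path.Homotopic.Quotient.mk α = q at *
  generalize Path.Homotopic.Quotient.mk p = p at *
  calc q = (p.trans ((p.symm.trans q).trans p)).trans p.symm := by
        rw [Path.Homotopic.Quotient.trans_assoc _ _ p.symm, Path.Homotopic.Quotient.trans_assoc,
          Path.Homotopic.Quotient.trans_symm, Path.Homotopic.Quotient.trans_refl,
          ← Path.Homotopic.Quotient.trans_assoc, Path.Homotopic.Quotient.trans_symm,
          Path.Homotopic.Quotient.refl_trans]
    _ = .refl x := by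
        rw [h2, Path.Homotopic.Quotient.trans_refl, Path.Homotopic.Quotient.trans_symm]

end Fits

end Cayley

/-! ### Edge steps on path classes, and relators that bound 2-cells -/

namespace Cayley

variable {S : Type*} {R : Set (GenWord S)}

theorem toComplex_corner (g : PresGroup R) (r : R) {i : ℕ} (hi : i ≤ r.1.length) :
    toComplex R (cell2 R g r (circlePoint (i / r.1.length))) =
      toGraph R (vert (g * PresGroup.val R (r.1.take i))) := by
  have key : ∀ i (hi : i < r.1.length), toComplex R (cell2 R g r (circlePoint (i / r.1.length))) =
      toGraph R (vert (g * PresGroup.val R (r.1.take i))) := by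
    intro i hi
    have := toComplex_boundary g r ⟨i, hi⟩ 0
    rw [← toGraph_normalize, normalize_letterEdge_zero] at this
    simpa using this
  obtain hi | rfl := hi.lt_or_eq
  · exact key i hi
  obtain h0 | h0 := Nat.eq_zero_or_pos r.1.length
  · have hr : r.1 = [] := List.length_eq_zero_iff.1 h0
    have : toComplex R (cell2 R g r (circlePoint (r.1.length / r.1.length))) = toGraph R (vert g) :=
      Quot.sound (Glue.constant g r hr _ (norm_circlePoint _))
    rw [this, List.take_length, val_eq_one r.2, mul_one]
  · have h1 : circlePoint (r.1.length / r.1.length) = circlePoint ((0 : ℕ) / r.1.length) :=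
      circlePoint_eq_iff.2 ⟨1, by
        have : (r.1.length : ℝ) ≠ 0 := by positivity
        field_simp; simp⟩
    rw [h1, key 0 h0, List.take_length, val_eq_one r.2]
    simp

namespace Fits

variable {V : Set (PresGroup R)} {Y : Set (Complex2 R)} (hY : Fits V Y) (g₀ : V)

/-- The homotopy classes of paths in `Y` from the base vertex to vertices. -/
abbrev VertexClasses : Type _ :=
  Σ g : V, Path.Homotopic.Quotient (hY.vertex g₀) (hY.vertex g)

variable {hY g₀}

/-- The class `τ'` is obtained from `τ` by appending an edge labelled `s`. -/
def Step (s : S) (τ τ' : hY.VertexClasses g₀) : Prop :=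
  ∃ δ : Path (hY.vertex τ.1) (hY.vertex τ'.1),
    (∀ t, (δ t : Complex2 R) = toGraph R (edge τ.1.1 s t)) ∧ τ'.2 = τ.2.trans (.mk δ)

theorem sigma_eq_of_const {τ τ' : hY.VertexClasses g₀}
    (δ : Path (hY.vertex τ.1) (hY.vertex τ'.1)) (hδ : ∀ t, δ t = hY.vertex τ.1)
    (h : τ'.2 = τ.2.trans (.mk δ)) : τ' = τ := by
  obtain ⟨g, k⟩ := τ
  obtain ⟨g', k'⟩ := τ'
  obtain rfl : g' = g := hY.vertex_injective (by rw [← δ.target, hδ])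
  rw [Path.Homotopic.Quotient.mk_eq_refl hδ, Path.Homotopic.Quotient.trans_refl] at h
  rw [show k' = k from h]

theorem Step.fst_eq {s : S} {τ τ' : hY.VertexClasses g₀} (h : Step s τ τ') :
    (τ'.1 : PresGroup R) = τ.1 * PresGroup.gen R s := by
  obtain ⟨δ, hδ, -⟩ := h
  refine toGraph_vert_injective ?_
  change toGraph R (vert τ'.1.1) = toGraph R (vert (τ.1.1 * PresGroup.gen R s))
  rw [← toGraph_edge_one, ← hδ 1, δ.target]; rfl

theorem Step.right_unique {s : S} {τ ρ ρ' : hY.VertexClasses g₀} (h : Step s τ ρ)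
    (h' : Step s τ ρ') : ρ = ρ' := by
  have h1 := h.fst_eq.trans h'.fst_eq.symm
  obtain ⟨g, k⟩ := ρ
  obtain ⟨g', k'⟩ := ρ'
  obtain rfl : g = g' := Subtype.ext h1
  obtain ⟨δ, hδ, e⟩ := h
  obtain ⟨δ', hδ', e'⟩ := h'
  obtain rfl : δ = δ' := Path.ext (funext fun t => Subtype.ext (by rw [hδ, hδ']))
  rw [show k = k' from e.trans e'.symm]

/-- The start of the edge is determined by its end and its label, and appending the edge can be
undone. With `right_unique` this makes each label a partial injection. -/
theorem Step.left_unique {s : S} {τ τ' ρ : hY.VertexClasses g₀} (h : Step s τ ρ)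
    (h' : Step s τ' ρ) : τ = τ' := by
  have h1 : τ.1.1 = τ'.1.1 := mul_right_cancel (h.fst_eq.symm.trans h'.fst_eq)
  obtain ⟨g, k⟩ := τ
  obtain ⟨g', k'⟩ := τ'
  obtain rfl : g = g' := Subtype.ext h1
  obtain ⟨δ, hδ, e⟩ := h
  obtain ⟨δ', hδ', e'⟩ := h'
  obtain rfl : δ = δ' := Path.ext (funext fun t => Subtype.ext (by rw [hδ, hδ']))
  have h2 := congrArg (fun q => q.trans (Path.Homotopic.Quotient.mk δ).symm) (e.symm.trans e')
  simp only [Path.Homotopic.Quotient.trans_assoc, Path.Homotopic.Quotient.trans_symm,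
    Path.Homotopic.Quotient.trans_refl] at h2
  rw [h2]

theorem exists_edgePath (g g' : V) {s : S} (h : g'.1 = g.1 * PresGroup.gen R s) :
    ∃ δ : Path (hY.vertex g) (hY.vertex g'),
      ∀ t, (δ t : Complex2 R) = toGraph R (edge g.1 s t) := by
  have hc : Continuous fun t => (⟨toGraph R (edge g.1 s t),
      hY.edge_mem g.2 (h ▸ g'.2) t⟩ : Y) :=
    (continuous_toGraph.comp (continuous_edge _ _)).subtype_mk _
  exact ⟨⟨⟨_, hc⟩, Subtype.ext (toGraph_edge_zero _ _),
    Subtype.ext ((toGraph_edge_one _ _).trans (by rw [← h]; rfl))⟩, fun t => rfl⟩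

theorem exists_step (τ : hY.VertexClasses g₀) {s : S} (h : τ.1.1 * PresGroup.gen R s ∈ V) :
    ∃ τ', Step s τ τ' := by
  obtain ⟨δ, hδ⟩ := exists_edgePath (hY := hY) τ.1 ⟨_, h⟩ rfl
  exact ⟨⟨⟨_, h⟩, τ.2.trans (.mk δ)⟩, δ, hδ, rfl⟩

theorem exists_step_inv (τ : hY.VertexClasses g₀) {s : S}
    (h : τ.1.1 * (PresGroup.gen R s)⁻¹ ∈ V) : ∃ τ', Step s τ' τ := by
  obtain ⟨δ, hδ⟩ := exists_edgePath (hY := hY) ⟨_, h⟩ τ.1 (s := s) (by simp)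
  refine ⟨⟨⟨_, h⟩, τ.2.trans (Path.Homotopic.Quotient.mk δ).symm⟩, δ, hδ, ?_⟩
  rw [Path.Homotopic.Quotient.trans_assoc, Path.Homotopic.Quotient.symm_trans,
    Path.Homotopic.Quotient.trans_refl]

/-- The class `τ'` is obtained from `τ` by appending an edge that is read as the given letter. -/
def LetterStep : S × Bool → hY.VertexClasses g₀ → hY.VertexClasses g₀ → Prop
  | (s, true), τ, τ' => Step s τ τ'
  | (s, false), τ, τ' => Step s τ' τ

/-- The class `τ'` is obtained from `τ` by appending an edge path that spells the given word. -/
def Run : GenWord S → hY.VertexClasses g₀ → hY.VertexClasses g₀ → Prop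
  | [], τ, τ' => τ' = τ
  | p :: l, τ, τ' => ∃ ρ, LetterStep p τ ρ ∧ Run l ρ τ'

theorem LetterStep.fst_eq {p : S × Bool} {τ τ' : hY.VertexClasses g₀} (h : LetterStep p τ τ') :
    (τ'.1 : PresGroup R) = τ.1 * letterVal R p := by
  obtain ⟨s, _ | _⟩ := p
  · rw [letterVal_false, Step.fst_eq h, mul_inv_cancel_right]
  · exact Step.fst_eq h

theorem Run.fst_eq {l : GenWord S} {τ τ' : hY.VertexClasses g₀} (h : Run l τ τ') :
    (τ'.1 : PresGroup R) = τ.1 * PresGroup.val R l := by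
  induction l generalizing τ with
  | nil => rw [show τ' = τ from h]; simp
  | cons p l ih =>
    obtain ⟨ρ, h1, h2⟩ := h
    rw [ih h2, h1.fst_eq, val_cons, mul_assoc]

theorem Run.snoc {l : GenWord S} {p : S × Bool} {τ ρ τ' : hY.VertexClasses g₀} (h : Run l τ ρ)
    (h' : LetterStep p ρ τ') : Run (l ++ [p]) τ τ' := by
  induction l generalizing τ with
  | nil => rw [show ρ = τ from h] at h'; exact ⟨τ', h', rfl⟩
  | cons q l ih =>
    obtain ⟨ν, h1, h2⟩ := h
    exact ⟨ν, h1, ih h2⟩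

/-- A relator that bounds a 2-cell in `Y` acts trivially. -/
theorem run_relator (τ : hY.VertexClasses g₀) (r : R)
    (hr : ∀ i ≤ r.1.length, τ.1.1 * PresGroup.val R (r.1.take i) ∈ V) : Run r.1 τ τ := by
  set n := r.1.length with hn
  have hfull := hY.disc_mem hr
  have hc : Continuous fun z => (⟨toComplex R (cell2 R τ.1.1 r z), hfull z⟩ : Y) :=
    (continuous_disc _ r).subtype_mk _
  let F : 𝔻 → Y := fun z => ⟨toComplex R (cell2 R τ.1.1 r z), hfull z⟩
  -- `D i ρ` says that `ρ` arises from `τ` by following the chord of the 2-cell from its first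
  -- corner to corner `i`. Consecutive chords and the boundary arc between them form a triangle in
  -- the disc, so each arc takes one chord class to the next.
  let D (i : ℕ) (ρ : hY.VertexClasses g₀) : Prop :=
    ∃ δ : Path (hY.vertex τ.1) (hY.vertex ρ.1),
      (∀ t, δ t = F (discLine (circlePoint 0) (circlePoint (i / n)) t)) ∧ ρ.2 = τ.2.trans (.mk δ)
  have hD : ∀ i ≤ n, ∃ ρ, D i ρ ∧ ρ.1.1 = τ.1.1 * PresGroup.val R (r.1.take i) := by
    intro i hi
    have hcl : Continuous fun t => F (discLine (circlePoint 0) (circlePoint (i / n)) t) :=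
      hc.comp (discPath _ _).continuous
    let δ : Path (hY.vertex τ.1) (hY.vertex ⟨_, hr i hi⟩) := ⟨⟨_, hcl⟩, Subtype.ext (by
      have := toComplex_corner τ.1.1 r (Nat.zero_le _)
      simpa [F, Fits.vertex] using this), Subtype.ext (by
      have := toComplex_corner τ.1.1 r hi
      simpa [F, ← hn, Fits.vertex] using this)⟩
    exact ⟨⟨⟨_, hr i hi⟩, τ.2.trans (.mk δ)⟩, ⟨δ, fun t => rfl, rfl⟩, rfl⟩
  have hconst : ∀ i ρ, circlePoint ((i : ℕ) / n) = circlePoint 0 → D i ρ → ρ = τ := by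
    rintro i ρ h ⟨δ, hδ, e⟩
    refine sigma_eq_of_const δ (fun t => ?_) e
    have h0 := δ.source
    rw [hδ, h, discLine_self] at h0
    rw [hδ, h, discLine_self, h0]
  have hrun : ∀ i ≤ n, ∀ ρ, D i ρ → ρ.1.1 = τ.1.1 * PresGroup.val R (r.1.take i) →
      Run (r.1.take i) τ ρ := by
    intro i
    induction i with
    | zero =>
      intro hi ρ hρ _
      exact hconst 0 ρ (by simp) hρ
    | succ i ih =>
      rintro hi ρ ⟨δ, hδ, e⟩ hρ
      obtain ⟨ν, ⟨η, hη, e'⟩, hν⟩ := hD i (Nat.le_of_succ_le hi)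
      rw [List.take_succ_eq_append_getElem hi]
      refine (ih (Nat.le_of_succ_le hi) ν ⟨η, hη, e'⟩ hν).snoc ?_
      let arc : Path (circlePoint (i / n)) (circlePoint ((i + 1 : ℕ) / n)) :=
        ⟨⟨fun t : I => circlePoint ((i + t) / n), continuous_circlePoint.comp (by fun_prop)⟩,
          by simp, by simp⟩
      have harc : ∀ t, (F (arc t) : Complex2 R) =
          toGraph R (letterEdge ν.1.1 (r.1[i]) t) := by
        intro t
        have := toComplex_boundary τ.1.1 r ⟨i, hi⟩ t
        rw [hν]
        exact this
      rw [List.take_succ_eq_append_getElem hi, val_append, ← mul_assoc, ← hν] at hρ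
      generalize r.1[i] = p at harc hρ
      obtain ⟨s, _ | _⟩ := p
      · have hρ' : ρ.1.1 = ν.1.1 * (PresGroup.gen R s)⁻¹ := by
          rw [← letterVal_false]; exact hρ
        obtain ⟨θ, hθ⟩ := exists_edgePath (hY := hY) ρ.1 ν.1 (s := s) (by rw [hρ']; simp)
        refine ⟨θ, hθ, ?_⟩
        rw [e', e, Path.Homotopic.Quotient.trans_assoc,
          Path.Homotopic.Quotient.trans_eq_of_lift hc (r := η) (discPath _ _) arc.symm
            (discPath _ _) hδ (fun t => Subtype.ext ?_) hη]
        rw [hθ, hρ']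
        have := harc (σ t)
        rw [letterEdge, unitInterval.symm_symm] at this
        exact this.symm
      · obtain ⟨θ, hθ⟩ := exists_edgePath (hY := hY) ν.1 ρ.1 (s := s) hρ
        refine ⟨θ, hθ, ?_⟩
        rw [e', e, Path.Homotopic.Quotient.trans_assoc,
          Path.Homotopic.Quotient.trans_eq_of_lift hc (r := δ) (discPath _ _) arc
            (discPath _ _) hη (fun t => Subtype.ext ?_) hδ]
        rw [hθ]
        exact (harc t).symm
  obtain ⟨ρ, hρ, hρ'⟩ := hD n le_rfl
  -- The last corner is the first one, so the last chord is constant. For the empty relator this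
  -- uses `0 / 0 = 0`.
  have hs : ρ = τ := by
    obtain h0 | h0 := Nat.eq_zero_or_pos n
    · exact hconst n ρ (by simp [h0]) hρ
    · refine hconst n ρ (circlePoint_eq_iff.2 ⟨1, ?_⟩) hρ
      have : (n : ℝ) ≠ 0 := by positivity
      field_simp; simp
  have := hrun n le_rfl ρ hρ hρ'
  rwa [hn, List.take_length, hs] at this

end Fits

end Cayley

/-! ### The base group inside the ascending HNN extension -/

namespace AscHNN

open Cayley

section Group

variable {S : Type*} (R : Set (GenWord S)) (w : S → GenWord S)

theorem val_invRev {S : Type*} {R : Set (GenWord S)} (l : GenWord S) :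
    PresGroup.val R (FreeGroup.invRev l) = (PresGroup.val R l)⁻¹ := by
  rw [PresGroup.val, ← FreeGroup.inv_mk, map_inv]; rfl

theorem lift_mk_eq_lift_baseWord {S G : Type*} [Group G] (f : Option S → G) (l : GenWord S) :
    FreeGroup.lift f (FreeGroup.mk (baseWord l)) =
      FreeGroup.lift (fun a => f (some a)) (FreeGroup.mk l) := by
  simp only [FreeGroup.lift_mk, baseWord, List.map_map]
  rfl

theorem lift_gen {S : Type*} {R : Set (GenWord S)} (l : GenWord S) :
    FreeGroup.lift (fun s => PresGroup.gen R s) (FreeGroup.mk l) = PresGroup.val R l := by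
  have : FreeGroup.lift (fun s => PresGroup.gen R s) = PresentedGroup.mk (FreeGroup.mk '' R) :=
    FreeGroup.ext_hom _ _ fun s => by simp [PresGroup.gen, PresentedGroup.of]
  rw [this]; rfl

theorem lift_gen_some (l : GenWord S) :
    FreeGroup.lift (fun a => PresGroup.gen (relators R w) (some a)) (FreeGroup.mk l) =
      PresGroup.val (relators R w) (baseWord l) := by
  rw [← lift_gen, lift_mk_eq_lift_baseWord]

/-- The homomorphism from the base presentation to the HNN presentation. -/
def ofBase : PresGroup R →* PresGroup (relators R w) :=
  PresentedGroup.toGroup (f := fun a => PresGroup.gen (relators R w) (some a)) (by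
    rintro _ ⟨r, hr, rfl⟩
    rw [lift_gen_some]
    exact val_eq_one (Or.inl ⟨r, hr, rfl⟩))

@[simp] theorem ofBase_gen (a : S) :
    ofBase R w (PresGroup.gen R a) = PresGroup.gen (relators R w) (some a) :=
  PresentedGroup.toGroup.of _

theorem ofBase_val (l : GenWord S) :
    ofBase R w (PresGroup.val R l) = PresGroup.val (relators R w) (baseWord l) :=
  lift_gen_some R w l

theorem ofBase_mem_base (a : PresGroup R) : ofBase R w a ∈ base R w := by
  induction a using PresentedGroup.induction_on with
  | _ x =>
    induction x using FreeGroup.induction_on with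
    | C1 => rw [map_one, map_one]; exact one_mem _
    | of a =>
      exact (ofBase_gen R w a).symm ▸ Subgroup.subset_closure ⟨a, rfl⟩
    | inv_of a h => rw [map_inv, map_inv]; exact inv_mem h
    | mul x y hx hy => rw [map_mul, map_mul]; exact mul_mem hx hy

theorem stable_conj (a : S) : (stable R w)⁻¹ * PresGroup.gen (relators R w) (some a) * stable R w =
    ofBase R w (PresGroup.val R (w a)) := by
  have h : PresGroup.val (relators R w) (conjWord a (w a)) = 1 := val_eq_one (Or.inr ⟨a, rfl⟩)
  rw [conjWord, val_cons, val_cons, val_cons, letterVal_false, letterVal_true, letterVal_true,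
    ← ofBase_val, val_invRev, map_inv, ← mul_assoc, ← mul_assoc, mul_inv_eq_one] at h
  exact h

/-- The exponent sum of the stable letter. -/
def exponent : PresGroup (relators R w) →* Multiplicative ℤ :=
  PresentedGroup.toGroup (f := fun s => s.elim (Multiplicative.ofAdd 1) fun _ => 1) (by
    have h1 : ∀ l : GenWord S, FreeGroup.lift
        (fun s : Option S => s.elim (Multiplicative.ofAdd (1 : ℤ)) fun _ => 1)
        (FreeGroup.mk (baseWord l)) = 1 := fun l => by
      rw [lift_mk_eq_lift_baseWord]
      have : FreeGroup.lift (fun _ : S => (1 : Multiplicative ℤ)) = 1 :=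
        FreeGroup.ext_hom _ _ fun s => by simp
      exact DFunLike.congr_fun this _
    rintro _ ⟨r, ⟨r, hr, rfl⟩ | ⟨a, rfl⟩, rfl⟩
    · exact h1 r
    · have h2 := h1 (FreeGroup.invRev (w a))
      rw [FreeGroup.lift_mk] at h2 ⊢
      simp only [conjWord, List.map_cons, List.prod_cons, h2]
      simp)

theorem exponent_stable : exponent R w (stable R w) = Multiplicative.ofAdd 1 :=
  PresentedGroup.toGroup.of _

theorem exponent_ofBase (a : PresGroup R) : exponent R w (ofBase R w a) = 1 := by
  have : (exponent R w).comp (ofBase R w) = 1 := PresentedGroup.ext fun s => by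
    change exponent R w (ofBase R w (PresGroup.gen R s)) = 1
    rw [ofBase_gen]
    exact PresentedGroup.toGroup.of _
  exact DFunLike.congr_fun this a

-- The presented group maps to the abstract `HNNExtension` with associated subgroups `⊤` and
-- `φ.range`, in which the base is known to embed.
variable {R w} in
theorem ofBase_injective {A : Type*} [Group A] (e : PresGroup R ≃* A) (φ : A →* A)
    (hφ : Function.Injective φ)
    (hw : ∀ a, e (PresGroup.val R (w a)) = φ (e (PresGroup.gen R a))) :
    Function.Injective (ofBase R w) := by
  let ψ : (⊤ : Subgroup A) ≃* φ.range := Subgroup.topEquiv.trans (MonoidHom.ofInjective hφ)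
  let f : Option S → HNNExtension A ⊤ φ.range ψ := fun s =>
    -- In `HNNExtension` conjugation is `t a t⁻¹ = φ(a)`, so the stable letter of the presentation
    -- goes to the inverse of `t`.
    s.elim HNNExtension.t⁻¹ fun a => HNNExtension.of (e (PresGroup.gen R a))
  have hbase : ∀ l : GenWord S, FreeGroup.lift f (FreeGroup.mk (baseWord l)) =
      HNNExtension.of (e (PresGroup.val R l)) := fun l => by
    rw [lift_mk_eq_lift_baseWord]
    have : FreeGroup.lift (fun a => f (some a)) =
        ((HNNExtension.of (A := ⊤) (B := φ.range) (φ := ψ)).comp e.toMonoidHom).comp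
          (PresentedGroup.mk (FreeGroup.mk '' R)) :=
      FreeGroup.ext_hom _ _ fun s => by
        rw [FreeGroup.lift_apply_of]; rfl
    rw [this]; rfl
  have hrel : ∀ r ∈ FreeGroup.mk '' relators R w, FreeGroup.lift f r = 1 := by
    rintro _ ⟨r, ⟨r, hr, rfl⟩ | ⟨a, rfl⟩, rfl⟩
    · rw [hbase, val_eq_one hr, map_one, map_one]
    · have h2 := hbase (FreeGroup.invRev (w a))
      rw [FreeGroup.lift_mk] at h2 ⊢
      simp only [conjWord, List.map_cons, List.prod_cons, h2]
      rw [val_invRev, map_inv, map_inv, hw]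
      have h3 := HNNExtension.t_mul_of (φ := ψ) ⟨e (PresGroup.gen R a), trivial⟩
      have h4 : ((ψ ⟨e (PresGroup.gen R a), trivial⟩ : φ.range) : A) = φ (e (PresGroup.gen R a)) :=
        rfl
      rw [h4] at h3
      simp only [cond_true, cond_false, f, Option.elim, inv_inv]
      change HNNExtension.t * (HNNExtension.of (e (PresGroup.gen R a)) * _) = 1
      rw [← mul_assoc, h3]
      group
  let κ := PresentedGroup.toGroup hrel
  have hκ : ∀ a, κ (ofBase R w a) = HNNExtension.of (e a) := fun a => by
    have : κ.comp (ofBase R w) = HNNExtension.of.comp e.toMonoidHom :=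
      PresentedGroup.ext fun s => by
        change κ (ofBase R w (PresGroup.gen R s)) = _
        rw [ofBase_gen]
        exact PresentedGroup.toGroup.of hrel
    exact DFunLike.congr_fun this a
  intro a b h
  have := (hκ a).symm.trans ((congrArg κ h).trans (hκ b))
  exact e.injective (HNNExtension.of_injective _ this)

end Group

/-! ### The action of the base on path classes, and normal forms `t^m a t^{-n}` -/

section Action

variable {S : Type*} {R : Set (GenWord S)} {w : S → GenWord S}
  {V : Set (PresGroup (relators R w))} {Y : Set (Complex2 (relators R w))} {hY : Fits V Y} {g₀ : V}
  (hV : ∀ g ∈ V, ∀ a ∈ base R w, g * a ∈ V)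

open Fits

include hV

theorem mul_ofBase_mem_iff {g : PresGroup (relators R w)} (a : PresGroup R) :
    g * ofBase R w a ∈ V ↔ g ∈ V := by
  refine ⟨fun h => ?_, fun h => hV g h _ (ofBase_mem_base R w a)⟩
  have := hV _ h _ (ofBase_mem_base R w a⁻¹)
  rwa [map_inv, mul_inv_cancel_right] at this

theorem mul_gen_some_mem {g : PresGroup (relators R w)} (hg : g ∈ V) (a : S) :
    g * PresGroup.gen (relators R w) (some a) ∈ V := by
  rw [← ofBase_gen]
  exact (mul_ofBase_mem_iff hV _).2 hg

theorem mul_gen_some_inv_mem {g : PresGroup (relators R w)} (hg : g ∈ V) (a : S) :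
    g * (PresGroup.gen (relators R w) (some a))⁻¹ ∈ V := by
  rw [← ofBase_gen, ← map_inv]
  exact (mul_ofBase_mem_iff hV _).2 hg

/-- Appending an edge labelled by a generator of the base, as a permutation. -/
noncomputable def stepPerm (a : S) : Equiv.Perm (hY.VertexClasses g₀) where
  toFun τ := (exists_step τ (mul_gen_some_mem hV τ.1.2 a)).choose
  invFun τ := (exists_step_inv τ (mul_gen_some_inv_mem hV τ.1.2 a)).choose
  left_inv τ := (exists_step_inv _ (mul_gen_some_inv_mem hV (Subtype.prop _) a)).choose_spec
    |>.left_unique (exists_step τ (mul_gen_some_mem hV τ.1.2 a)).choose_spec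
  right_inv τ := (exists_step _ (mul_gen_some_mem hV (Subtype.prop _) a)).choose_spec
    |>.right_unique (exists_step_inv τ (mul_gen_some_inv_mem hV τ.1.2 a)).choose_spec

theorem step_iff (a : S) (τ τ' : hY.VertexClasses g₀) :
    Step (some a) τ τ' ↔ τ' = stepPerm hV a τ := by
  have h := (exists_step τ (mul_gen_some_mem hV τ.1.2 a)).choose_spec
  exact ⟨fun h' => h'.right_unique h, fun h' => h' ▸ h⟩

/-- Words are read from left to right while permutations compose from right to left, hence the
opposite group. -/
theorem run_baseWord_iff (l : GenWord S) (τ τ' : hY.VertexClasses g₀) :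
    Run (baseWord l) τ τ' ↔
      τ' = (FreeGroup.lift (fun a => MulOpposite.op (stepPerm hV a)) (FreeGroup.mk l)).unop τ := by
  induction l generalizing τ with
  | nil =>
    rw [← FreeGroup.one_eq_mk, map_one]
    rfl
  | cons p l ih =>
    have h : FreeGroup.mk (p :: l) = FreeGroup.mk [p] * FreeGroup.mk l := by
      rw [FreeGroup.mul_mk]; rfl
    rw [h, map_mul, MulOpposite.unop_mul, Equiv.Perm.mul_apply]
    obtain ⟨s, b⟩ := p
    have h2 : ∀ ν, LetterStep (some s, b) τ ν ↔ ν =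
        (FreeGroup.lift (fun a => MulOpposite.op (stepPerm (hY := hY) (g₀ := g₀) hV a))
          (FreeGroup.mk [(s, b)])).unop τ := by
      intro ν
      rw [FreeGroup.lift_mk]
      cases b
      · simp only [List.map_cons, List.map_nil, List.prod_cons, List.prod_nil, mul_one,
          cond_false, MulOpposite.unop_inv, MulOpposite.unop_op]
        rw [Equiv.Perm.eq_inv_iff_eq, eq_comm]
        exact step_iff hV s ν τ
      · simp only [List.map_cons, List.map_nil, List.prod_cons, List.prod_nil, mul_one,
          cond_true, MulOpposite.unop_op]
        exact step_iff hV s τ ν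
    constructor
    · rintro ⟨ν, h1, h3⟩
      rw [(h2 ν).1 h1] at h3
      exact (ih _).1 h3
    · intro h3
      exact ⟨_, (h2 _).2 rfl, (ih _).2 h3⟩

omit hV in
theorem val_take_baseWord (l : GenWord S) (i : ℕ) :
    PresGroup.val (relators R w) ((baseWord l).take i) =
      ofBase R w (PresGroup.val R (l.take i)) := by
  rw [ofBase_val, baseWord, baseWord, List.map_take]

/-- The right action of the base group, as a homomorphism to the opposite of the permutations. -/
noncomputable def actHom : PresGroup R →* (Equiv.Perm (hY.VertexClasses g₀))ᵐᵒᵖ :=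
  PresentedGroup.toGroup (f := fun a => MulOpposite.op (stepPerm hV a)) (by
    rintro _ ⟨r, hr, rfl⟩
    refine MulOpposite.unop_injective (Equiv.ext fun τ => ?_)
    refine ((run_baseWord_iff hV r τ τ).1 ?_).symm
    refine run_relator τ ⟨baseWord r, Or.inl ⟨r, hr, rfl⟩⟩ fun i _ => ?_
    rw [val_take_baseWord]
    exact (mul_ofBase_mem_iff hV _).2 τ.1.2)

/-- The right action of the base group. -/
noncomputable def act (τ : hY.VertexClasses g₀) (a : PresGroup R) : hY.VertexClasses g₀ :=
  (actHom hV a).unop τ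

theorem act_one (τ : hY.VertexClasses g₀) : act hV τ 1 = τ := by
  rw [act, map_one]; rfl

theorem act_mul (τ : hY.VertexClasses g₀) (a b : PresGroup R) :
    act hV τ (a * b) = act hV (act hV τ a) b := by
  rw [act, map_mul]; rfl

theorem act_inv_act (τ : hY.VertexClasses g₀) (a : PresGroup R) :
    act hV (act hV τ a⁻¹) a = τ := by
  rw [← act_mul, inv_mul_cancel, act_one]

theorem act_act_inv (τ : hY.VertexClasses g₀) (a : PresGroup R) :
    act hV (act hV τ a) a⁻¹ = τ := by
  rw [← act_mul, mul_inv_cancel, act_one]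

theorem run_baseWord_iff_act (l : GenWord S) (τ τ' : hY.VertexClasses g₀) :
    Run (baseWord l) τ τ' ↔ τ' = act hV τ (PresGroup.val R l) :=
  run_baseWord_iff hV l τ τ'

theorem step_iff_act (a : S) (τ τ' : hY.VertexClasses g₀) :
    Step (some a) τ τ' ↔ τ' = act hV τ (PresGroup.gen R a) := by
  rw [step_iff hV, act, PresGroup.gen, actHom, PresentedGroup.toGroup.of]; rfl

theorem act_fst (τ : hY.VertexClasses g₀) (a : PresGroup R) :
    ((act hV τ a).1 : PresGroup (relators R w)) = τ.1 * ofBase R w a := by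
  obtain ⟨x, rfl⟩ := PresentedGroup.mk_surjective _ a
  obtain ⟨l, rfl⟩ := Quot.exists_rep x
  exact ((run_baseWord_iff_act hV l τ _).2 rfl).fst_eq.trans (by rw [← ofBase_val]; rfl)

/-- The action of `a` below an edge labelled by the stable letter corresponds to the action of
`a'` above it. -/
def Commutes (hY : Fits V Y) (g₀ : V) (a a' : PresGroup R) : Prop :=
  ofBase R w a * stable R w = stable R w * ofBase R w a' ∧
    ∀ τ ρ : hY.VertexClasses g₀, Step none τ ρ → Step none (act hV τ a) (act hV ρ a')

theorem commutes_gen (a : S) :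
    Commutes hV hY g₀ (PresGroup.gen R a) (PresGroup.val R (w a)) := by
  have h0 := stable_conj R w a
  refine ⟨by rw [← h0, ofBase_gen]; group, fun τ ρ h => ?_⟩
  have hτ : τ.1.1 = ρ.1.1 * (stable R w)⁻¹ := by rw [h.fst_eq]; simp [stable]
  -- The 2-cell based at `ρ` goes down to `τ`, along `a`, up again, and back along `w_a⁻¹`. Its
  -- corners lie in the cosets of `τ` and `ρ`, hence in `V`.
  have hrun : Run (conjWord a (w a)) ρ ρ := by
    refine run_relator ρ ⟨conjWord a (w a), Or.inr ⟨a, rfl⟩⟩ fun i _ => ?_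
    obtain _ | _ | _ | i := i
    · simp
    · change ρ.1.1 * PresGroup.val _ [(none, false)] ∈ V
      have := τ.1.2
      rw [hτ] at this
      rw [val_cons, letterVal_false, val_nil, mul_one]
      exact this
    · change ρ.1.1 * PresGroup.val _ [(none, false), (some a, true)] ∈ V
      have := mul_gen_some_mem hV τ.1.2 a
      rw [hτ] at this
      rwa [val_cons, val_cons, letterVal_false, letterVal_true, val_nil, mul_one, ← mul_assoc]
    · change ρ.1.1 * PresGroup.val _ ((none, false) :: (some a, true) :: (none, true) ::
        (baseWord (FreeGroup.invRev (w a))).take i) ∈ V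
      rw [val_cons, val_cons, val_cons, letterVal_false, letterVal_true, letterVal_true,
        val_take_baseWord]
      have : ρ.1.1 * (ofBase R w (PresGroup.val R (w a))) *
          ofBase R w (PresGroup.val R ((FreeGroup.invRev (w a)).take i)) ∈ V :=
        (mul_ofBase_mem_iff hV _).2 ((mul_ofBase_mem_iff hV _).2 ρ.1.2)
      rw [← h0] at this
      simpa only [stable, mul_assoc] using this
  obtain ⟨τ', h1, ν, h2, ξ, h3, h4⟩ := hrun
  obtain rfl : τ' = τ := Step.left_unique h1 h
  obtain rfl := (step_iff_act hV a _ _).1 h2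
  rw [run_baseWord_iff_act hV, val_invRev] at h4
  rw [h4, act_inv_act]
  exact h3

/-- The 2-cells give this for generators. The group identity is kept in `Commutes` because the
inverse case must first know that the `t`-edge at the moved class ends in `V`. -/
theorem exists_commutes (a : PresGroup R) : ∃ a', Commutes hV hY g₀ a a' := by
  induction a using PresentedGroup.induction_on with
  | _ x =>
    induction x using FreeGroup.induction_on with
    | C1 =>
      refine ⟨1, ?_, ?_⟩
      · simp
      · intro τ ρ h
        rw [map_one, act_one, act_one]
        exact h
    | of a => exact ⟨_, commutes_gen hV a⟩
    | inv_of a h =>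
      obtain ⟨a', h1, h2⟩ := h
      have h1' : ofBase R w (PresentedGroup.mk _ (FreeGroup.of a))⁻¹ * stable R w =
          stable R w * ofBase R w a'⁻¹ := by
        rw [map_inv, map_inv, inv_mul_eq_iff_eq_mul, ← mul_assoc, h1, mul_inv_cancel_right]
      refine ⟨a'⁻¹, by rw [map_inv]; exact h1', fun τ ρ h => ?_⟩
      rw [map_inv]
      set τ₁ := act hV τ (PresentedGroup.mk _ (FreeGroup.of a))⁻¹ with hτ₁
      have hmem : τ₁.1.1 * PresGroup.gen (relators R w) none ∈ V := by
        rw [hτ₁, act_fst, mul_assoc]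
        change τ.1.1 * (_ * stable R w) ∈ V
        rw [h1', ← mul_assoc]
        refine (mul_ofBase_mem_iff hV _).2 ?_
        have := ρ.1.2
        rwa [h.fst_eq] at this
      obtain ⟨ρ₁, hρ₁⟩ := exists_step τ₁ hmem
      have h3 := h2 τ₁ ρ₁ hρ₁
      rw [hτ₁, act_inv_act] at h3
      obtain rfl := h3.right_unique h
      rwa [act_act_inv]
    | mul x y hx hy =>
      obtain ⟨a', h1, h2⟩ := hx
      obtain ⟨b', h3, h4⟩ := hy
      refine ⟨a' * b', ?_, fun τ ρ h => ?_⟩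
      · rw [map_mul, map_mul, map_mul, mul_assoc, h3, ← mul_assoc, h1, mul_assoc]
      · rw [map_mul, act_mul, act_mul]
        exact h4 _ _ (h2 _ _ h)

omit hV in
/-- The class `ρ` is obtained from `τ` by appending `n` edges labelled by the stable letter. -/
def Up : ℕ → hY.VertexClasses g₀ → hY.VertexClasses g₀ → Prop
  | 0, τ, ρ => ρ = τ
  | n + 1, τ, ρ => ∃ ν, Step none τ ν ∧ Up n ν ρ

omit hV in
theorem Up.snoc {n : ℕ} {τ ν ρ : hY.VertexClasses g₀} (h : Up n τ ν) (h' : Step none ν ρ) :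
    Up (n + 1) τ ρ := by
  induction n generalizing τ with
  | zero => rw [show ν = τ from h] at h'; exact ⟨ρ, h', rfl⟩
  | succ n ih =>
    obtain ⟨ξ, h1, h2⟩ := h
    exact ⟨ξ, h1, ih h2⟩

omit hV in
theorem Up.left_unique {n : ℕ} {τ τ' ρ : hY.VertexClasses g₀} (h : Up n τ ρ) (h' : Up n τ' ρ) :
    τ = τ' := by
  induction n generalizing τ τ' with
  | zero => exact (show ρ = τ from h).symm.trans h'
  | succ n ih =>
    obtain ⟨ξ, h1, h2⟩ := h
    obtain ⟨ξ', h1', h2'⟩ := h'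
    obtain rfl := ih h2 h2'
    exact h1.left_unique h1'

omit hV in
theorem Up.fst_eq {n : ℕ} {τ ρ : hY.VertexClasses g₀} (h : Up n τ ρ) :
    (ρ.1 : PresGroup (relators R w)) = τ.1 * stable R w ^ n := by
  induction n generalizing τ with
  | zero => rw [show ρ = τ from h]; simp
  | succ n ih =>
    obtain ⟨ξ, h1, h2⟩ := h
    rw [ih h2, h1.fst_eq, pow_succ', ← mul_assoc]; rfl

/-- The action can be carried upwards but in general not downwards, since `φ` need not be onto. This
is why normal forms go up first and down last. -/
theorem Up.exists_act {n : ℕ} {τ ρ : hY.VertexClasses g₀} (h : Up n τ ρ) (a : PresGroup R) :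
    ∃ a', Up n (act hV τ a) (act hV ρ a') := by
  induction n generalizing τ a with
  | zero => exact ⟨a, by rw [show ρ = τ from h]; rfl⟩
  | succ n ih =>
    obtain ⟨ξ, h1, h2⟩ := h
    obtain ⟨a', -, h3⟩ := exists_commutes (hY := hY) (g₀ := g₀) hV a
    obtain ⟨b, hb⟩ := ih h2 a'
    exact ⟨b, _, h3 _ _ h1, hb⟩

/-- The class `τ'` is obtained from `τ` by going up, moving in a coset of the base, and going
down. -/
def Reach (τ τ' : hY.VertexClasses g₀) : Prop :=
  ∃ (m n : ℕ) (ρ : hY.VertexClasses g₀) (a : PresGroup R), Up m τ ρ ∧ Up n τ' (act hV ρ a)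

theorem Reach.act {τ τ' : hY.VertexClasses g₀} (h : Reach hV τ τ') (a : PresGroup R) :
    Reach hV τ (act hV τ' a) := by
  obtain ⟨m, n, ρ, b, h1, h2⟩ := h
  obtain ⟨a', h3⟩ := h2.exists_act hV a
  exact ⟨m, n, ρ, b * a', h1, by rwa [act_mul]⟩

theorem Reach.step_iff {τ τ' τ'' : hY.VertexClasses g₀} {s : Option S} (h : Step s τ' τ'') :
    Reach hV τ τ' ↔ Reach hV τ τ'' := by
  obtain _ | a := s
  · constructor
    -- If there is no descent to cancel, the new `t`-edge is moved to the left past `a` and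
    -- lengthens the ascent. Otherwise it cancels the first edge on the way from `τ'` back up to the
    -- top coset.
    · rintro ⟨m, _ | n, ρ, a, h1, h2⟩
      · obtain rfl : AscHNN.act hV ρ a = τ' := h2
        obtain ⟨a', h3, h4⟩ := exists_commutes (hY := hY) (g₀ := g₀) hV a
        have hmem : ρ.1.1 * PresGroup.gen (relators R w) none ∈ V := by
          have := τ''.1.2
          rw [h.fst_eq, act_fst, mul_assoc] at this
          change ρ.1.1 * (_ * stable R w) ∈ V at this
          rw [h3, ← mul_assoc] at this
          exact (mul_ofBase_mem_iff hV _).1 this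
        obtain ⟨ρ', hρ'⟩ := exists_step ρ hmem
        exact ⟨m + 1, 0, ρ', a', h1.snoc hρ', (h4 _ _ hρ').right_unique h⟩
      · obtain ⟨ν, h3, h4⟩ := h2
        obtain rfl := h3.right_unique h
        exact ⟨m, n, ρ, a, h1, h4⟩
    · rintro ⟨m, n, ρ, a, h1, h2⟩
      exact ⟨m, n + 1, ρ, a, h1, τ'', h, h2⟩
  · obtain rfl := (step_iff_act hV a _ _).1 h
    refine ⟨fun h => h.act hV _, fun h => ?_⟩
    have := h.act hV (PresGroup.gen R a)⁻¹
    rwa [act_act_inv] at this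

theorem Reach.eq (hinj : Function.Injective (ofBase R w)) {τ τ' : hY.VertexClasses g₀}
    (h : Reach hV τ τ') (h' : τ.1 = τ'.1) : τ = τ' := by
  obtain ⟨m, n, ρ, a, h1, h2⟩ := h
  have e := h2.fst_eq
  rw [act_fst, h1.fst_eq, ← h', mul_assoc, mul_right_inj] at e
  -- Equal end points give `t^m a = t^n` in `G`. The exponent sum of `t` forces `m = n`, and then
  -- injectivity on the base forces `a = 1`.
  have e2 := congrArg (exponent R w) e
  rw [map_mul, map_pow, map_pow, exponent_ofBase, exponent_stable, mul_one, ← ofAdd_nsmul,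
    ← ofAdd_nsmul, Multiplicative.ofAdd.apply_eq_iff_eq] at e2
  obtain rfl : m = n := by simpa using e2
  rw [mul_eq_left] at e
  obtain rfl : a = 1 := hinj (e.trans (map_one _).symm)
  rw [act_one] at h2
  exact h1.left_unique h2

/-- Let `V` be a union of left cosets of the base. All loops in a part of the Cayley 2-complex that
fits `V` are null-homotopic. -/
theorem loopsNullHomotopicIn (hY : Fits V Y) (hinj : Function.Injective (ofBase R w)) :
    LoopsNullHomotopicIn Y := by
  refine hY.loopsNullHomotopicIn fun g => ⟨fun g' k =>
    Reach hV (⟨g, .refl _⟩ : hY.VertexClasses g) ⟨g', k⟩, ?_, ?_, ?_⟩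
  · intro g₁ g₂ s δ hδ k
    exact Reach.step_iff hV ⟨δ, hδ, rfl⟩
  · exact ⟨0, 0, _, 1, rfl, act_one hV _⟩
  · intro k hk
    have := hk.eq hV hinj rfl
    exact (eq_of_heq (Sigma.mk.inj this).2).symm

end Action

end AscHNN

/-! ### Retracting a disc without a boundary arc -/

namespace Cayley

/-- The circle minus a closed arc has a continuous angle function. -/
theorem exists_continuous_angle {a b : ℝ} (hab : a ≤ b) (J : Set 𝔻)
    (hJ : circlePoint '' Set.Icc a b ⊆ J) :
    ∃ θ : {z : 𝔻 | ‖(z : ℂ)‖ = 1 ∧ z ∉ J} → ℝ, Continuous θ ∧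
      ∀ z, b < θ z ∧ θ z < a + 1 ∧ circlePoint (θ z) = z := by
  set m := (a + b) / 2 with hm
  have hpi := Real.pi_pos
  -- Dividing by the antipode of the midpoint of the arc puts the branch cut of `arg` at that
  -- midpoint, which lies in `J`.
  let c : ℂ := -(circlePoint m : ℂ)
  have hc : ‖c‖ = 1 := by rw [norm_neg, norm_circlePoint]
  have hc0 : c ≠ 0 := norm_ne_zero_iff.1 (by rw [hc]; exact one_ne_zero)
  let θ : {z : 𝔻 | ‖(z : ℂ)‖ = 1 ∧ z ∉ J} → ℝ := fun z =>
    m + 1 / 2 + Complex.arg ((z : 𝔻) / c) / (2 * Real.pi)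
  have hθ : ∀ z, circlePoint (θ z) = z := by
    rintro ⟨z, hz, hzJ⟩
    refine Subtype.ext ?_
    have h1 := Complex.norm_mul_exp_arg_mul_I ((z : ℂ) / c)
    rw [norm_div, hz, hc] at h1
    have h2 : ((2 * Real.pi * θ ⟨z, hz, hzJ⟩ : ℝ) : ℂ) * Complex.I =
        ((2 * Real.pi * m : ℝ) : ℂ) * Complex.I + Real.pi * Complex.I +
          Complex.arg ((z : ℂ) / c) * Complex.I := by
      simp only [θ]
      push_cast
      have : (Real.pi : ℂ) ≠ 0 := by exact_mod_cast hpi.ne'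
      field_simp
    simp only [circlePoint]
    rw [h2, Complex.exp_add, Complex.exp_add, Complex.exp_pi_mul_I]
    have h3 : Complex.exp (((2 * Real.pi * m : ℝ) : ℂ) * Complex.I) * -1 = c := by
      simp [c, circlePoint]
    rw [h3]
    simp only [div_one, Complex.ofReal_one, one_mul] at h1
    rw [h1, mul_div_cancel₀ _ hc0]
  have hmem : ∀ z : {z : 𝔻 | ‖(z : ℂ)‖ = 1 ∧ z ∉ J}, ∀ x, a ≤ x → x ≤ b → circlePoint x ≠ z :=
    fun z x h1 h2 h => z.2.2 (hJ ⟨x, ⟨h1, h2⟩, h⟩)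
  have hlo : ∀ z, m < θ z := fun z => by
    have := Complex.neg_pi_lt_arg ((z : 𝔻) / c)
    have h2 : -(1 / 2) < Complex.arg ((z : 𝔻) / c) / (2 * Real.pi) := by
      rw [lt_div_iff₀ (by positivity)]; linarith
    simp only [θ]; linarith
  have hhi : ∀ z, θ z ≤ m + 1 := fun z => by
    have := Complex.arg_le_pi ((z : 𝔻) / c)
    have h2 : Complex.arg ((z : 𝔻) / c) / (2 * Real.pi) ≤ 1 / 2 := by
      rw [div_le_iff₀ (by positivity)]; linarith
    simp only [θ]; linarith
  refine ⟨θ, ?_, fun z => ⟨?_, ?_, hθ z⟩⟩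
  · rw [continuous_iff_continuousAt]
    intro z
    have hs : ((z : 𝔻) : ℂ) / c ∈ Complex.slitPlane := by
      rw [Complex.mem_slitPlane_iff_arg]
      refine ⟨fun h => ?_, div_ne_zero (norm_ne_zero_iff.1 ?_) hc0⟩
      · refine hmem z m (by linarith) (by linarith) ?_
        rw [← hθ z]
        refine circlePoint_eq_iff.2 ⟨-1, ?_⟩
        simp only [θ, h]
        push_cast
        field_simp
        ring
      · rw [z.2.1]; exact one_ne_zero
    have h1 : ContinuousAt (fun z : {z : 𝔻 | ‖(z : ℂ)‖ = 1 ∧ z ∉ J} => ((z : 𝔻) : ℂ) / c) z := by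
      fun_prop
    have h2 := ContinuousAt.comp (f := fun z : {z : 𝔻 | ‖(z : ℂ)‖ = 1 ∧ z ∉ J} =>
      ((z : 𝔻) : ℂ) / c) (Complex.continuousAt_arg hs) h1
    exact continuousAt_const.add (h2.div_const _)
  · by_contra h
    exact hmem z (θ z) (by linarith [hlo z]) (not_lt.1 h) (hθ z)
  · by_contra h
    refine hmem z (θ z - 1) (by linarith) (by linarith [hhi z]) ?_
    rw [← hθ z]
    exact circlePoint_eq_iff.2 ⟨-1, by push_cast; ring⟩

/-- The closed disc minus a closed arc of its boundary retracts to the rest of the boundary. -/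
theorem exists_retraction_compl_arc {a b : ℝ} (hab : a ≤ b) (hb : b < a + 1) :
    ∃ ρ : 𝔻 → 𝔻, ContinuousOn ρ (circlePoint '' Set.Icc a b)ᶜ ∧
      ∀ z ∉ circlePoint '' Set.Icc a b, ρ z ∉ circlePoint '' Set.Icc a b ∧ ‖(ρ z : ℂ)‖ = 1 ∧
        (‖(z : ℂ)‖ = 1 → ρ z = z) := by
  set J := circlePoint '' Set.Icc a b with hJ
  obtain ⟨θ, hθ, hθ'⟩ := exists_continuous_angle hab J subset_rfl
  let e : {z : 𝔻 | ‖(z : ℂ)‖ = 1 ∧ z ∉ J} → {z : 𝔻 | z ∉ J} := fun z => ⟨z, z.2.2⟩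
  have he : IsClosedEmbedding e := by
    refine ⟨IsEmbedding.subtypeVal.codRestrict _ fun z => z.2.2, ?_⟩
    have : Set.range e = {z : {z : 𝔻 | z ∉ J} | ‖((z : 𝔻) : ℂ)‖ = 1} := by
      refine Set.ext fun z => ⟨?_, fun h => ⟨⟨z, h, z.2⟩, rfl⟩⟩
      rintro ⟨w, rfl⟩
      exact w.2.1
    rw [this]
    exact isClosed_eq (by fun_prop) continuous_const
  -- The angle is extended by Tietze with values still in the open interval from `b` to `a + 1`. The
  -- points of the circle with such angles are exactly those outside the arc.
  obtain ⟨F, hF, hFe⟩ := ContinuousMap.exists_extension_forall_mem_of_isClosedEmbedding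
    ⟨θ, hθ⟩ (t := Set.Ioo b (a + 1)) (fun z => ⟨(hθ' z).1, (hθ' z).2.1⟩) ⟨(b + (a + 1)) / 2, by
      constructor <;> linarith⟩ he
  classical
  let ρ : 𝔻 → 𝔻 := fun z => if h : z ∉ J then circlePoint (F ⟨z, h⟩) else z
  have hρ : ∀ z (h : z ∉ J), ρ z = circlePoint (F ⟨z, h⟩) := fun z h => dif_pos h
  refine ⟨ρ, ?_, fun z hz => ?_⟩
  · rw [continuousOn_iff_continuous_domRestrict]
    exact (continuous_circlePoint.comp F.continuous).congr fun z => (hρ z z.2).symm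
  · rw [hρ z hz]
    refine ⟨?_, norm_circlePoint _, fun h1 => ?_⟩
    · rintro ⟨y, hy, h⟩
      obtain ⟨k, hk⟩ := circlePoint_eq_iff.1 h
      have h1 := (hF ⟨z, hz⟩).1
      have h2 := (hF ⟨z, hz⟩).2
      have h3 : (k : ℝ) < 0 := by linarith [hy.1, hy.2]
      have h4 : (-1 : ℝ) < k := by linarith [hy.1, hy.2]
      have h3' : k < 0 := by exact_mod_cast h3
      have h4' : -1 < k := by exact_mod_cast h4
      omega
    · have := congrFun hFe ⟨z, h1, hz⟩
      change F ⟨z, hz⟩ = θ _ at this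
      rw [this]
      exact (hθ' ⟨z, h1, hz⟩).2.2

end Cayley

/-! ### Spanned subcomplexes and their complements -/

namespace Cayley

variable {S : Type*} {R : Set (GenWord S)} {V : Set (PresGroup R)}

/-- The vertices in `V` and the points of edges with both ends in `V`. -/
def graphPart (V : Set (PresGroup R)) : Set (Cells1 R) :=
  {c | (∃ g ∈ V, c = vert g) ∨
    ∃ g s u, g ∈ V ∧ g * PresGroup.gen R s ∈ V ∧ c = edge g s u}

theorem letterEdge_mem_graphPart {g : PresGroup R} {p : S × Bool} (h0 : g ∈ V)
    (h1 : g * letterVal R p ∈ V) (u : I) : letterEdge g p u ∈ graphPart V := by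
  obtain ⟨s, _ | _⟩ := p
  · exact Or.inr ⟨_, s, _, by simpa using h1, by simpa using h0, rfl⟩
  · exact Or.inr ⟨_, s, _, h0, by simpa using h1, rfl⟩

theorem toComplex_cell2_mem_graphPart {g : PresGroup R} {r : R}
    (h : ∀ i ≤ r.1.length, g * PresGroup.val R (r.1.take i) ∈ V) {z : 𝔻} (hz : ‖(z : ℂ)‖ = 1) :
    toComplex R (cell2 R g r z) ∈ toGraph R '' graphPart V := by
  by_cases hr : r.1 = []
  · refine ⟨vert g, Or.inl ⟨g, by simpa using h 0 (Nat.zero_le _), rfl⟩, ?_⟩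
    exact (Quot.sound (Glue.constant g r hr z hz)).symm
  · obtain ⟨i, u, -, rfl⟩ := exists_corner (n := r.1.length) (by simpa using hr) hz
    rw [toComplex_boundary]
    refine ⟨_, letterEdge_mem_graphPart (h i i.2.le) ?_ u, rfl⟩
    rw [mul_assoc, ← val_take_succ]
    exact h _ i.2

theorem toGraph_mem_spanned_of_mem {c : Cells1 R} (h : c ∈ graphPart V) :
    toGraph R c ∈ spanned R V := by
  obtain ⟨g, hg, rfl⟩ | ⟨g, s, u, h0, h1, rfl⟩ := h
  · exact Or.inl ⟨g, hg, rfl⟩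
  · exact Or.inr (Or.inl ⟨g, s, u, h0, h1, rfl⟩)

theorem toGraph_mem_spanned_iff {c : Cells1 R} :
    toGraph R c ∈ spanned R V ↔ toGraph R c ∈ toGraph R '' graphPart V := by
  refine ⟨?_, fun ⟨c', h, h'⟩ => h' ▸ toGraph_mem_spanned_of_mem h⟩
  rintro (⟨g, hg, h⟩ | ⟨g, s, u, h0, h1, h⟩ | ⟨g, r, z, hV, h⟩)
  · exact ⟨vert g, Or.inl ⟨g, hg, rfl⟩, h.symm⟩
  · exact ⟨edge g s u, Or.inr ⟨g, s, u, h0, h1, rfl⟩, h.symm⟩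
  · change toGraph R c = toComplex R (cell2 R g r z) at h
    by_cases hz : ‖(z : ℂ)‖ = 1
    · rw [h]
      exact toComplex_cell2_mem_graphPart hV hz
    · exact (toComplex_cell2_ne_toGraph hz c h.symm).elim

theorem toGraph_vert_mem_spanned_iff {g : PresGroup R} :
    toGraph R (vert g) ∈ spanned R V ↔ g ∈ V := by
  refine ⟨fun h => ?_, fun h => toGraph_mem_spanned_of_mem (Or.inl ⟨g, h, rfl⟩)⟩
  obtain ⟨c, ⟨g', hg', rfl⟩ | ⟨g', s, u, h0, h1, rfl⟩, h⟩ := toGraph_mem_spanned_iff.1 h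
  · rwa [← toGraph_vert_injective h]
  · obtain rfl | rfl := Fits.eq_zero_or_one_of_toGraph_edge_eq h
    · rw [toGraph_edge_zero] at h
      rwa [← toGraph_vert_injective h]
    · rw [toGraph_edge_one] at h
      rwa [← toGraph_vert_injective h]

theorem mem_of_toGraph_edge_mem_spanned {g : PresGroup R} {s : S} {u : I} (h0 : u ≠ 0)
    (h1 : u ≠ 1) (h : toGraph R (edge g s u) ∈ spanned R V) :
    g ∈ V ∧ g * PresGroup.gen R s ∈ V := by
  obtain ⟨c, hc, h⟩ := toGraph_mem_spanned_iff.1 h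
  rw [toGraph_eq_iff, normalize_edge h0 h1] at h
  obtain ⟨g', hg', rfl⟩ | ⟨g', s', u', hg0, hg1, rfl⟩ := hc
  · cases h
  · by_cases h0' : u' = 0
    · rw [h0', normalize_edge_zero] at h; cases h
    by_cases h1' : u' = 1
    · rw [h1', normalize_edge_one] at h; cases h
    rw [normalize_edge h0' h1'] at h
    simp only [edge, Sum.inr.injEq, Sigma.mk.injEq, Prod.mk.injEq] at h
    obtain ⟨⟨rfl, rfl⟩, -⟩ := h
    exact ⟨hg0, hg1⟩

theorem toGraph_edge_mem_spanned_iff {g : PresGroup R} {s : S} {u : I} :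
    toGraph R (edge g s u) ∈ spanned R V ↔
      (u = 0 ∧ g ∈ V) ∨ (u = 1 ∧ g * PresGroup.gen R s ∈ V) ∨
        (g ∈ V ∧ g * PresGroup.gen R s ∈ V) := by
  constructor
  · intro h
    by_cases h0 : u = 0
    · subst h0
      rw [toGraph_edge_zero, toGraph_vert_mem_spanned_iff] at h
      exact Or.inl ⟨rfl, h⟩
    by_cases h1 : u = 1
    · subst h1
      rw [toGraph_edge_one, toGraph_vert_mem_spanned_iff] at h
      exact Or.inr (Or.inl ⟨rfl, h⟩)
    exact Or.inr (Or.inr (mem_of_toGraph_edge_mem_spanned h0 h1 h))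
  · rintro (⟨rfl, h⟩ | ⟨rfl, h⟩ | ⟨h, h'⟩)
    · rwa [toGraph_edge_zero, toGraph_vert_mem_spanned_iff]
    · rwa [toGraph_edge_one, toGraph_vert_mem_spanned_iff]
    · exact Or.inr (Or.inl ⟨g, s, u, h, h', rfl⟩)

theorem toGraph_letterEdge_mem_spanned_iff {g : PresGroup R} {p : S × Bool} {u : I} :
    toGraph R (letterEdge g p u) ∈ spanned R V ↔
      (u = 0 ∧ g ∈ V) ∨ (u = 1 ∧ g * letterVal R p ∈ V) ∨ (g ∈ V ∧ g * letterVal R p ∈ V) := by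
  obtain ⟨s, _ | _⟩ := p
  · rw [letterEdge, toGraph_edge_mem_spanned_iff, letterVal_false, inv_mul_cancel_right,
      unitInterval.symm_eq_zero, unitInterval.symm_eq_one]
    tauto
  · rw [letterEdge, toGraph_edge_mem_spanned_iff, letterVal_true]

theorem toComplex_corner_mem_spanned_iff {g : PresGroup R} {r : R} (i : Fin r.1.length) {u : I} :
    toComplex R (cell2 R g r (circlePoint (((i : ℕ) + (u : ℝ)) / r.1.length))) ∈ spanned R V ↔
      (u = 0 ∧ g * PresGroup.val R (r.1.take i) ∈ V) ∨
      (u = 1 ∧ g * PresGroup.val R (r.1.take (i + 1)) ∈ V) ∨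
      (g * PresGroup.val R (r.1.take i) ∈ V ∧ g * PresGroup.val R (r.1.take (i + 1)) ∈ V) := by
  rw [toComplex_boundary, toGraph_letterEdge_mem_spanned_iff, mul_assoc, ← val_take_succ]

theorem toComplex_cell2_mem_spanned_iff {g : PresGroup R} {r : R} {z : 𝔻} (hz : ‖(z : ℂ)‖ ≠ 1) :
    toComplex R (cell2 R g r z) ∈ spanned R V ↔
      ∀ i ≤ r.1.length, g * PresGroup.val R (r.1.take i) ∈ V := by
  refine ⟨?_, fun h => Or.inr (Or.inr ⟨g, r, z, h, rfl⟩)⟩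
  rintro (⟨g', hg, h⟩ | ⟨g', s, u, h0, h1, h⟩ | ⟨g', r', z', hV, h⟩)
  · exact (toComplex_cell2_ne_toGraph hz (vert g') h).elim
  · exact (toComplex_cell2_ne_toGraph hz (edge g' s u) h).elim
  · have := eq_of_toComplex_eq_cell2 hz h.symm
    simp only [cell2, Sum.inr.injEq, Sigma.mk.injEq, Prod.mk.injEq] at this
    obtain ⟨⟨rfl, rfl⟩, -⟩ := this
    exact hV

theorem isClosed_graphPart : IsClosed (graphPart V) := by
  refine isClosed_cells1_iff.2 fun g s => ?_
  have : {u | edge g s u ∈ graphPart V} = {_u | g ∈ V ∧ g * PresGroup.gen R s ∈ V} := by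
    ext u
    constructor
    · rintro (⟨g', -, h⟩ | ⟨g', s', u', h0, h1, h⟩)
      · cases h
      · simp only [edge, Sum.inr.injEq, Sigma.mk.injEq, Prod.mk.injEq] at h
        obtain ⟨⟨rfl, rfl⟩, -⟩ := h
        exact ⟨h0, h1⟩
    · exact fun h => Or.inr ⟨g, s, u, h.1, h.2, rfl⟩
  rw [this]
  exact isClosed_const

/-- A 2-cell that does not belong to the subcomplex meets it only in the closed image of `graphPart
V`. -/
theorem isClosed_spanned : IsClosed (spanned R V) := by
  have hK := isClosedMap_toGraph _ (isClosed_graphPart (V := V))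
  rw [← isQuotientMap_toComplex.isClosed_preimage, isClosed_cells_iff]
  constructor
  · intro g s
    convert hK.preimage (continuous_toGraph.comp (continuous_edge g s)) using 1
    exact Set.ext fun u => toGraph_mem_spanned_iff (c := edge g s u)
  · intro g r
    by_cases hV : ∀ i ≤ r.1.length, g * PresGroup.val R (r.1.take i) ∈ V
    · convert isClosed_univ
      exact Set.eq_univ_of_forall fun z => Or.inr (Or.inr ⟨g, r, z, hV, rfl⟩)
    · convert hK.preimage (isQuotientMap_toComplex.continuous.comp (continuous_cell2 g r)) using 1
      ext z
      rw [Set.mem_ofPred_eq, Set.mem_preimage, Set.mem_preimage, Function.comp_apply]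
      by_cases hz : ‖(z : ℂ)‖ = 1
      · obtain ⟨c, hc⟩ := exists_toComplex_cell2_eq g r hz
        rw [hc, toGraph_mem_spanned_iff]
      · rw [toComplex_cell2_mem_spanned_iff hz]
        refine iff_of_false hV ?_
        rintro ⟨c, -, hc⟩
        exact toComplex_cell2_ne_toGraph hz c hc.symm

/-- A spanned subcomplex meets a cell that it does not contain only in the boundary. -/
theorem fits_spanned (V : Set (PresGroup R)) : Fits V (spanned R V) where
  isLocallyClosed := isClosed_spanned.isLocallyClosed
  vert_mem := toGraph_vert_mem_spanned_iff
  edge_mem h0 h1 u := Or.inr (Or.inl ⟨_, _, u, h0, h1, rfl⟩)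
  edge_mixed {g s u} hV h := by
    obtain ⟨rfl, hg⟩ | ⟨rfl, hg⟩ | hg := toGraph_edge_mem_spanned_iff.1 h
    · refine Or.inl ⟨hg, fun u' hu' => ?_⟩
      rw [le_antisymm hu' nonneg']
      exact toGraph_edge_mem_spanned_iff.2 (Or.inl ⟨rfl, hg⟩)
    · refine Or.inr ⟨hg, fun u' hu' => ?_⟩
      rw [le_antisymm le_one' hu']
      exact toGraph_edge_mem_spanned_iff.2 (Or.inr (Or.inl ⟨rfl, hg⟩))
    · exact (hV hg).elim
  disc_interior hz hz' h := by
    rw [toComplex_cell2_mem_spanned_iff hz.ne] at h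
    rwa [toComplex_cell2_mem_spanned_iff hz'.ne]
  disc_mem {g r} h z := Or.inr (Or.inr ⟨g, r, z, h, rfl⟩)
  disc_mixed g r h := by
    refine ⟨id, continuousOn_id, fun z hz => ⟨hz, ?_, fun _ => rfl⟩⟩
    by_contra hz1
    rw [toComplex_cell2_mem_spanned_iff (z := z) hz1] at hz
    exact h fun z => Or.inr (Or.inr ⟨g, r, z, hz, rfl⟩)

/-- If a 2-cell meets a spanned subcomplex in an arc of its boundary, then the rest of the 2-cell can
be pushed into its boundary. -/
theorem exists_retraction_compl_spanned {D : Set (PresGroup R)} {g : PresGroup R} {r : R} {a b : ℝ}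
    (hab : a ≤ b) (hb : b < a + 1)
    (h : ∀ z, toComplex R (cell2 R g r z) ∈ spanned R D ↔ z ∈ circlePoint '' Set.Icc a b) :
    ∃ ρ : 𝔻 → 𝔻, ContinuousOn ρ {z | toComplex R (cell2 R g r z) ∈ (spanned R D)ᶜ} ∧
      ∀ z, toComplex R (cell2 R g r z) ∈ (spanned R D)ᶜ →
        toComplex R (cell2 R g r (ρ z)) ∈ (spanned R D)ᶜ ∧
        ‖(ρ z : ℂ)‖ = 1 ∧ (‖(z : ℂ)‖ = 1 → ρ z = z) := by
  obtain ⟨ρ, hρ, hρ'⟩ := exists_retraction_compl_arc hab hb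
  refine ⟨ρ, hρ.mono fun z hz => mt (h z).2 hz, fun z hz => ?_⟩
  obtain ⟨h1, h2⟩ := hρ' z (mt (h z).2 hz)
  exact ⟨mt (h _).1 h1, h2⟩

theorem notMem_spanned_of_forall_notMem {D : Set (PresGroup R)} {g : PresGroup R} {r : R}
    (h : ∀ i ≤ r.1.length, g * PresGroup.val R (r.1.take i) ∉ D) (z : 𝔻) :
    toComplex R (cell2 R g r z) ∉ spanned R D := by
  intro h'
  by_cases hz : ‖(z : ℂ)‖ = 1
  · obtain ⟨c, hc, h1⟩ := toComplex_cell2_mem_graphPart (V := Dᶜ) h hz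
    rw [← h1] at h'
    obtain ⟨g', hg', rfl⟩ | ⟨g', s, u, h0, hs, rfl⟩ := hc
    · exact hg' (toGraph_vert_mem_spanned_iff.1 h')
    · rw [toGraph_edge_mem_spanned_iff] at h'
      simp only [Set.mem_compl_iff] at h0 hs
      tauto
  · exact h 0 (Nat.zero_le _) ((toComplex_cell2_mem_spanned_iff hz).1 h' 0 (Nat.zero_le _))

/-- The complement of a spanned subcomplex, if every 2-cell has the arc property. -/
theorem fits_compl_spanned {D : Set (PresGroup R)}
    (hD : ∀ g, ∀ r : R, (∀ i ≤ r.1.length, g * PresGroup.val R (r.1.take i) ∈ D) ∨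
      (∀ i ≤ r.1.length, g * PresGroup.val R (r.1.take i) ∉ D) ∨
      ∃ a b : ℝ, a ≤ b ∧ b < a + 1 ∧
        ∀ z, toComplex R (cell2 R g r z) ∈ spanned R D ↔ z ∈ circlePoint '' Set.Icc a b) :
    Fits Dᶜ (spanned R D)ᶜ where
  isLocallyClosed := isClosed_spanned.isOpen_compl.isLocallyClosed
  vert_mem := toGraph_vert_mem_spanned_iff.not
  edge_mem h0 h1 u h := by
    rw [toGraph_edge_mem_spanned_iff] at h
    simp only [Set.mem_compl_iff] at h0 h1
    tauto
  edge_mixed {g s u} hV h := by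
    rw [Set.mem_compl_iff, toGraph_edge_mem_spanned_iff] at h
    simp only [Set.mem_compl_iff] at hV ⊢
    by_cases hg : g ∈ D
    · have hs : g * PresGroup.gen R s ∉ D := fun hs => h (Or.inr (Or.inr ⟨hg, hs⟩))
      refine Or.inr ⟨hs, fun u' hu' h' => ?_⟩
      obtain ⟨rfl, -⟩ | ⟨-, h'⟩ | ⟨-, h'⟩ := toGraph_edge_mem_spanned_iff.1 h'
      · exact h (Or.inl ⟨le_antisymm hu' nonneg', hg⟩)
      · exact hs h'
      · exact hs h'
    · refine Or.inl ⟨hg, fun u' hu' h' => ?_⟩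
      obtain ⟨-, h'⟩ | ⟨rfl, hs⟩ | ⟨h', -⟩ := toGraph_edge_mem_spanned_iff.1 h'
      · exact hg h'
      · exact h (Or.inr (Or.inl ⟨le_antisymm le_one' hu', hs⟩))
      · exact hg h'
  disc_interior hz hz' h h' := by
    rw [toComplex_cell2_mem_spanned_iff hz'.ne] at h'
    exact h ((toComplex_cell2_mem_spanned_iff hz.ne).2 h')
  disc_mem h z := notMem_spanned_of_forall_notMem h z
  disc_mixed g r h := by
    obtain h1 | h1 | ⟨a, b, hab, hb, h1⟩ := hD g r
    · exact ⟨id, continuousOn_id, fun z hz => (hz (Or.inr (Or.inr ⟨g, r, z, h1, rfl⟩))).elim⟩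
    · exact (h fun z => notMem_spanned_of_forall_notMem h1 z).elim
    · exact exists_retraction_compl_spanned hab hb h1

end Cayley

/-! ### 2-cells that meet a spanned subcomplex in an arc -/

namespace Cayley

variable {S : Type*} {R : Set (GenWord S)}

/-- If the vertices of a 2-cell that lie in `D` are consecutive, but not all vertices, then the
2-cell meets the subcomplex spanned by `D` in an arc of its boundary. -/
theorem toComplex_cell2_mem_spanned_iff_mem_arc {D : Set (PresGroup R)} {g : PresGroup R} {r : R}
    {j k : ℕ} (hj : 1 ≤ j) (hjk : j ≤ k) (hk : k ≤ r.1.length)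
    (hD : ∀ i, 1 ≤ i → i ≤ r.1.length →
      (g * PresGroup.val R (r.1.take i) ∈ D ↔ j ≤ i ∧ i ≤ k))
    (hne : ¬ ∀ i ≤ r.1.length, g * PresGroup.val R (r.1.take i) ∈ D) (z : 𝔻) :
    toComplex R (cell2 R g r z) ∈ spanned R D ↔
      z ∈ circlePoint '' Set.Icc ((j : ℝ) / r.1.length) ((k : ℝ) / r.1.length) := by
  set n := r.1.length with hn
  have hn0 : 0 < n := by omega
  have hn' : (0 : ℝ) < n := by exact_mod_cast hn0
  -- Corner `0` is the same vertex as corner `n`. Numbering the corners from `1` to `n` avoids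
  -- counting it twice.
  have h0 : g * PresGroup.val R (r.1.take 0) ∈ D ↔ k = n := by
    have := hD n hn0 le_rfl
    rw [List.take_of_length_le (by omega), val_eq_one r.2] at this
    rw [List.take_zero, val_nil, this]
    omega
  constructor
  · intro h
    by_cases hz : ‖(z : ℂ)‖ = 1
    swap
    · exact (hne ((toComplex_cell2_mem_spanned_iff hz).1 h)).elim
    obtain ⟨i, u, hu, rfl⟩ := exists_corner hn0.ne' hz
    replace h := (toComplex_corner_mem_spanned_iff i).1 h
    have key : ∀ x : ℝ, (j : ℝ) ≤ x → x ≤ k → circlePoint (x / n) ∈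
        circlePoint '' Set.Icc ((j : ℝ) / n) ((k : ℝ) / n) := fun x h1 h2 =>
      ⟨_, ⟨by gcongr, by gcongr⟩, rfl⟩
    obtain ⟨rfl, h⟩ | ⟨rfl, -⟩ | ⟨h, h'⟩ := h
    · obtain hi | hi := Nat.eq_zero_or_pos i
      · rw [hi, h0] at h
        have := key n (by exact_mod_cast hjk.trans hk) (by rw [h])
        convert this using 1
        refine circlePoint_eq_iff.2 ⟨-1, ?_⟩
        simp [hi, hn'.ne']
      · obtain ⟨h1, h2⟩ := (hD i hi i.2.le).1 h
        refine key _ ?_ ?_ <;> simpa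
    · simp at hu
    · obtain ⟨h1, h2⟩ := (hD (i + 1) (by omega) i.2).1 h'
      obtain hi | hi := Nat.eq_zero_or_pos i
      -- If the first edge lay in the subcomplex, corner `1` and corner `n` would both be in `D`,
      -- and hence all corners.
      · rw [hi, h0] at h
        refine (hne fun i' hi' => ?_).elim
        obtain rfl | hi1 := Nat.eq_zero_or_pos i'
        · exact h0.2 h
        · exact (hD i' hi1 hi').2 (by omega)
      · obtain ⟨h3, -⟩ := (hD i hi i.2.le).1 h
        have h3' : (j : ℝ) ≤ (i : ℕ) := by exact_mod_cast h3
        have h2' : ((i : ℕ) : ℝ) + 1 ≤ k := by exact_mod_cast h2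
        have := u.2.1
        exact key _ (by linarith) (by linarith)
  · rintro ⟨θ, ⟨h1, h2⟩, rfl⟩
    rw [div_le_iff₀ hn'] at h1
    rw [le_div_iff₀ hn'] at h2
    have hpos : 0 ≤ θ * n := le_trans (by positivity) h1
    have hf := Nat.floor_le hpos
    have hf' := Nat.lt_floor_add_one (θ * n)
    set i := ⌊θ * n⌋₊ with hi
    have hji : j ≤ i := Nat.le_floor h1
    have hik : i ≤ k := by exact_mod_cast hf.trans h2
    -- At the right end of the arc only corner `k` itself is used, since the next edge need not be
    -- spanned by `D`.
    obtain hik | hik := hik.eq_or_lt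
    · have : θ = k / n := by
        rw [eq_div_iff hn'.ne']
        refine le_antisymm h2 ?_
        rwa [← hik]
      rw [this, hn, toComplex_corner g r hk, toGraph_vert_mem_spanned_iff]
      exact (hD k (hj.trans hjk) hk).2 ⟨hjk, le_rfl⟩
    · have := (toComplex_corner_mem_spanned_iff (V := D) (g := g) (r := r) ⟨i, by omega⟩
        (u := ⟨θ * n - i, by linarith, by linarith⟩)).2 (Or.inr (Or.inr
          ⟨(hD i (by omega) (by omega)).2 (by omega), (hD (i + 1) (by omega) (by omega)).2 (by omega)⟩))
      convert this using 3
      simp only [add_sub_cancel, ← hn]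
      field_simp

end Cayley

/-! ### The removed set as a union of cosets -/

namespace AscHNN

open Cayley

variable {S : Type*} {R : Set (GenWord S)} {w : S → GenWord S}
  {D : Set (PresGroup (relators R w))}

/-- Corners `1` and `2` lie in the coset of `g t⁻¹`, and all other corners lie in the coset of `g`.
-/
theorem mul_val_take_conjWord_mem_iff (hD : ∀ g ∈ D, ∀ a ∈ base R w, g * a ∈ D)
    (g : PresGroup (relators R w)) (a : S) (l : GenWord S) (i : ℕ) :
    g * PresGroup.val (relators R w) ((conjWord a l).take i) ∈ D ↔
      if i = 1 ∨ i = 2 then g * (stable R w)⁻¹ ∈ D else g ∈ D := by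
  match i with
  | 0 => simp
  | 1 =>
    rw [conjWord, List.take_succ_cons, List.take_zero, val_cons, val_nil, letterVal_false]
    simp [stable]
  | 2 =>
    rw [conjWord, List.take_succ_cons, List.take_succ_cons, List.take_zero, val_cons, val_cons,
      val_nil, letterVal_false, letterVal_true, ← ofBase_gen, mul_one, ← mul_assoc,
      mul_ofBase_mem_iff hD]
    simp [stable]
  | i + 3 =>
    rw [conjWord, List.take_succ_cons, List.take_succ_cons, List.take_succ_cons, val_cons, val_cons,
      val_cons, val_take_baseWord, letterVal_false, letterVal_true, letterVal_true, ← mul_assoc,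
      ← mul_assoc, ← mul_assoc, mul_ofBase_mem_iff hD, mul_assoc, mul_assoc,
      ← mul_assoc _ _ (PresGroup.gen _ none)]
    change g * ((stable R w)⁻¹ * PresGroup.gen (relators R w) (some a) * stable R w) ∈ D ↔ _
    rw [stable_conj, mul_ofBase_mem_iff hD]
    simp

/-- The corners of a 2-cell for a relator of the base lie in one coset. Those of a strip lie in the
cosets `gA` and `g t⁻¹ A`, each of which occupies consecutive corners in cyclic order. -/
theorem fits_compl_spanned (hD : ∀ g ∈ D, ∀ a ∈ base R w, g * a ∈ D) :
    Fits Dᶜ (spanned (relators R w) D)ᶜ := by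
  refine Cayley.fits_compl_spanned fun g => ?_
  rintro ⟨_, ⟨r, hr, rfl⟩ | ⟨a, rfl⟩⟩
  · have h : ∀ i, g * PresGroup.val (relators R w) ((baseWord r).take i) ∈ D ↔ g ∈ D := fun i => by
      rw [val_take_baseWord, mul_ofBase_mem_iff hD]
    by_cases hg : g ∈ D
    · exact Or.inl fun i _ => (h i).2 hg
    · exact Or.inr (Or.inl fun i _ => mt (h i).1 hg)
  · have h := mul_val_take_conjWord_mem_iff hD g a (w a)
    have hlen : 3 ≤ (conjWord a (w a)).length := by simp [conjWord]
    have hlen' : (3 : ℝ) ≤ (conjWord a (w a)).length := by exact_mod_cast hlen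
    simp only [h]
    by_cases hg : g ∈ D <;> by_cases hg' : g * (stable R w)⁻¹ ∈ D
    · exact Or.inl fun i _ => by simp [hg, hg']
    -- Here only the coset of `g` is in `D`. Its corners run from `3` to the last one, which is also
    -- corner `0`.
    · refine Or.inr (Or.inr ⟨_, _, ?_, ?_, toComplex_cell2_mem_spanned_iff_mem_arc (j := 3)
        (k := (conjWord a (w a)).length) (by norm_num) hlen le_rfl (fun i h1 h2 => ?_) fun h1 => ?_⟩)
      · gcongr
      · simp only
        rw [div_self (by positivity)]
        exact lt_add_of_pos_left _ (by positivity)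
      · rw [h]
        simp only [hg, hg']
        simp only at h2
        split_ifs <;> simp <;> omega
      · have := (h 1).1 (h1 1 (by simp only; omega))
        simp [hg'] at this
    -- Here only the lower coset is in `D`, and the arc is the single edge labelled `a`.
    · refine Or.inr (Or.inr ⟨_, _, ?_, ?_, toComplex_cell2_mem_spanned_iff_mem_arc (j := 1)
        (k := 2) le_rfl (by norm_num) (by simp only; omega) (fun i h1 h2 => ?_) fun h1 => ?_⟩)
      · gcongr; norm_num
      · simp only
        rw [div_add_one (by positivity)]
        gcongr
        push_cast
        linarith
      · rw [h]
        simp only [hg, hg']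
        split_ifs <;> simp <;> omega
      · have := (h 0).1 (h1 0 (Nat.zero_le _))
        simp [hg] at this
    · exact Or.inr (Or.inl fun i _ => by simp [hg, hg'])

/-- The extension is ascending, `t⁻¹ A t ≤ A`. Therefore `t^N a t^{-m} b = t^N (a · t^{-m} b t^m)
t^{-m}` stays in the removed set. -/
theorem stable_pow_conj_mem_base (m : ℕ) {b : PresGroup (relators R w)} (hb : b ∈ base R w) :
    (stable R w ^ m)⁻¹ * b * stable R w ^ m ∈ base R w := by
  have h1 : base R w ≤ (base R w).comap (MulAut.conj (stable R w)⁻¹).toMonoidHom := by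
    refine (Subgroup.closure_le _).2 ?_
    rintro _ ⟨a, rfl⟩
    change (stable R w)⁻¹ * _ * (stable R w)⁻¹⁻¹ ∈ base R w
    rw [inv_inv, stable_conj]
    exact ofBase_mem_base R w _
  induction m with
  | zero => simpa
  | succ m ih =>
    have := h1 ih
    change (stable R w)⁻¹ * _ * (stable R w)⁻¹⁻¹ ∈ base R w at this
    convert this using 1
    group

theorem mul_mem_removedSet {N M : ℕ} : ∀ g ∈ removedSet R w N M, ∀ b ∈ base R w,
    g * b ∈ removedSet R w N M := by
  rintro _ ⟨a, ha, m, hm, rfl⟩ b hb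
  refine ⟨_, mul_mem ha (stable_pow_conj_mem_base m hb), m, hm, ?_⟩
  group

theorem mul_mem_compl {D : Set (PresGroup (relators R w))}
    (hD : ∀ g ∈ D, ∀ a ∈ base R w, g * a ∈ D) : ∀ g ∈ Dᶜ, ∀ a ∈ base R w, g * a ∈ Dᶜ := by
  intro g hg a ha h
  have := hD _ h _ (inv_mem ha)
  rw [mul_inv_cancel_right] at this
  exact hg this

end AscHNN

theorem theorem5p10
    -- a finitely presented group `A` with a finite presentation `⟨S : R⟩`, and a monomorphism `φ`
    {S A : Type*} [Finite S] [Group A] (R : Set (GenWord S)) (hR : R.Finite)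
    (e : PresGroup R ≃* A) (φ : A →* A) (hφ : Function.Injective φ)
    -- for every generator `a` a word `w a` that represents `φ a`
    (w : S → GenWord S)
    (hw : ∀ a, e (PresGroup.val R (w a)) = φ (e (PresGroup.gen R a)))
    (M N : ℕ) :
    -- the complement in the Cayley 2-complex of the subcomplex spanned by `t ^ N A {1, …, t⁻ᴹ}`
    LoopsNullHomotopicIn
        (Cayley.spanned (AscHNN.relators R w) (AscHNN.removedSet R w N M))ᶜ ∧
      -- the largest subcomplex that contains no vertex of `t ^ N A {1, …, t⁻ᴹ}`
      LoopsNullHomotopicIn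
        (Cayley.spanned (AscHNN.relators R w) (AscHNN.removedSet R w N M)ᶜ) := by
  have hV := AscHNN.mul_mem_compl (AscHNN.mul_mem_removedSet (R := R) (w := w) (N := N) (M := M))
  have hinj := AscHNN.ofBase_injective e φ hφ hw
  exact ⟨AscHNN.loopsNullHomotopicIn hV (AscHNN.fits_compl_spanned AscHNN.mul_mem_removedSet) hinj,
    AscHNN.loopsNullHomotopicIn hV (Cayley.fits_spanned _) hinj⟩
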